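/- **Setting.** Let $T>0$, $d\ge 1$, let $(\Omega,\mathcal F,(\mathcal F_t)_{t\ge0},\mathbb P)$ be a filtered probability space with a standard $d$-dimensional $(\mathcal F_t)$-Brownian motion $W$, and let $\mathbb I_q=\{1,\dots,q\}$ be a finite set of regimes. For $i,j\in\mathbb I_q$ let $b_i:\mathbb R^d\to\mathbb R^d$, $\sigma_i:\mathbb R^d\to\mathbb R^{d\times d}$, $f_i,g_i,c_{ij}:\mathbb R^d\to\mathbb R$ be Lipschitz continuous, with $c_{ii}=0$; $\inf_x c_{ij}(x)>0$ for $j\ne i$; $\inf_x[c_{ij}(x)+c_{jk}(x)-c_{ik}(x)]>0$ for $j\neq i$, $j\ne k$; and $g_i(x)\ge\max_{j}[g_j(x)-c_{ij}(x)]$ for all $x$. Write $|\cdot|$ for the Euclidean norm and $\|Y\|_p=(\mathbb E|Y|^p)^{1/p}$. *Discrete-time problem.* For an integer $m\ge1$ with $h:=T/m\le 1$ put $t_\ell=\ell h$, $\mathbb T_h=\{t_0,\dots,t_m\}$, $\vartheta_{\ell+1}=(W_{t_{\ell+1}}-W_{t_\ell})/\sqrt h$ and $F^h_i(x,z)=x+b_i(x)h+\sigma_i(x)\sqrt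 h\,z$. Let $\mathcal A^h_{t_k,i}$ be the set of switching controls $\alpha=(\tau_n,\iota_n)_{n\ge0}$, where $(\tau_n)$ is a nondecreasing sequence of stopping times valued in $\{t_k,\dots,t_m\}\cup\{\infty\}$, $\iota_n$ is an $\mathcal F_{\tau_n}$-measurable $\mathbb I_q$-valued random variable, $\tau_0=t_k$, $\iota_0=i$, and almost surely $\tau_n>T$ for some $n$. Let $I_t=\iota_n$ for $\tau_n\le t<\tau_{n+1}$, let $N(\alpha)=\#\{n\ge1:\tau_n\le T\}$, and define $\bar X=\bar X^{t_k,x,\alpha}$ by $\bar X_{t_k}=x$ and $\bar X_{t_{\ell+1}}=F^h_{I_{t_\ell}}(\bar X_{t_\ell},\vartheta_{\ell+1})$ for $k\le\ell<m$. Set $$\bar v_i(t_k,x)=\sup_{\alpha\in\mathcal A^h_{t_k,i}}\mathbb E\Big[\sum_{\ell=k}^{m-1}f_{I_{t_\ell}}(\bar X_{t_\ell})h+g_{I_{t_m}}(\bar X_{t_m})-\sum_{n=1}^{N(\alpha)}c_{\iota_{n-1}\iota_n}(\bar X_{\tau_n})\Big],$$ where the expectation is $-\infty$ if the expected total switching cost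 is infinite. *Markovian quantization scheme.* For $\delta,R>0$ let $\mathbb X=\{x\in(\delta/d)\mathbb Z^d:|x|\le R\}$ and let $\mathrm{Proj}_{\mathbb X}$ be a closest-neighbour projection on $\mathbb X$. Let $\vartheta\sim\mathcal N(0,I_d)$ and let $\hat\vartheta$ be a (measurable) closest-neighbour projection of $\vartheta$ on a grid $\{w_1,\dots,w_N\}\subset\mathbb R^d$, $N\ge1$, that is optimal, i.e. minimizes $\|\vartheta-\hat\vartheta\|_2$ among all grids of $N$ points. Define $\hat v_i$ on $\mathbb T_h\times\mathbb X$ by $\hat v_i(t_m,x)=g_i(x)$ and, for $k=m-1,\dots,0$, $$\hat v_i(t_k,x)=\max_{j\in\mathbb I_q}\Big\{\mathbb E\big[\hat v_j\big(t_{k+1},\mathrm{Proj}_{\mathbb X}(F^h_j(x,\hat\vartheta))\big)\big]+f_j(x)h-c_{ij}(x)\Big\}.$$ **Theorem.** There exists a constant $K>0$, not depending on $h$ (nor on $\delta$, $R$, $\mathrm{Proj}_{\mathbb X}$, $N$, the optimal grid, $\hat\vartheta$, $t_k$, $x$, $i$), such that for all such parameters and all $(t_k,x,i)\in\mathbb T_h\times\mathbb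 X\times\mathbb I_q$ the value $\bar v_i(t_k,x)$ is finite and $$\begin{aligned}|\bar v_i(t_k,x)-\hat v_i(t_k,x)|\le{}& K\exp\!\big(Kh^{-1}\|\vartheta-\hat\vartheta\|_2^2\big)\Big(1+|x|+\frac\delta h\Big)\Big[\frac\delta h+h^{-1/2}\|\vartheta-\hat\vartheta\|_2\Big(1+|x|+\frac\delta h\Big)\\&+\frac1{Rh}\exp\!\big(Kh^{-2}\|\vartheta-\hat\vartheta\|_4^4\big)\Big(1+|x|^2+\Big(\frac\delta h\Big)^2\Big)\Big].\end{aligned}$$ If moreover the switching costs $c_{ij}$ do not depend on $x$, then $$\begin{aligned}|\bar v_i(t_k,x)-\hat v_i(t_k,x)|\le{}& K\Big[h^{-1/2}\|\vartheta-\hat\vartheta\|_2\exp\!\big(Kh^{-1}\|\vartheta-\hat\vartheta\|_2^2\big)\Big(1+|x|+\frac\delta h\Big)\\&+\frac\delta h+\frac1{Rh}\exp\!\big(Kh^{-2}\|\vartheta-\hat\vartheta\|_4^4\big)\Big(1+|x|^2+\Big(\frac\delta h\Big)^2\Big)\Big].\end{aligned}$$ -/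

import Mathlib

open MeasureTheory ProbabilityTheory
open scoped NNReal ENNReal

noncomputable section

/-- The state space `ℝ^d` with its Euclidean norm. -/
abbrev Euc (d : ℕ) : Type := EuclideanSpace ℝ (Fin d)

/-- `W` is a standard `d`-dimensional Brownian motion relative to the filtration `𝓕`. -/
structure IsBrownianMotion {Ω : Type*} {mΩ : MeasurableSpace Ω} (P : Measure Ω)
    (𝓕 : Filtration ℝ≥0 mΩ) {d : ℕ} (W : ℝ≥0 → Ω → Euc d) : Prop where
  adapted : Adapted 𝓕 W
  zero : ∀ᵐ ω ∂P, W 0 ω = 0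
  cont : ∀ᵐ ω ∂P, Continuous fun t => W t ω
  indep : ∀ s t : ℝ≥0, s ≤ t →
    Indep (MeasurableSpace.comap (fun ω => W t ω - W s ω) inferInstance) (𝓕 s) P
  law : ∀ s t : ℝ≥0, s ≤ t →
    P.map (fun ω => W t ω - W s ω) =
      (stdGaussian (Euc d)).map fun z => Real.sqrt ((t : ℝ) - s) • z

/-- The coefficients of a switching problem with `q` regimes in `ℝ^d`: drift `b`, volatility `σ`
(a `d × d` matrix, seen as a linear map of `ℝ^d`), running reward `f`, terminal gain `g`, and
cost `c i j` of switching from regime `i` to regime `j`. -/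
structure SwitchingModel (d q : ℕ) where
  b : Fin q → Euc d → Euc d
  σ : Fin q → Euc d → Euc d →L[ℝ] Euc d
  f : Fin q → Euc d → ℝ
  g : Fin q → Euc d → ℝ
  c : Fin q → Fin q → Euc d → ℝ

/-- The standing assumptions: Lipschitz coefficients, uniformly positive switching costs with the
strict triangular condition, and no profit from a switch at the horizon. -/
structure SwitchingModel.StandingAssumptions {d q : ℕ} (M : SwitchingModel d q) : Prop where
  lip_b : ∀ i, ∃ L : ℝ≥0, LipschitzWith L (M.b i)
  lip_σ : ∀ i, ∃ L : ℝ≥0, LipschitzWith L (M.σ i)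
  lip_f : ∀ i, ∃ L : ℝ≥0, LipschitzWith L (M.f i)
  lip_g : ∀ i, ∃ L : ℝ≥0, LipschitzWith L (M.g i)
  lip_c : ∀ i j, ∃ L : ℝ≥0, LipschitzWith L (M.c i j)
  cost_self : ∀ i x, M.c i i x = 0
  cost_pos : ∀ i j, j ≠ i → ∃ ε : ℝ, 0 < ε ∧ ∀ x, ε ≤ M.c i j x
  cost_triangle : ∀ i j k, j ≠ i → j ≠ k →
    ∃ ε : ℝ, 0 < ε ∧ ∀ x, ε ≤ M.c i j x + M.c j k x - M.c i k x
  terminal : ∀ i j x, M.g j x - M.c i j x ≤ M.g i x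

/-- One step of the Euler scheme: `F_i^h(x, z) = x + b_i(x) h + σ_i(x) √h z`. -/
def SwitchingModel.eulerStep {d q : ℕ} (M : SwitchingModel d q) (h : ℝ) (i : Fin q)
    (x z : Euc d) : Euc d :=
  x + h • M.b i x + Real.sqrt h • M.σ i x z

/-- The time `t_ℓ = ℓ T / m`. -/
def gridTime (T : ℝ≥0) (m ℓ : ℕ) : ℝ≥0 := (ℓ : ℝ≥0) * (T / (m : ℝ≥0))

/-- The normalized Brownian increment `ϑ_{ℓ+1} = (W_{t_{ℓ+1}} - W_{t_ℓ}) / √h`, `h = T / m`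
(indexed here by `ℓ`). -/
def normalizedIncrement {Ω : Type*} {d : ℕ} (W : ℝ≥0 → Ω → Euc d) (T : ℝ≥0) (m ℓ : ℕ)
    (ω : Ω) : Euc d :=
  (Real.sqrt ((T : ℝ) / m))⁻¹ • (W (gridTime T m (ℓ + 1)) ω - W (gridTime T m ℓ) ω)

/-- Admissible switching controls `(τ_n, ι_n)` that start from regime `i` at time `t_k` and whose
switching times are valued in `{t_k, …, t_m}`; the value `⊤` means no switch up to the horizon. -/
structure DiscreteControl {Ω : Type*} {mΩ : MeasurableSpace Ω} (P : Measure Ω)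
    (𝓕 : Filtration ℝ≥0 mΩ) {q : ℕ} (T : ℝ≥0) (m k : ℕ) (i : Fin q) where
  τ : ℕ → Ω → WithTop ℝ≥0
  ι : ℕ → Ω → Fin q
  isStoppingTime : ∀ n, IsStoppingTime 𝓕 (τ n)
  measurable_regime : ∀ n, Measurable[(isStoppingTime n).measurableSpace] (ι n)
  mono : ∀ n ω, τ n ω ≤ τ (n + 1) ω
  grid : ∀ n ω, τ n ω = ⊤ ∨
    ∃ ℓ : ℕ, k ≤ ℓ ∧ ℓ ≤ m ∧ τ n ω = ((gridTime T m ℓ : ℝ≥0) : WithTop ℝ≥0)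
  start_time : ∀ ω, τ 0 ω = ((gridTime T m k : ℝ≥0) : WithTop ℝ≥0)
  start_regime : ∀ ω, ι 0 ω = i
  admissible : ∀ᵐ ω ∂P, ∃ n, (T : WithTop ℝ≥0) < τ n ω

namespace DiscreteControl

variable {Ω : Type*} {mΩ : MeasurableSpace Ω} {P : Measure Ω} {𝓕 : Filtration ℝ≥0 mΩ}
  {d q : ℕ} {T : ℝ≥0} {m k : ℕ} {i : Fin q}

open Classical in
/-- The regime at time `t`: the value `ι_n` for the `n` with `τ_n ≤ t < τ_{n+1}` (such an `n` is
unique, and for `t ≥ t_k` it exists almost surely). -/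
def regime (α : DiscreteControl P 𝓕 T m k i) (t : ℝ≥0) (ω : Ω) : Fin q :=
  if hn : ∃ n, α.τ n ω ≤ (t : WithTop ℝ≥0) ∧ (t : WithTop ℝ≥0) < α.τ (n + 1) ω then
    α.ι (Nat.find hn) ω
  else α.ι 0 ω

/-- The controlled Euler scheme started from `x` at time `t_k`; `euler M W x α ℓ` is its value at
time `t_ℓ` for `ℓ ≥ k` (for `ℓ < k` it is put equal to `x`). -/
def euler (M : SwitchingModel d q) (W : ℝ≥0 → Ω → Euc d) (x : Euc d)
    (α : DiscreteControl P 𝓕 T m k i) : ℕ → Ω → Euc d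
  | 0, _ => x
  | ℓ + 1, ω =>
    if k ≤ ℓ then
      M.eulerStep ((T : ℝ) / m) (α.regime (gridTime T m ℓ) ω) (euler M W x α ℓ ω)
        (normalizedIncrement W T m ℓ ω)
    else x

/-- Running reward plus terminal gain:
`∑_{ℓ=k}^{m-1} f(X_{t_ℓ}, I_{t_ℓ}) h + g(X_{t_m}, I_{t_m})`. -/
def reward (M : SwitchingModel d q) (W : ℝ≥0 → Ω → Euc d) (x : Euc d)
    (α : DiscreteControl P 𝓕 T m k i) (ω : Ω) : ℝ :=
  ∑ ℓ ∈ Finset.Ico k m,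
      M.f (α.regime (gridTime T m ℓ) ω) (euler M W x α ℓ ω) * ((T : ℝ) / m) +
    M.g (α.regime (gridTime T m m) ω) (euler M W x α m ω)

open Classical in
/-- The total switching cost `∑_{n ≥ 1, τ_n ≤ T} c(X_{τ_n}, ι_{n-1}, ι_n)`, a sum of nonnegative
terms; the inner sum over `ℓ` only picks out the grid point `t_ℓ` equal to `τ_n`. -/
def totalCost (M : SwitchingModel d q) (W : ℝ≥0 → Ω → Euc d) (x : Euc d)
    (α : DiscreteControl P 𝓕 T m k i) (ω : Ω) : ℝ≥0∞ :=
  ∑' n : ℕ, ∑ ℓ ∈ Finset.Icc k m,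
    if α.τ (n + 1) ω = ((gridTime T m ℓ : ℝ≥0) : WithTop ℝ≥0) then
      ENNReal.ofReal (M.c (α.ι n ω) (α.ι (n + 1) ω) (euler M W x α ℓ ω))
    else 0

/-- The expected total profit of a control: expected reward minus expected cost. It is `-∞` for
a control with infinite expected cost. -/
def expectedProfit (M : SwitchingModel d q) (W : ℝ≥0 → Ω → Euc d) (x : Euc d)
    (α : DiscreteControl P 𝓕 T m k i) : EReal :=
  ((∫ ω, α.reward M W x ω ∂P : ℝ) : EReal) - ((∫⁻ ω, α.totalCost M W x ω ∂P : ℝ≥0∞) : EReal)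

end DiscreteControl

/-- The value function `v̄_i(t_k, x)` of the switching problem for the Euler scheme with `m` time
steps: the supremum of the expected profit over all admissible discrete controls. -/
def eulerValue {Ω : Type*} {mΩ : MeasurableSpace Ω} (P : Measure Ω) (𝓕 : Filtration ℝ≥0 mΩ)
    {d q : ℕ} (M : SwitchingModel d q) (W : ℝ≥0 → Ω → Euc d) (T : ℝ≥0) (m k : ℕ) (i : Fin q)
    (x : Euc d) : EReal :=
  ⨆ α : DiscreteControl P 𝓕 T m k i, α.expectedProfit M W x

/-- The bounded lattice `(δ/d) ℤ^d ∩ B(0, R)` with the closed ball. -/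
def spaceGrid (d : ℕ) (δ R : ℝ) : Set (Euc d) :=
  {x | (∃ z : Fin d → ℤ, ∀ a, x a = δ / d * z a) ∧ ‖x‖ ≤ R}

/-- `p` is a projection on the set `S` following the closest neighbour rule (ties are broken
arbitrarily). -/
def IsClosestNeighbour {E : Type*} [PseudoMetricSpace E] (S : Set E) (p : E → E) : Prop :=
  ∀ y, p y ∈ S ∧ ∀ s ∈ S, dist y (p y) ≤ dist y s

/-- The grid `{w_1, …, w_N}` minimizes the quadratic distortion of the standard normal law among
all grids of `N` points. -/
def IsOptimalGrid {d N : ℕ} (w : Fin N → Euc d) : Prop :=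
  ∀ w' : Fin N → Euc d,
    ∫ z, Metric.infDist z (Set.range w) ^ 2 ∂(stdGaussian (Euc d)) ≤
      ∫ z, Metric.infDist z (Set.range w') ^ 2 ∂(stdGaussian (Euc d))

/-- The quantization error `‖ϑ - ϑ̂‖_p = (E|ϑ - ϑ̂|^p)^{1/p}`, where `ϑ` is standard normal and
`ϑ̂ = quant ϑ`. -/
def quantError {d : ℕ} (quant : Euc d → Euc d) (p : ℝ) : ℝ :=
  (∫ z, ‖z - quant z‖ ^ p ∂(stdGaussian (Euc d))) ^ (1 / p)

/-- The quantized backward scheme with `n` time steps left: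
`û_i(0, x) = g_i(x)` and
`û_i(n+1, x) = max_j { E[û_j(n, Proj(F_j^h(x, ϑ̂)))] + f_j(x) h - c_{ij}(x) }`. -/
def quantizedScheme {d q : ℕ} (M : SwitchingModel d q) (h : ℝ) (proj quant : Euc d → Euc d) :
    ℕ → Fin q → Euc d → ℝ
  | 0, i, x => M.g i x
  | n + 1, i, x => ⨆ j : Fin q,
      ((∫ z, quantizedScheme M h proj quant n j (proj (M.eulerStep h j x (quant z)))
          ∂(stdGaussian (Euc d))) + M.f j x * h - M.c i j x)

/-- The value function `v̂_i(t_k, x)` of the Markovian quantization scheme with `m` time steps. -/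
def quantizedValue {d q : ℕ} (M : SwitchingModel d q) (T : ℝ≥0) (m : ℕ)
    (proj quant : Euc d → Euc d) (k : ℕ) (i : Fin q) (x : Euc d) : ℝ :=
  quantizedScheme M ((T : ℝ) / m) proj quant (m - k) i x

end

/-! ### The weight √(1 + |x|²) -/

section Bracket

variable {d : ℕ}

/-! The proof has a probabilistic half and an analytic half.

Probabilistic half (`eulerValue_eq_eulerScheme`). The value of the control problem is exactly the
backward recursion V = `eulerScheme`, which is `quantizedScheme` with true Gaussian increments and
no projection. Any control gains at most V: its switches at one grid time merge into a single switch
by the triangular condition, a switch at the horizon is useless by the terminal condition, and at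
each step the control is one candidate in the maximum that defines V. A measurable choice of the
maximizing regime gives an admissible control that gains exactly V.

Analytic half (`exists_quantization_bound`). A maximum over regimes does not expand differences, so
the gap between the two recursions is dominated by any E with E_{n+1}(x) at least the sum of the
one-step error E|V_j(F(x,ϑ)) - V_j(Proj F(x,ϑ̂))| and the mean of E_n after a projected quantized
step (`abs_eulerScheme_sub_quantizedScheme_le`). This needs the regularity of V in x, uniformly in
h, and moment bounds for the quantized chain.

Regularity. If the costs are constant they cancel in differences and V is Lipschitz by a direct
induction. Otherwise each switch may add L|x-y| to the difference, and the number of switches of an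
optimal path has to be controlled. This is done by the potential Ψ = K⟨x⟩ - (V + (B+1)⟨x⟩)²/⟨x⟩,
with ⟨x⟩ = √(1+|x|²) and |V| ≤ B⟨x⟩, which lies between ⟨x⟩ and K⟨x⟩. An optimal switch of cost c
means that the continuation value exceeds V by c, so the mean of Ψ falls by at least 2c, up to
O(h)⟨x⟩. Since c ≥ ε, the variation L|x-y| of the cost is at most (L/ε)c|x-y|, and the fall of Ψ
pays for it. Hence V(x) - V(y) is at most a constant times |x-y|Ψ(x) (`eulerScheme_sub_le`). The
delicate point is that the fluctuations of order √h in |F(x)-F(y)|Ψ(F(x)) cost only O(h) in the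
mean: s²/v is the perspective of the square, so it lies above its tangents (`mul_sq_div_ge`), and
only the means of the linear terms matter.

Moments. The function ψ = 1 + |x|² + (δ/h)² grows in one projected quantized step by at most exp(C
h(1 + h⁻¹e₂²)) in the mean, and ψ² by exp(C h(1 + h⁻²e₄⁴)), where e_p is the L^p quantization error.
Over n ≤ T/h steps this gives the two exponentials of the theorem. One step moves the point by √h
times the quantization error, by the mesh δ, and by |y|²/R for the truncation; summing over n ≤ T/h
steps turns these into h^{-1/2}e₂, δ/h and 1/(Rh). -/

/-- The Japanese bracket `√(1 + |x|²)`. -/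
noncomputable def bracket (x : Euc d) : ℝ := √(1 + ‖x‖ ^ 2)

lemma bracket_sq (x : Euc d) : bracket x ^ 2 = 1 + ‖x‖ ^ 2 :=
  Real.sq_sqrt (by positivity)

lemma one_le_bracket (x : Euc d) : 1 ≤ bracket x :=
  Real.one_le_sqrt.2 (by nlinarith [sq_nonneg ‖x‖])

lemma bracket_pos (x : Euc d) : 0 < bracket x := one_pos.trans_le (one_le_bracket x)

lemma norm_le_bracket (x : Euc d) : ‖x‖ ≤ bracket x :=
  Real.le_sqrt_of_sq_le (by linarith)

/-- The bracket is the norm of (1, x) in ℝ × ℝ^d, and this is Cauchy–Schwarz there. It serves to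
bound the mean of the bracket from below by testing against (1, x). -/
lemma one_add_inner_le_bracket_mul (x y : Euc d) :
    1 + inner ℝ x y ≤ bracket x * bracket y := by
  have h1 : inner ℝ x y ≤ ‖x‖ * ‖y‖ := real_inner_le_norm x y
  have h2 : (1 + ‖x‖ * ‖y‖) ^ 2 ≤ (bracket x * bracket y) ^ 2 := by
    rw [mul_pow, bracket_sq, bracket_sq]; nlinarith [sq_nonneg (‖x‖ - ‖y‖)]
  have h3 := abs_le_of_sq_le_sq' h2 (mul_nonneg (bracket_pos x).le (bracket_pos y).le)
  linarith [h3.2]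

lemma bracket_le_add (x y : Euc d) : bracket x ≤ bracket y + ‖x - y‖ := by
  have h1 : ‖x‖ ≤ ‖y‖ + ‖x - y‖ := by
    have := norm_add_le y (x - y); simpa using this
  refine Real.sqrt_le_iff.2 ⟨add_nonneg (bracket_pos y).le (norm_nonneg _), ?_⟩
  nlinarith [bracket_sq y, norm_le_bracket y, norm_nonneg (x - y), norm_nonneg x, norm_nonneg y]

lemma continuous_bracket : Continuous (bracket : Euc d → ℝ) := by
  unfold bracket; fun_prop

end Bracket

/-! ### Moments of affine images of a standard Gaussian -/

section GaussianMoments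

variable {d : ℕ}

/-- The fourth moment of `1 + |ϑ|` for a standard normal `ϑ`. -/
noncomputable def gaussMoment (d : ℕ) : ℝ := ∫ z, (1 + ‖z‖) ^ 4 ∂(stdGaussian (Euc d))

lemma integrable_one_add_norm_pow (n : ℕ) :
    Integrable (fun z : Euc d => (1 + ‖z‖) ^ n) (stdGaussian (Euc d)) := by
  have h := IsGaussian.memLp_id (stdGaussian (Euc d)) (n : ℝ≥0∞) (by simp)
  have h1 : MemLp (fun z : Euc d => 1 + ‖z‖) n (stdGaussian (Euc d)) :=
    (memLp_const (1 : ℝ)).add h.norm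
  have := h1.integrable_norm_pow'
  refine this.congr (Filter.Eventually.of_forall fun z => ?_)
  simp only [Real.norm_eq_abs]
  rw [abs_of_nonneg (by positivity)]

lemma integrable_of_abs_le_pow {f : Euc d → ℝ} (hf : Measurable f) {C : ℝ} (n : ℕ)
    (h : ∀ z, |f z| ≤ C * (1 + ‖z‖) ^ n) : Integrable f (stdGaussian (Euc d)) :=
  ((integrable_one_add_norm_pow n).const_mul C).mono' hf.aestronglyMeasurable
    (Filter.Eventually.of_forall fun z => by simpa using h z)

lemma one_add_norm_pow_le_four (z : Euc d) {n : ℕ} (hn : n ≤ 4) :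
    (1 + ‖z‖) ^ n ≤ (1 + ‖z‖) ^ 4 :=
  pow_le_pow_right₀ (by linarith [norm_nonneg z]) hn

lemma integral_one_add_norm_pow_le {n : ℕ} (hn : n ≤ 4) :
    ∫ z, (1 + ‖z‖) ^ n ∂(stdGaussian (Euc d)) ≤ gaussMoment d :=
  integral_mono (integrable_one_add_norm_pow n) (integrable_one_add_norm_pow 4)
    fun z => one_add_norm_pow_le_four z hn

lemma one_le_gaussMoment : 1 ≤ gaussMoment d := by
  simpa using integral_one_add_norm_pow_le (d := d) (n := 0) (by norm_num)

lemma integral_inner_clm (v : Euc d) (A : Euc d →L[ℝ] Euc d) :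
    ∫ z, inner ℝ v (A z) ∂(stdGaussian (Euc d)) = 0 :=
  integral_strongDual_stdGaussian ((innerSL ℝ v).comp A)

lemma integrable_inner_clm (v : Euc d) (A : Euc d →L[ℝ] Euc d) :
    Integrable (fun z => inner ℝ v (A z)) (stdGaussian (Euc d)) :=
  IsGaussian.integrable_dual _ ((innerSL ℝ v).comp A)

lemma integrable_sq_norm_clm (A : Euc d →L[ℝ] Euc d) :
    Integrable (fun z => ‖A z‖ ^ 2) (stdGaussian (Euc d)) := by
  refine integrable_of_abs_le_pow (by fun_prop) (C := ‖A‖ ^ 2) 2 fun z => ?_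
  rw [abs_of_nonneg (by positivity), ← mul_pow]
  have := A.le_opNorm z
  gcongr
  nlinarith [norm_nonneg A]

lemma integral_sq_norm_clm_le (A : Euc d →L[ℝ] Euc d) :
    ∫ z, ‖A z‖ ^ 2 ∂(stdGaussian (Euc d)) ≤ ‖A‖ ^ 2 * gaussMoment d := by
  have h1 : ∫ z, ‖A z‖ ^ 2 ∂(stdGaussian (Euc d)) ≤
      ∫ z, ‖A‖ ^ 2 * (1 + ‖z‖) ^ 2 ∂(stdGaussian (Euc d)) := by
    refine integral_mono (integrable_sq_norm_clm A)
      ((integrable_one_add_norm_pow 2).const_mul _) fun z => ?_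
    simp only
    rw [← mul_pow]
    have := A.le_opNorm z
    gcongr
    nlinarith [norm_nonneg A]
  rw [integral_const_mul] at h1
  exact h1.trans (by gcongr; exact integral_one_add_norm_pow_le (by norm_num))

lemma sq_norm_add_smul_clm (a : Euc d) (A : Euc d →L[ℝ] Euc d) {h : ℝ} (hh : 0 ≤ h) (z : Euc d) :
    ‖a + √h • A z‖ ^ 2 = ‖a‖ ^ 2 + 2 * √h * inner ℝ a (A z) + h * ‖A z‖ ^ 2 := by
  rw [norm_add_sq_real, inner_smul_right, norm_smul, mul_pow, Real.norm_eq_abs, sq_abs,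
    Real.sq_sqrt hh]
  ring

lemma integrable_sq_norm_add_smul_clm (a : Euc d) (A : Euc d →L[ℝ] Euc d) {h : ℝ} (hh : 0 ≤ h) :
    Integrable (fun z => ‖a + √h • A z‖ ^ 2) (stdGaussian (Euc d)) := by
  simp_rw [sq_norm_add_smul_clm a A hh]
  exact ((integrable_const _).add ((integrable_inner_clm a A).const_mul _)).add
    ((integrable_sq_norm_clm A).const_mul _)

/-- The cross term of order √h is linear in `z`, hence centred; only the quadratic term of order h
remains. -/
lemma integral_sq_norm_add_smul_clm_le (a : Euc d) (A : Euc d →L[ℝ] Euc d) {h : ℝ} (hh : 0 ≤ h) :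
    ∫ z, ‖a + √h • A z‖ ^ 2 ∂(stdGaussian (Euc d)) ≤ ‖a‖ ^ 2 + h * (‖A‖ ^ 2 * gaussMoment d) := by
  simp_rw [sq_norm_add_smul_clm a A hh]
  have hi : Integrable (fun z => ‖a‖ ^ 2 + 2 * √h * inner ℝ a (A z)) (stdGaussian (Euc d)) :=
    (integrable_const _).add ((integrable_inner_clm a A).const_mul _)
  rw [integral_add hi ((integrable_sq_norm_clm A).const_mul _), integral_add (integrable_const _)
    ((integrable_inner_clm a A).const_mul _), integral_const_mul, integral_const_mul,
    integral_inner_clm]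
  simp only [integral_const, probReal_univ, one_smul, mul_zero, add_zero]
  gcongr
  exact integral_sq_norm_clm_le A

lemma integral_inner_add_smul_clm (v a : Euc d) (A : Euc d →L[ℝ] Euc d) (s : ℝ) :
    ∫ z, inner ℝ v (a + s • A z) ∂(stdGaussian (Euc d)) = inner ℝ v a := by
  simp_rw [inner_add_right, inner_smul_right]
  rw [integral_add (integrable_const _) ((integrable_inner_clm v A).const_mul _),
    integral_const_mul, integral_inner_clm]
  simp

lemma integrable_inner_add_smul_clm (v a : Euc d) (A : Euc d →L[ℝ] Euc d) (s : ℝ) :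
    Integrable (fun z => inner ℝ v (a + s • A z)) (stdGaussian (Euc d)) := by
  simp_rw [inner_add_right, inner_smul_right]
  exact (integrable_const _).add ((integrable_inner_clm v A).const_mul _)

end GaussianMoments

/-! ### Constants uniform over the finite set of regimes -/

section FiniteFamilies

variable {d : ℕ} {ι : Type*} [Finite ι]

lemma exists_uniform_lipschitz_growth {E : Type*} [NormedAddCommGroup E] (φ : ι → Euc d → E)
    (h : ∀ i, ∃ L : ℝ≥0, LipschitzWith L (φ i)) :
    ∃ L : ℝ, 0 ≤ L ∧ (∀ i x y, ‖φ i x - φ i y‖ ≤ L * ‖x - y‖) ∧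
      ∀ i x, ‖φ i x‖ ≤ L * bracket x := by
  have := Fintype.ofFinite ι
  choose L hL using h
  have hle (i : ι) : (L i : ℝ) + ‖φ i 0‖ ≤ ∑ j, ((L j : ℝ) + ‖φ j 0‖) :=
    Finset.single_le_sum (f := fun j => (L j : ℝ) + ‖φ j 0‖) (fun j _ => by positivity)
      (Finset.mem_univ i)
  refine ⟨∑ i, ((L i : ℝ) + ‖φ i 0‖), Finset.sum_nonneg fun j _ => by positivity,
    fun i x y => ?_, fun i x => ?_⟩
  · refine ((hL i).norm_sub_le x y).trans ?_
    gcongr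
    linarith [hle i, norm_nonneg (φ i 0)]
  · have h1 := (hL i).norm_sub_le x 0
    have h2 : ‖φ i x‖ ≤ ‖φ i 0‖ + ‖φ i x - φ i 0‖ := by
      simpa using norm_add_le (φ i 0) (φ i x - φ i 0)
    rw [sub_zero] at h1
    have h3 : (L i : ℝ) * ‖x‖ ≤ L i * bracket x := by
      gcongr; exact norm_le_bracket x
    have h4 : ‖φ i 0‖ ≤ ‖φ i 0‖ * bracket x :=
      le_mul_of_one_le_right (norm_nonneg _) (one_le_bracket x)
    have h5 := mul_le_mul_of_nonneg_right (hle i) (bracket_pos x).le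
    linarith

lemma exists_pos_forall_le (e : ι → ℝ) (he : ∀ i, 0 < e i) : ∃ ε : ℝ, 0 < ε ∧ ∀ i, ε ≤ e i := by
  rcases isEmpty_or_nonempty ι with h | h
  · exact ⟨1, one_pos, fun i => h.elim i⟩
  · obtain ⟨i, hi⟩ := Finite.exists_min e
    exact ⟨e i, he i, hi⟩

lemma abs_ciSup_sub_ciSup_le [Nonempty ι] {a b : ι → ℝ} {C : ℝ} (h : ∀ i, |a i - b i| ≤ C) :
    |(⨆ i, a i) - ⨆ i, b i| ≤ C := by
  rw [abs_le]
  constructor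
  · have : (⨆ i, b i) ≤ (⨆ i, a i) + C := ciSup_le fun i => by
      linarith [le_ciSup (Set.finite_range a).bddAbove i, (abs_le.1 (h i)).1]
    linarith
  · have : (⨆ i, a i) ≤ (⨆ i, b i) + C := ciSup_le fun i => by
      linarith [le_ciSup (Set.finite_range b).bddAbove i, (abs_le.1 (h i)).2]
    linarith

end FiniteFamilies

/-- Quantitative form of the standing assumptions, with constants uniform over the regimes. -/
structure SwitchingModel.UniformBounds {d q : ℕ} (M : SwitchingModel d q) (L ε : ℝ) : Prop where
  one_le : 1 ≤ L
  pos : 0 < ε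
  b_lip : ∀ i x y, ‖M.b i x - M.b i y‖ ≤ L * ‖x - y‖
  σ_lip : ∀ i x y, ‖M.σ i x - M.σ i y‖ ≤ L * ‖x - y‖
  f_lip : ∀ i x y, |M.f i x - M.f i y| ≤ L * ‖x - y‖
  g_lip : ∀ i x y, |M.g i x - M.g i y| ≤ L * ‖x - y‖
  c_lip : ∀ i j x y, |M.c i j x - M.c i j y| ≤ L * ‖x - y‖
  b_le : ∀ i x, ‖M.b i x‖ ≤ L * bracket x
  σ_le : ∀ i x, ‖M.σ i x‖ ≤ L * bracket x
  f_le : ∀ i x, |M.f i x| ≤ L * bracket x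
  g_le : ∀ i x, |M.g i x| ≤ L * bracket x
  c_le : ∀ i j x, |M.c i j x| ≤ L * bracket x
  c_self : ∀ i x, M.c i i x = 0
  c_pos : ∀ i j, j ≠ i → ∀ x, ε ≤ M.c i j x
  c_triangle : ∀ i j k x, M.c i k x ≤ M.c i j x + M.c j k x
  terminal : ∀ i j x, M.g j x - M.c i j x ≤ M.g i x

/-- The finitely many constants are summed, and the added 1 gives `1 ≤ L`. The triangular condition
is kept in weak form, in which it also holds for degenerate triples because the diagonal costs
vanish. -/
lemma SwitchingModel.StandingAssumptions.exists_uniformBounds {d q : ℕ} {M : SwitchingModel d q}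
    (hM : M.StandingAssumptions) : ∃ L ε : ℝ, M.UniformBounds L ε := by
  obtain ⟨Lb, hb0, hb, hb'⟩ := exists_uniform_lipschitz_growth M.b hM.lip_b
  obtain ⟨Lσ, hσ0, hσ, hσ'⟩ := exists_uniform_lipschitz_growth M.σ hM.lip_σ
  obtain ⟨Lf, hf0, hf, hf'⟩ := exists_uniform_lipschitz_growth M.f hM.lip_f
  obtain ⟨Lg, hg0, hg, hg'⟩ := exists_uniform_lipschitz_growth M.g hM.lip_g
  obtain ⟨Lc, hc0, hc, hc'⟩ := exists_uniform_lipschitz_growth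
    (fun p : Fin q × Fin q => M.c p.1 p.2) fun p => hM.lip_c p.1 p.2
  have hpos : ∃ ε : ℝ, 0 < ε ∧ ∀ i j, j ≠ i → ∀ x, ε ≤ M.c i j x := by
    have : ∀ p : Fin q × Fin q, ∃ ε : ℝ, 0 < ε ∧ (p.2 ≠ p.1 → ∀ x, ε ≤ M.c p.1 p.2 x) := by
      rintro ⟨i, j⟩
      by_cases hij : j = i
      · exact ⟨1, one_pos, fun h => absurd hij h⟩
      · obtain ⟨ε, h1, h2⟩ := hM.cost_pos i j hij
        exact ⟨ε, h1, fun _ => h2⟩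
    choose e he he' using this
    obtain ⟨ε, h1, h2⟩ := exists_pos_forall_le e he
    exact ⟨ε, h1, fun i j hij x => (h2 (i, j)).trans (he' (i, j) hij x)⟩
  obtain ⟨ε, hε, hε'⟩ := hpos
  have key {K : ℝ} (hK : K ≤ 1 + Lb + Lσ + Lf + Lg + Lc) {a b : ℝ} (hb : 0 ≤ b) (h : a ≤ K * b) :
      a ≤ (1 + Lb + Lσ + Lf + Lg + Lc) * b := h.trans (by gcongr)
  refine ⟨1 + Lb + Lσ + Lf + Lg + Lc, ε, by linarith, hε,
    fun i x y => key (by linarith) (norm_nonneg _) (hb i x y),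
    fun i x y => key (by linarith) (norm_nonneg _) (hσ i x y),
    fun i x y => key (by linarith) (norm_nonneg _) (hf i x y),
    fun i x y => key (by linarith) (norm_nonneg _) (hg i x y),
    fun i j x y => key (by linarith) (norm_nonneg _) (hc (i, j) x y),
    fun i x => key (by linarith) (bracket_pos x).le (hb' i x),
    fun i x => key (by linarith) (bracket_pos x).le (hσ' i x),
    fun i x => key (by linarith) (bracket_pos x).le (hf' i x),
    fun i x => key (by linarith) (bracket_pos x).le (hg' i x),
    fun i j x => key (by linarith) (bracket_pos x).le (hc' (i, j) x),
    hM.cost_self, hε', fun i j k x => ?_, hM.terminal⟩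
  by_cases hij : j = i
  · subst hij; simp [hM.cost_self]
  by_cases hjk : j = k
  · subst hjk; simp [hM.cost_self]
  obtain ⟨e, he, he'⟩ := hM.cost_triangle i j k hij hjk
  linarith [he' x]

/-! ### One Euler step: increments and moments -/

namespace SwitchingModel.UniformBounds

variable {d q : ℕ} {M : SwitchingModel d q} {L ε : ℝ}

lemma pos_L (H : M.UniformBounds L ε) : 0 < L := one_pos.trans_le H.one_le

lemma c_nonneg (H : M.UniformBounds L ε) (i j : Fin q) (x : Euc d) : 0 ≤ M.c i j x := by
  by_cases h : j = i
  · subst h; rw [H.c_self]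
  · exact H.pos.le.trans (H.c_pos i j h x)

lemma continuous_of_lip {E : Type*} [NormedAddCommGroup E] {φ : Euc d → E} {L : ℝ}
    (h : ∀ x y, ‖φ x - φ y‖ ≤ L * ‖x - y‖) : Continuous φ :=
  (LipschitzWith.of_dist_le_mul (K := L.toNNReal) fun x y => by
    rw [dist_eq_norm, dist_eq_norm]
    exact (h x y).trans (by gcongr; exact Real.le_coe_toNNReal L)).continuous

lemma continuous_b (H : M.UniformBounds L ε) (i : Fin q) : Continuous (M.b i) :=
  continuous_of_lip (H.b_lip i)

lemma continuous_σ (H : M.UniformBounds L ε) (i : Fin q) : Continuous (M.σ i) :=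
  continuous_of_lip (H.σ_lip i)

lemma continuous_f (H : M.UniformBounds L ε) (i : Fin q) : Continuous (M.f i) :=
  continuous_of_lip (H.f_lip i)

lemma continuous_g (H : M.UniformBounds L ε) (i : Fin q) : Continuous (M.g i) :=
  continuous_of_lip (H.g_lip i)

lemma continuous_c (H : M.UniformBounds L ε) (i j : Fin q) : Continuous (M.c i j) :=
  continuous_of_lip (H.c_lip i j)

lemma continuous_eulerStep (H : M.UniformBounds L ε) (h : ℝ) (i : Fin q) :
    Continuous fun p : Euc d × Euc d => M.eulerStep h i p.1 p.2 := by
  unfold SwitchingModel.eulerStep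
  have h1 := H.continuous_b i
  have h2 := H.continuous_σ i
  exact (continuous_fst.add ((h1.comp continuous_fst).const_smul h)).add
    (((h2.comp continuous_fst).clm_apply continuous_snd).const_smul (√h))

lemma measurable_eulerStep (H : M.UniformBounds L ε) (h : ℝ) (i : Fin q) (x : Euc d) :
    Measurable fun z => M.eulerStep h i x z :=
  ((H.continuous_eulerStep h i).comp (Continuous.prodMk_right x)).measurable

variable {h : ℝ}

lemma le_sqrt_self (h0 : 0 ≤ h) (h1 : h ≤ 1) : h ≤ √h :=
  Real.le_sqrt_of_sq_le (by nlinarith)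

/-- Since h ≤ √h for h ≤ 1, drift and noise are measured together: the relative fluctuation of one
step is √h times L(1 + |z|). -/
lemma norm_eulerStep_sub_self_le (H : M.UniformBounds L ε) (h0 : 0 ≤ h) (h1 : h ≤ 1)
    (j : Fin q) (x z : Euc d) :
    ‖M.eulerStep h j x z - x‖ ≤ √h * (L * (1 + ‖z‖)) * bracket x := by
  have e : M.eulerStep h j x z - x = h • M.b j x + √h • M.σ j x z := by
    unfold SwitchingModel.eulerStep; abel
  have hs := le_sqrt_self h0 h1
  have e1 : ‖h • M.b j x‖ ≤ √h * (L * bracket x) := by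
    rw [norm_smul, Real.norm_of_nonneg h0]
    exact mul_le_mul hs (H.b_le j x) (norm_nonneg _) (Real.sqrt_nonneg h)
  have e2 : ‖√h • M.σ j x z‖ ≤ √h * (L * bracket x * ‖z‖) := by
    rw [norm_smul, Real.norm_of_nonneg (Real.sqrt_nonneg h)]
    gcongr
    exact ((M.σ j x).le_opNorm z).trans (by gcongr; exact H.σ_le j x)
  rw [e]
  calc _ ≤ _ := norm_add_le _ _
    _ ≤ _ := add_le_add e1 e2
    _ = _ := by ring

lemma eulerStep_sub_eulerStep (j : Fin q) (x y z : Euc d) :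
    M.eulerStep h j x z - M.eulerStep h j y z =
      (x - y + h • (M.b j x - M.b j y)) + √h • (M.σ j x - M.σ j y) z := by
  simp only [SwitchingModel.eulerStep, sub_apply, smul_sub]; abel

lemma norm_eulerStep_sub_sub_le (H : M.UniformBounds L ε) (h0 : 0 ≤ h) (h1 : h ≤ 1)
    (j : Fin q) (x y z : Euc d) :
    ‖M.eulerStep h j x z - M.eulerStep h j y z - (x - y)‖ ≤
      √h * (L * (1 + ‖z‖)) * ‖x - y‖ := by
  have e : M.eulerStep h j x z - M.eulerStep h j y z - (x - y) =
      h • (M.b j x - M.b j y) + √h • (M.σ j x - M.σ j y) z := by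
    rw [eulerStep_sub_eulerStep]; abel
  have hs := le_sqrt_self h0 h1
  have e1 : ‖h • (M.b j x - M.b j y)‖ ≤ √h * (L * ‖x - y‖) := by
    rw [norm_smul, Real.norm_of_nonneg h0]
    exact mul_le_mul hs (H.b_lip j x y) (norm_nonneg _) (Real.sqrt_nonneg h)
  have e2 : ‖√h • (M.σ j x - M.σ j y) z‖ ≤ √h * (L * ‖x - y‖ * ‖z‖) := by
    rw [norm_smul, Real.norm_of_nonneg (Real.sqrt_nonneg h)]
    gcongr
    exact ((M.σ j x - M.σ j y).le_opNorm z).trans (by gcongr; exact H.σ_lip j x y)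
  rw [e]
  calc _ ≤ _ := norm_add_le _ _
    _ ≤ _ := add_le_add e1 e2
    _ = _ := by ring

lemma bracket_eulerStep_le (H : M.UniformBounds L ε) (h0 : 0 ≤ h) (h1 : h ≤ 1)
    (j : Fin q) (x z : Euc d) :
    bracket (M.eulerStep h j x z) ≤ 2 * L * bracket x * (1 + ‖z‖) := by
  have e1 := bracket_le_add (M.eulerStep h j x z) x
  have e2 := H.norm_eulerStep_sub_self_le h0 h1 j x z
  have e3 : √h * (L * (1 + ‖z‖)) * bracket x ≤ 1 * (L * (1 + ‖z‖)) * bracket x := by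
    have := bracket_pos x
    have := H.pos_L
    gcongr
    exact Real.sqrt_le_one.2 h1
  have e4 : bracket x ≤ L * (1 + ‖z‖) * bracket x :=
    le_mul_of_one_le_left (bracket_pos x).le
      (one_le_mul_of_one_le_of_one_le H.one_le (by linarith [norm_nonneg z]))
  linarith

/-- The growth constant of one Euler step. -/
noncomputable def stepConst (d : ℕ) (L : ℝ) : ℝ := 2 * L ^ 2 * gaussMoment d

/-- Common core of two estimates: with `r = ‖x - y‖` it is applied to the difference of two Euler
steps, with `r = bracket x` to a single one. -/
lemma integral_sq_bound {a : Euc d} {A : Euc d →L[ℝ] Euc d} (hL : 1 ≤ L) (h0 : 0 ≤ h)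
    (h1 : h ≤ 1) {x u : Euc d} {r : ℝ} (hx : ‖x‖ ≤ r)
    (hu : ‖u‖ ≤ L * r) (hA : ‖A‖ ≤ L * r) (ha : a = x + h • u) :
    ∫ z, ‖a + √h • A z‖ ^ 2 ∂(stdGaussian (Euc d)) ≤
      ‖x‖ ^ 2 + 2 * stepConst d L * h * r ^ 2 := by
  refine (integral_sq_norm_add_smul_clm_le a A h0).trans ?_
  have hr : 0 ≤ r := (norm_nonneg _).trans hx
  have e1 : ‖a‖ ≤ ‖x‖ + h * (L * r) := by
    rw [ha]
    refine (norm_add_le _ _).trans ?_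
    rw [norm_smul, Real.norm_of_nonneg h0]
    gcongr
  have e2 : ‖a‖ ^ 2 ≤ (‖x‖ + h * (L * r)) ^ 2 := by gcongr
  have e3 : ‖A‖ ^ 2 * gaussMoment d ≤ (L * r) ^ 2 * gaussMoment d := by
    have := one_le_gaussMoment (d := d)
    gcongr
  have e4 : (L * r) ^ 2 ≤ (L * r) ^ 2 * gaussMoment d :=
    le_mul_of_one_le_right (by positivity) one_le_gaussMoment
  have e5 : L * r ^ 2 ≤ L ^ 2 * r ^ 2 := by nlinarith [sq_nonneg r]
  have e6 : ‖x‖ * (h * (L * r)) ≤ r * (h * (L * r)) := by gcongr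
  have e7 : (h * (L * r)) ^ 2 ≤ h * (L * r) ^ 2 := by
    rw [mul_pow]; gcongr; nlinarith
  unfold stepConst
  have e8 := mul_le_mul_of_nonneg_left e3 h0
  have e9 := mul_le_mul_of_nonneg_left e4 h0
  have e10 := mul_le_mul_of_nonneg_left e5 h0
  nlinarith

lemma integrable_norm_eulerStep_sub (H : M.UniformBounds L ε) (h0 : 0 ≤ h) (h1 : h ≤ 1)
    (j : Fin q) (x y : Euc d) :
    Integrable (fun z => ‖M.eulerStep h j x z - M.eulerStep h j y z‖) (stdGaussian (Euc d)) := by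
  refine integrable_of_abs_le_pow
    (((H.measurable_eulerStep h j x).sub (H.measurable_eulerStep h j y)).norm)
    (C := 2 * L * ‖x - y‖) 1 fun z => ?_
  have e1 := H.norm_eulerStep_sub_sub_le h0 h1 j x y z
  have e2 := norm_add_le (M.eulerStep h j x z - M.eulerStep h j y z - (x - y)) (x - y)
  rw [sub_add_cancel] at e2
  have e3 : √h * (L * (1 + ‖z‖)) * ‖x - y‖ ≤ 1 * (L * (1 + ‖z‖)) * ‖x - y‖ := by
    have := H.pos_L
    gcongr
    exact Real.sqrt_le_one.2 h1
  have e4 : ‖x - y‖ ≤ L * (1 + ‖z‖) * ‖x - y‖ :=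
    le_mul_of_one_le_left (norm_nonneg _)
      (one_le_mul_of_one_le_of_one_le H.one_le (by linarith [norm_nonneg z]))
  rw [abs_of_nonneg (norm_nonneg _), pow_one]
  linarith

/-- The second moment is (1 + O(h))r² with r = |x - y|. The inequality w ≤ w²/(2r) + r/2 passes to
the first moment without losing the order h. -/
lemma integral_norm_eulerStep_sub_le (H : M.UniformBounds L ε) (h0 : 0 ≤ h) (h1 : h ≤ 1)
    (j : Fin q) (x y : Euc d) :
    ∫ z, ‖M.eulerStep h j x z - M.eulerStep h j y z‖ ∂(stdGaussian (Euc d)) ≤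
      (1 + stepConst d L * h) * ‖x - y‖ := by
  rcases eq_or_ne x y with rfl | hxy
  · simp
  have hr : 0 < ‖x - y‖ := norm_pos_iff.2 (sub_ne_zero.2 hxy)
  have e1 : ∫ z, ‖M.eulerStep h j x z - M.eulerStep h j y z‖ ^ 2 ∂(stdGaussian (Euc d)) ≤
      ‖x - y‖ ^ 2 + 2 * stepConst d L * h * ‖x - y‖ ^ 2 := by
    simp_rw [eulerStep_sub_eulerStep]
    exact integral_sq_bound H.one_le h0 h1 le_rfl (H.b_lip j x y) (H.σ_lip j x y) rfl
  have hi : Integrable (fun z => ‖M.eulerStep h j x z - M.eulerStep h j y z‖ ^ 2)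
      (stdGaussian (Euc d)) := by
    simp_rw [eulerStep_sub_eulerStep]
    exact integrable_sq_norm_add_smul_clm _ _ h0
  have e2 : ∫ z, ‖M.eulerStep h j x z - M.eulerStep h j y z‖ ∂(stdGaussian (Euc d)) ≤
      ∫ z, (‖M.eulerStep h j x z - M.eulerStep h j y z‖ ^ 2 * (2 * ‖x - y‖)⁻¹ + ‖x - y‖ / 2)
        ∂(stdGaussian (Euc d)) := by
    refine integral_mono (H.integrable_norm_eulerStep_sub h0 h1 j x y)
      ((hi.mul_const _).add (integrable_const _)) fun z => ?_
    simp only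
    set w := ‖M.eulerStep h j x z - M.eulerStep h j y z‖
    have : w ^ 2 * (2 * ‖x - y‖)⁻¹ + ‖x - y‖ / 2 - w = (w - ‖x - y‖) ^ 2 * (2 * ‖x - y‖)⁻¹ := by
      field_simp; ring
    have h3 : 0 ≤ (w - ‖x - y‖) ^ 2 * (2 * ‖x - y‖)⁻¹ := by positivity
    linarith
  rw [integral_add (hi.mul_const _) (integrable_const _), integral_mul_const] at e2
  simp only [integral_const, probReal_univ, one_smul] at e2
  refine e2.trans ?_
  calc _ ≤ (‖x - y‖ ^ 2 + 2 * stepConst d L * h * ‖x - y‖ ^ 2) * (2 * ‖x - y‖)⁻¹ + ‖x - y‖ / 2 := by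
        gcongr
    _ = _ := by field_simp; ring

/-- Test the difference against the direction x - y: the Gaussian part is centred and only the
drift, of order h, is left. Together with the upper bound this pins the mean expansion ratio to 1 +
O(h), although its fluctuations are of order √h. -/
lemma le_integral_norm_eulerStep_sub (H : M.UniformBounds L ε) (h0 : 0 ≤ h) (h1 : h ≤ 1)
    (j : Fin q) (x y : Euc d) :
    (1 - L * h) * ‖x - y‖ ≤
      ∫ z, ‖M.eulerStep h j x z - M.eulerStep h j y z‖ ∂(stdGaussian (Euc d)) := by
  rcases eq_or_ne x y with rfl | hxy
  · simp
  have hr : 0 < ‖x - y‖ := norm_pos_iff.2 (sub_ne_zero.2 hxy)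
  have e1 : ∫ z, inner ℝ (x - y) (M.eulerStep h j x z - M.eulerStep h j y z)
        ∂(stdGaussian (Euc d)) ≤
      ∫ z, ‖x - y‖ * ‖M.eulerStep h j x z - M.eulerStep h j y z‖ ∂(stdGaussian (Euc d)) := by
    refine integral_mono ?_ ((H.integrable_norm_eulerStep_sub h0 h1 j x y).const_mul _)
      fun z => real_inner_le_norm _ _
    simp_rw [eulerStep_sub_eulerStep]
    exact integrable_inner_add_smul_clm _ _ _ _
  rw [integral_const_mul] at e1
  have e2 : ∫ z, inner ℝ (x - y) (M.eulerStep h j x z - M.eulerStep h j y z)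
        ∂(stdGaussian (Euc d)) = ‖x - y‖ ^ 2 + h * inner ℝ (x - y) (M.b j x - M.b j y) := by
    simp_rw [eulerStep_sub_eulerStep]
    rw [integral_inner_add_smul_clm, inner_add_right, inner_smul_right, real_inner_self_eq_norm_sq]
  have e3 : -(‖x - y‖ * (L * ‖x - y‖)) ≤ inner ℝ (x - y) (M.b j x - M.b j y) := by
    have := (abs_le.1 (abs_real_inner_le_norm (x - y) (M.b j x - M.b j y))).1
    have h4 := mul_le_mul_of_nonneg_left (H.b_lip j x y) hr.le
    linarith
  have e4 := mul_le_mul_of_nonneg_left e3 h0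
  rw [e2] at e1
  have e5 : ‖x - y‖ * ((1 - L * h) * ‖x - y‖) ≤ ‖x - y‖ *
      ∫ z, ‖M.eulerStep h j x z - M.eulerStep h j y z‖ ∂(stdGaussian (Euc d)) := by nlinarith
  exact le_of_mul_le_mul_left e5 hr

lemma integrable_bracket_eulerStep (H : M.UniformBounds L ε) (h0 : 0 ≤ h) (h1 : h ≤ 1)
    (j : Fin q) (x : Euc d) :
    Integrable (fun z => bracket (M.eulerStep h j x z)) (stdGaussian (Euc d)) := by
  refine integrable_of_abs_le_pow (continuous_bracket.measurable.comp
    (H.measurable_eulerStep h j x)) (C := 2 * L * bracket x) 1 fun z => ?_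
  rw [abs_of_pos (bracket_pos _), pow_one]
  exact H.bracket_eulerStep_le h0 h1 j x z

lemma integral_bracket_eulerStep_le (H : M.UniformBounds L ε) (h0 : 0 ≤ h) (h1 : h ≤ 1)
    (j : Fin q) (x : Euc d) :
    ∫ z, bracket (M.eulerStep h j x z) ∂(stdGaussian (Euc d)) ≤
      (1 + stepConst d L * h) * bracket x := by
  have hr : 0 < bracket x := bracket_pos x
  have hi : Integrable (fun z => ‖M.eulerStep h j x z‖ ^ 2) (stdGaussian (Euc d)) :=
    integrable_sq_norm_add_smul_clm _ _ h0
  have e1 : ∫ z, ‖M.eulerStep h j x z‖ ^ 2 ∂(stdGaussian (Euc d)) ≤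
      ‖x‖ ^ 2 + 2 * stepConst d L * h * bracket x ^ 2 :=
    integral_sq_bound H.one_le h0 h1 (norm_le_bracket x) (H.b_le j x) (H.σ_le j x) rfl
  have e2 : ∫ z, bracket (M.eulerStep h j x z) ∂(stdGaussian (Euc d)) ≤
      ∫ z, ((1 + ‖M.eulerStep h j x z‖ ^ 2) * (2 * bracket x)⁻¹ + bracket x / 2)
        ∂(stdGaussian (Euc d)) := by
    refine integral_mono (H.integrable_bracket_eulerStep h0 h1 j x)
      ((((integrable_const _).add hi).mul_const _).add (integrable_const _)) fun z => ?_
    simp only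
    rw [← bracket_sq]
    set w := bracket (M.eulerStep h j x z)
    have : w ^ 2 * (2 * bracket x)⁻¹ + bracket x / 2 - w =
        (w - bracket x) ^ 2 * (2 * bracket x)⁻¹ := by
      field_simp; ring
    have h3 : 0 ≤ (w - bracket x) ^ 2 * (2 * bracket x)⁻¹ := by positivity
    linarith
  have hi' : Integrable (fun z => (1 + ‖M.eulerStep h j x z‖ ^ 2) * (2 * bracket x)⁻¹)
      (stdGaussian (Euc d)) := ((integrable_const _).add hi).mul_const _
  rw [integral_add hi' (integrable_const _), integral_mul_const, integral_add (integrable_const _) hi] at e2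
  simp only [integral_const, probReal_univ, one_smul] at e2
  refine e2.trans ?_
  calc _ ≤ (1 + (‖x‖ ^ 2 + 2 * stepConst d L * h * bracket x ^ 2)) * (2 * bracket x)⁻¹ +
        bracket x / 2 := by gcongr
    _ = (bracket x ^ 2 + 2 * stepConst d L * h * bracket x ^ 2) * (2 * bracket x)⁻¹ +
        bracket x / 2 := by rw [← add_assoc, ← bracket_sq]
    _ = _ := by field_simp; ring

lemma le_integral_bracket_eulerStep (H : M.UniformBounds L ε) (h0 : 0 ≤ h) (h1 : h ≤ 1)
    (j : Fin q) (x : Euc d) :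
    (1 - L * h) * bracket x ≤ ∫ z, bracket (M.eulerStep h j x z) ∂(stdGaussian (Euc d)) := by
  have hr : 0 < bracket x := bracket_pos x
  have hi : Integrable (fun z => inner ℝ x (M.eulerStep h j x z)) (stdGaussian (Euc d)) :=
    integrable_inner_add_smul_clm _ _ _ _
  have e1 : ∫ z, (1 + inner ℝ x (M.eulerStep h j x z)) ∂(stdGaussian (Euc d)) ≤
      ∫ z, bracket x * bracket (M.eulerStep h j x z) ∂(stdGaussian (Euc d)) :=
    integral_mono ((integrable_const _).add hi)
      ((H.integrable_bracket_eulerStep h0 h1 j x).const_mul _)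
      fun z => one_add_inner_le_bracket_mul _ _
  rw [integral_const_mul, integral_add (integrable_const _) hi] at e1
  have e2 : ∫ z, inner ℝ x (M.eulerStep h j x z) ∂(stdGaussian (Euc d)) =
      ‖x‖ ^ 2 + h * inner ℝ x (M.b j x) := by
    unfold SwitchingModel.eulerStep
    rw [integral_inner_add_smul_clm, inner_add_right, inner_smul_right, real_inner_self_eq_norm_sq]
  have e3 : -(bracket x * (L * bracket x)) ≤ inner ℝ x (M.b j x) := by
    have := (abs_le.1 (abs_real_inner_le_norm x (M.b j x))).1
    have h4 := mul_le_mul (norm_le_bracket x) (H.b_le j x) (norm_nonneg _) hr.le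
    linarith
  have e4 := mul_le_mul_of_nonneg_left e3 h0
  simp only [integral_const, probReal_univ, one_smul, e2] at e1
  have e5 : bracket x * ((1 - L * h) * bracket x) ≤ bracket x *
      ∫ z, bracket (M.eulerStep h j x z) ∂(stdGaussian (Euc d)) := by
    nlinarith [bracket_sq x]
  exact le_of_mul_le_mul_left e5 hr

end SwitchingModel.UniformBounds

/-! ### The backward scheme with Gaussian increments: growth, and Lipschitz bound for constant costs
-/

section EulerScheme

variable {d q : ℕ} {M : SwitchingModel d q} {L ε h : ℝ}

/-- The dynamic programming scheme of the Euler scheme, without any quantization. -/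
noncomputable def eulerScheme (M : SwitchingModel d q) (h : ℝ) : ℕ → Fin q → Euc d → ℝ :=
  quantizedScheme M h id id

/-- The expected value of staying in regime `j` during the next time step. -/
noncomputable def continuationValue (M : SwitchingModel d q) (h : ℝ) (n : ℕ) (j : Fin q)
    (x : Euc d) : ℝ :=
  (∫ z, eulerScheme M h n j (M.eulerStep h j x z) ∂(stdGaussian (Euc d))) + M.f j x * h

lemma eulerScheme_zero (i : Fin q) (x : Euc d) : eulerScheme M h 0 i x = M.g i x := rfl

lemma eulerScheme_succ (n : ℕ) (i : Fin q) (x : Euc d) :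
    eulerScheme M h (n + 1) i x = ⨆ j, (continuationValue M h n j x - M.c i j x) := rfl

lemma continuationValue_sub_le (n : ℕ) (i j : Fin q) (x : Euc d) :
    continuationValue M h n j x - M.c i j x ≤ eulerScheme M h (n + 1) i x :=
  le_ciSup (f := fun j => continuationValue M h n j x - M.c i j x)
    (Set.finite_range _).bddAbove j

lemma exists_eulerScheme_eq (n : ℕ) (i : Fin q) (x : Euc d) :
    ∃ j, eulerScheme M h (n + 1) i x = continuationValue M h n j x - M.c i j x := by
  have : Nonempty (Fin q) := ⟨i⟩
  obtain ⟨j, hj⟩ := exists_eq_ciSup_of_finite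
    (f := fun j => continuationValue M h n j x - M.c i j x)
  exact ⟨j, hj.symm⟩

namespace SwitchingModel.UniformBounds

lemma measurable_continuationValue_of (H : M.UniformBounds L ε) {n : ℕ} (j : Fin q)
    (hV : Measurable (eulerScheme M h n j)) : Measurable (continuationValue M h n j) := by
  have h1 : Measurable fun p : Euc d × Euc d => eulerScheme M h n j (M.eulerStep h j p.1 p.2) :=
    hV.comp (H.continuous_eulerStep h j).measurable
  have h2 := (h1.stronglyMeasurable.integral_prod_right' (ν := stdGaussian (Euc d))).measurable
  exact h2.add ((H.continuous_f j).measurable.mul_const h)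

lemma measurable_eulerScheme (H : M.UniformBounds L ε) (n : ℕ) (i : Fin q) :
    Measurable (eulerScheme M h n i) := by
  induction n generalizing i with
  | zero => exact (H.continuous_g i).measurable
  | succ n ih =>
    have : eulerScheme M h (n + 1) i =
        fun x => ⨆ j, (continuationValue M h n j x - M.c i j x) := rfl
    rw [this]
    exact Measurable.iSup fun j =>
      (H.measurable_continuationValue_of j (ih j)).sub (H.continuous_c i j).measurable

lemma measurable_continuationValue (H : M.UniformBounds L ε) (n : ℕ) (j : Fin q) :
    Measurable (continuationValue M h n j) :=
  H.measurable_continuationValue_of j (H.measurable_eulerScheme n j)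

lemma stepConst_nonneg : 0 ≤ stepConst d L := by
  have := one_le_gaussMoment (d := d)
  unfold stepConst
  positivity

lemma integrable_comp_eulerStep (H : M.UniformBounds L ε) (h0 : 0 ≤ h) (h1 : h ≤ 1)
    {φ : Euc d → ℝ} (hφ : Measurable φ) {B : ℝ} (hB : ∀ y, |φ y| ≤ B * bracket y) (j : Fin q)
    (x : Euc d) :
    Integrable (fun z => φ (M.eulerStep h j x z)) (stdGaussian (Euc d)) :=
  ((H.integrable_bracket_eulerStep h0 h1 j x).const_mul B).mono'
    (hφ.comp (H.measurable_eulerStep h j x)).aestronglyMeasurable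
    (Filter.Eventually.of_forall fun _ => hB _)

lemma abs_integral_comp_eulerStep_le (H : M.UniformBounds L ε) (h0 : 0 ≤ h) (h1 : h ≤ 1)
    {φ : Euc d → ℝ} {B : ℝ} (hB : ∀ y, |φ y| ≤ B * bracket y) (hB0 : 0 ≤ B)
    (j : Fin q) (x : Euc d) :
    |∫ z, φ (M.eulerStep h j x z) ∂(stdGaussian (Euc d))| ≤
      B * ((1 + stepConst d L * h) * bracket x) := by
  have e1 := norm_integral_le_of_norm_le
    ((H.integrable_bracket_eulerStep h0 h1 j x).const_mul B)
    (f := fun z => φ (M.eulerStep h j x z)) (Filter.Eventually.of_forall fun _ => hB _)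
  rw [integral_const_mul] at e1
  exact e1.trans (mul_le_mul_of_nonneg_left (H.integral_bracket_eulerStep_le h0 h1 j x) hB0)

/-- From above the costs are dropped; from below one stays in the current regime, which is free. The
extra 1 in the rate `stepConst d L + 1` absorbs the running reward, at most L⟨x⟩h per step. -/
lemma abs_eulerScheme_le_pow (H : M.UniformBounds L ε) (h0 : 0 ≤ h) (h1 : h ≤ 1) (n : ℕ)
    (i : Fin q) (x : Euc d) :
    |eulerScheme M h n i x| ≤ L * (1 + (stepConst d L + 1) * h) ^ n * bracket x := by
  induction n generalizing i x with
  | zero => simpa [eulerScheme_zero] using H.g_le i x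
  | succ n ih =>
    have hC := stepConst_nonneg (d := d) (L := L)
    have hL := H.pos_L
    have hx := bracket_pos x
    set a := (1 + (stepConst d L + 1) * h) ^ n with ha
    have ha1 : 1 ≤ a := one_le_pow₀ (by nlinarith)
    have key (j : Fin q) : |continuationValue M h n j x| ≤
        L * (1 + (stepConst d L + 1) * h) ^ (n + 1) * bracket x := by
      have e1 := H.abs_integral_comp_eulerStep_le h0 h1 (ih j) (by positivity) j x
      have e2 : |M.f j x * h| ≤ L * bracket x * h := by
        rw [abs_mul, abs_of_nonneg h0]; gcongr; exact H.f_le j x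
      refine (abs_add_le _ _).trans ((add_le_add e1 e2).trans ?_)
      rw [pow_succ, ← ha]
      have : L * bracket x * h * 1 ≤ L * bracket x * h * a := by gcongr
      nlinarith
    rw [abs_le]
    constructor
    · have e1 := continuationValue_sub_le (M := M) (h := h) n i i x
      rw [H.c_self, sub_zero] at e1
      linarith [(abs_le.1 (key i)).1]
    · obtain ⟨j, hj⟩ := exists_eulerScheme_eq (M := M) (h := h) n i x
      linarith [(abs_le.1 (key j)).2, H.c_nonneg i j x]

lemma one_add_mul_pow_le_exp {C T : ℝ} (hC : 0 ≤ C) (h0 : 0 ≤ h) {n : ℕ} (hn : n * h ≤ T) :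
    (1 + C * h) ^ n ≤ Real.exp (C * T) := by
  have e1 : 1 + C * h ≤ Real.exp (C * h) := by linarith [Real.add_one_le_exp (C * h)]
  calc (1 + C * h) ^ n ≤ Real.exp (C * h) ^ n := by gcongr
    _ = Real.exp (C * (n * h)) := by rw [← Real.exp_nat_mul]; congr 1; ring
    _ ≤ _ := by gcongr

/-- A bound for the growth and Lipschitz constants of the scheme up to the horizon `T`. -/
noncomputable def growthConst (d : ℕ) (L T : ℝ) : ℝ := L * Real.exp ((stepConst d L + 1) * T)

lemma growthConst_pos (H : M.UniformBounds L ε) (T : ℝ) : 0 < growthConst d L T :=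
  mul_pos H.pos_L (Real.exp_pos _)

lemma abs_eulerScheme_le (H : M.UniformBounds L ε) (h0 : 0 ≤ h) (h1 : h ≤ 1) {T : ℝ} {n : ℕ}
    (hn : n * h ≤ T) (i : Fin q) (x : Euc d) :
    |eulerScheme M h n i x| ≤ growthConst d L T * bracket x := by
  refine (H.abs_eulerScheme_le_pow h0 h1 n i x).trans ?_
  have hL := H.pos_L
  have hx := bracket_pos x
  have := stepConst_nonneg (d := d) (L := L)
  unfold growthConst
  gcongr
  exact one_add_mul_pow_le_exp (by positivity) h0 hn

lemma integrable_eulerScheme_eulerStep (H : M.UniformBounds L ε) (h0 : 0 ≤ h) (h1 : h ≤ 1)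
    (n : ℕ) (i j : Fin q) (x : Euc d) :
    Integrable (fun z => eulerScheme M h n i (M.eulerStep h j x z)) (stdGaussian (Euc d)) :=
  H.integrable_comp_eulerStep h0 h1 (H.measurable_eulerScheme n i)
    (H.abs_eulerScheme_le_pow h0 h1 n i) j x

/-- For each target regime the same cost occurs at both points and cancels, so the Lipschitz
constant grows per step only by the mean expansion of the Euler step and by the running reward. -/
lemma abs_eulerScheme_sub_le_of_const_cost (H : M.UniformBounds L ε)
    (hc : ∀ i j y z, M.c i j y = M.c i j z) (h0 : 0 ≤ h) (h1 : h ≤ 1) {T : ℝ} {n : ℕ}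
    (hn : n * h ≤ T) (i : Fin q) (x y : Euc d) :
    |eulerScheme M h n i x - eulerScheme M h n i y| ≤ growthConst d L T * ‖x - y‖ := by
  have hC := stepConst_nonneg (d := d) (L := L)
  have hL := H.pos_L
  suffices key : |eulerScheme M h n i x - eulerScheme M h n i y| ≤
      L * (1 + (stepConst d L + 1) * h) ^ n * ‖x - y‖ by
    refine key.trans ?_
    unfold growthConst
    gcongr
    exact one_add_mul_pow_le_exp (by positivity) h0 hn
  clear hn
  induction n generalizing i x y with
  | zero => simpa [eulerScheme_zero] using H.g_lip i x y
  | succ n ih =>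
    have : Nonempty (Fin q) := ⟨i⟩
    rw [eulerScheme_succ, eulerScheme_succ]
    refine abs_ciSup_sub_ciSup_le fun j => ?_
    set a := (1 + (stepConst d L + 1) * h) ^ n with ha
    have ha1 : 1 ≤ a := one_le_pow₀ (by nlinarith)
    have e1 : |∫ z, (eulerScheme M h n j (M.eulerStep h j x z) -
        eulerScheme M h n j (M.eulerStep h j y z)) ∂(stdGaussian (Euc d))| ≤
        L * a * ((1 + stepConst d L * h) * ‖x - y‖) := by
      have := norm_integral_le_of_norm_le
        ((H.integrable_norm_eulerStep_sub h0 h1 j x y).const_mul (L * a))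
        (f := fun z => eulerScheme M h n j (M.eulerStep h j x z) -
          eulerScheme M h n j (M.eulerStep h j y z))
        (Filter.Eventually.of_forall fun z => ih j _ _)
      rw [integral_const_mul] at this
      refine this.trans ?_
      gcongr
      exact H.integral_norm_eulerStep_sub_le h0 h1 j x y
    rw [integral_sub (H.integrable_eulerScheme_eulerStep h0 h1 n j j x)
      (H.integrable_eulerScheme_eulerStep h0 h1 n j j y)] at e1
    have e2 : |(M.f j x - M.f j y) * h| ≤ L * ‖x - y‖ * h := by
      rw [abs_mul, abs_of_nonneg h0]; gcongr; exact H.f_lip j x y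
    have e3 : continuationValue M h n j x - M.c i j x -
        (continuationValue M h n j y - M.c i j y) =
        (∫ z, eulerScheme M h n j (M.eulerStep h j x z) ∂(stdGaussian (Euc d))) -
          (∫ z, eulerScheme M h n j (M.eulerStep h j y z) ∂(stdGaussian (Euc d))) +
          (M.f j x - M.f j y) * h := by
      unfold continuationValue
      rw [hc i j x y]; ring
    rw [e3]
    refine (abs_add_le _ _).trans ((add_le_add e1 e2).trans ?_)
    rw [pow_succ, ← ha]
    have : L * ‖x - y‖ * h * 1 ≤ L * ‖x - y‖ * h * a := by gcongr
    nlinarith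

end SwitchingModel.UniformBounds

end EulerScheme

/-! ### Tangent inequality for u s² / v, pointwise and in the mean -/

section PerspectiveInequality

variable {u v s κ h B θ : ℝ}

lemma mul_sub_one_le_of_abs_le (h0 : 0 ≤ h) (hκ : 1 ≤ κ) (hu : |u - 1| ≤ √h * κ)
    (hv : |v - 1| ≤ √h * κ) : |(u - 1) * (v - 1)| ≤ h * κ ^ 3 := by
  have e : √h * κ * (√h * κ) = h * κ ^ 2 := by
    nlinarith [Real.mul_self_sqrt h0]
  rw [abs_mul]
  calc _ ≤ √h * κ * (√h * κ) := mul_le_mul hu hv (abs_nonneg _) (by positivity)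
    _ = h * κ ^ 2 := e
    _ ≤ h * κ ^ 3 := mul_le_mul_of_nonneg_left (pow_le_pow_right₀ hκ (by norm_num)) h0

/-- Completing the square gives w s²/v ≥ 2θs - θ² v/w for every slope θ, and v/w is then linearized
at u = v = 1. The first-order terms stay linear, so that later only their means count; the
second-order terms are O(hκ³). -/
lemma mul_sq_div_ge (h0 : 0 ≤ h) (h1 : h ≤ 1) (hκ : 1 ≤ κ) (hu0 : 0 ≤ u) (hv0 : 0 < v)
    (hs0 : 0 ≤ s) (hsB : s ≤ B * v) (hu : |u - 1| ≤ √h * κ) (hv : |v - 1| ≤ √h * κ) :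
    2 * θ * s - θ ^ 2 * (v - (u - 1) + 5 * h * κ ^ 3) - 4 * B ^ 2 * h * κ ^ 3 ≤ u * s ^ 2 / v := by
  have hs1 : √h ≤ 1 := Real.sqrt_le_one.2 h1
  have hv2 : v ≤ 2 * κ := by
    have := (abs_le.1 hv).2
    nlinarith
  have hab := (abs_le.1 (mul_sub_one_le_of_abs_le h0 hκ hu hv)).1
  have haa : (u - 1) ^ 2 ≤ h * κ ^ 2 := by
    have : (u - 1) ^ 2 ≤ (√h * κ) ^ 2 := by rw [← sq_abs]; gcongr
    rwa [mul_pow, Real.sq_sqrt h0] at this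
  have haav : (u - 1) ^ 2 * v ≤ 2 * h * κ ^ 3 := by
    calc (u - 1) ^ 2 * v ≤ h * κ ^ 2 * (2 * κ) := by gcongr
      _ = _ := by ring
  -- `u` may vanish, so it is replaced by `w = max u (1/2)`. Then 1/w is bounded by its second-order
  -- expansion at u = 1, and the replacement itself costs only second order.
  obtain ⟨w, hw0, hwu, hwu2, hw1⟩ : ∃ w : ℝ, 0 < w ∧ u ≤ w ∧ w - u ≤ 2 * (u - 1) ^ 2 ∧
      1 ≤ w * (1 - (u - 1) + 2 * (u - 1) ^ 2) := by
    rcases le_or_gt (1 / 2) u with hu2 | hu2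
    · exact ⟨u, by linarith, le_rfl, by nlinarith, by nlinarith [sq_nonneg (u - 1)]⟩
    · exact ⟨1 / 2, by norm_num, hu2.le, by nlinarith, by nlinarith⟩
  have e1 : s ^ 2 / v ≤ B ^ 2 * v := by
    rw [div_le_iff₀ hv0]
    calc s ^ 2 ≤ (B * v) ^ 2 := by gcongr
      _ = _ := by ring
  have e2 : (w - u) * (s ^ 2 / v) ≤ 4 * B ^ 2 * h * κ ^ 3 := by
    calc (w - u) * (s ^ 2 / v) ≤ 2 * (u - 1) ^ 2 * (B ^ 2 * v) := by gcongr
      _ = 2 * B ^ 2 * ((u - 1) ^ 2 * v) := by ring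
      _ ≤ 2 * B ^ 2 * (2 * h * κ ^ 3) := by gcongr
      _ = _ := by ring
  have e3 : 2 * θ * s - θ ^ 2 * (v / w) ≤ w * (s ^ 2 / v) := by
    have : w * (s ^ 2 / v) - (2 * θ * s - θ ^ 2 * (v / w)) = w / v * (s - θ * (v / w)) ^ 2 := by
      field_simp; ring
    have h2 : 0 ≤ w / v * (s - θ * (v / w)) ^ 2 := by positivity
    linarith
  have e4 : v / w ≤ v - (u - 1) + 5 * h * κ ^ 3 := by
    rw [div_le_iff₀ hw0]
    have h3 : v * 1 ≤ v * (w * (1 - (u - 1) + 2 * (u - 1) ^ 2)) := by gcongr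
    have h4 : v * (1 - (u - 1) + 2 * (u - 1) ^ 2) ≤ v - (u - 1) + 5 * h * κ ^ 3 := by nlinarith
    have h5 := mul_le_mul_of_nonneg_right h4 hw0.le
    linarith
  have e5 : θ ^ 2 * (v / w) ≤ θ ^ 2 * (v - (u - 1) + 5 * h * κ ^ 3) := by gcongr
  have e6 : u * s ^ 2 / v = w * (s ^ 2 / v) - (w - u) * (s ^ 2 / v) := by ring
  linarith

end PerspectiveInequality

section PerspectiveIntegral

variable {α : Type*} {mα : MeasurableSpace α} {μ : Measure α} [IsProbabilityMeasure μ]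
  {u v s κ : α → ℝ} {h B C G θ : ℝ}

lemma integral_mul_le_of_abs_sub_one_le (h0 : 0 ≤ h) (hui : Integrable u μ) (hvi : Integrable v μ)
    (huv : Integrable (fun z => u z * v z) μ) (hκi : Integrable (fun z => κ z ^ 3) μ)
    (hκ : ∀ z, 1 ≤ κ z) (hu : ∀ z, |u z - 1| ≤ √h * κ z) (hv : ∀ z, |v z - 1| ≤ √h * κ z)
    (hEu : ∫ z, u z ∂μ ≤ 1 + C * h) (hEv : ∫ z, v z ∂μ ≤ 1 + C * h)
    (hG : ∫ z, κ z ^ 3 ∂μ ≤ G) :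
    ∫ z, u z * v z ∂μ ≤ 1 + (2 * C + G) * h := by
  have e1 : ∫ z, u z * v z ∂μ ≤ ∫ z, (u z + v z + (h * κ z ^ 3 - 1)) ∂μ := by
    refine integral_mono huv ((hui.add hvi).add ((hκi.const_mul h).sub (integrable_const 1)))
      fun z => ?_
    have := (abs_le.1 (mul_sub_one_le_of_abs_le h0 (hκ z) (hu z) (hv z))).2
    simp only
    linarith
  have hi1 : Integrable (fun z => u z + v z) μ := hui.add hvi
  have hi2 : Integrable (fun z => h * κ z ^ 3 - 1) μ := (hκi.const_mul h).sub (integrable_const 1)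
  rw [integral_add hi1 hi2,
    integral_add hui hvi, integral_sub (hκi.const_mul h) (integrable_const 1),
    integral_const_mul] at e1
  simp only [integral_const, probReal_univ, one_smul] at e1
  have := mul_le_mul_of_nonneg_left hG h0
  linarith

/-- After integration the fluctuations of order √h of `u` and `v` enter only through their means,
which deviate from 1 in the relevant directions by O(h). -/
lemma integral_mul_sq_div_ge (h0 : 0 ≤ h) (h1 : h ≤ 1) (hui : Integrable u μ)
    (hvi : Integrable v μ) (hsi : Integrable s μ) (hκi : Integrable (fun z => κ z ^ 3) μ)
    (hi : Integrable (fun z => u z * s z ^ 2 / v z) μ)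
    (hκ : ∀ z, 1 ≤ κ z) (hu0 : ∀ z, 0 ≤ u z) (hv0 : ∀ z, 0 < v z) (hs0 : ∀ z, 0 ≤ s z)
    (hsB : ∀ z, s z ≤ B * v z)
    (hu : ∀ z, |u z - 1| ≤ √h * κ z) (hv : ∀ z, |v z - 1| ≤ √h * κ z)
    (hEu : 1 - C * h ≤ ∫ z, u z ∂μ) (hEv : ∫ z, v z ∂μ ≤ 1 + C * h)
    (hG : ∫ z, κ z ^ 3 ∂μ ≤ G) :
    2 * θ * (∫ z, s z ∂μ) - θ ^ 2 * (1 + (2 * C + 5 * G) * h) - 4 * B ^ 2 * G * h ≤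
      ∫ z, u z * s z ^ 2 / v z ∂μ := by
  have hi0 : Integrable (fun z => u z - 1) μ := hui.sub (integrable_const 1)
  have hi1 : Integrable (fun z => v z - (u z - 1)) μ := hvi.sub hi0
  have hi2 : Integrable (fun z => v z - (u z - 1) + 5 * h * κ z ^ 3) μ :=
    hi1.add (hκi.const_mul _)
  have hi3 : Integrable (fun z => 2 * θ * s z - θ ^ 2 * (v z - (u z - 1) + 5 * h * κ z ^ 3)) μ :=
    (hsi.const_mul _).sub (hi2.const_mul _)
  have e1 := integral_mono (hi3.sub (hκi.const_mul (4 * B ^ 2 * h))) hi fun z =>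
    mul_sq_div_ge (θ := θ) h0 h1 (hκ z) (hu0 z) (hv0 z) (hs0 z) (hsB z) (hu z) (hv z)
  refine le_trans ?_ e1
  rw [integral_sub' hi3 (hκi.const_mul _), integral_sub (hsi.const_mul _) (hi2.const_mul _),
    integral_const_mul, integral_const_mul, integral_const_mul,
    integral_add hi1 (hκi.const_mul _), integral_const_mul,
    integral_sub hvi hi0, integral_sub hui (integrable_const 1)]
  simp only [integral_const, probReal_univ, one_smul]
  have e2 : (∫ z, v z ∂μ) - ((∫ z, u z ∂μ) - 1) + 5 * h * ∫ z, κ z ^ 3 ∂μ ≤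
      1 + (2 * C + 5 * G) * h := by
    have := mul_le_mul_of_nonneg_left hG (by positivity : 0 ≤ 5 * h)
    linarith
  have e3 := mul_le_mul_of_nonneg_left e2 (sq_nonneg θ)
  have e4 := mul_le_mul_of_nonneg_left hG (by positivity : 0 ≤ 4 * B ^ 2 * h)
  linarith

end PerspectiveIntegral

/-! ### Local Lipschitz bound for state-dependent costs, by a potential -/

section LocalLipschitz

variable {d q : ℕ} {M : SwitchingModel d q} {L ε h : ℝ}

namespace SwitchingModel.UniformBounds

/-- The constant of the supersolution inequality for the Lipschitz weight. -/
noncomputable def weightConst (d : ℕ) (L B K : ℝ) : ℝ :=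
  K * (2 * stepConst d L + L ^ 3 * gaussMoment d) + 2 * (2 * B + 1) * (L * (B + 2)) +
    (2 * B + 1) ^ 2 * (2 * stepConst d L + 9 * (L ^ 3 * gaussMoment d))

lemma le_stepConst (H : M.UniformBounds L ε) : L ≤ stepConst d L := by
  have e1 := one_le_gaussMoment (d := d)
  have e2 := H.one_le
  have e3 : L ^ 2 * 1 ≤ L ^ 2 * gaussMoment d := by gcongr
  unfold stepConst
  nlinarith

/-- Here `t` stands for the value before the switch, `c` for the cost paid, and `φ` for the value
function of the new regime at the next time. By `hE` the mean of `φ` exceeds `t` by `c` up to O(h),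
and the slope 2θ ≥ 2 of the tangent to the square turns this excess into the gain `2 * c * ‖x - y‖`.
All quantities are normalized by their values at `x`, so the weight becomes rρ(K u v - u s²/v). -/
lemma integral_weight_le (H : M.UniformBounds L ε) (h0 : 0 ≤ h) (h1 : h ≤ 1)
    {φ : Euc d → ℝ} (hφ : Measurable φ) {B K : ℝ} (hB0 : 0 ≤ B) (hK : 0 ≤ K)
    (hB : ∀ y, |φ y| ≤ B * bracket y) (j : Fin q) (x y : Euc d) {t c : ℝ}
    (ht : |t| ≤ B * bracket x) (hc : 0 ≤ c)
    (hE : t + c - L * bracket x * h ≤ ∫ z, φ (M.eulerStep h j x z) ∂(stdGaussian (Euc d))) :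
    Integrable (fun z => ‖M.eulerStep h j x z - M.eulerStep h j y z‖ *
      (K * bracket (M.eulerStep h j x z) - (φ (M.eulerStep h j x z) +
        (B + 1) * bracket (M.eulerStep h j x z)) ^ 2 / bracket (M.eulerStep h j x z)))
      (stdGaussian (Euc d)) ∧
    ∫ z, ‖M.eulerStep h j x z - M.eulerStep h j y z‖ *
      (K * bracket (M.eulerStep h j x z) - (φ (M.eulerStep h j x z) +
        (B + 1) * bracket (M.eulerStep h j x z)) ^ 2 / bracket (M.eulerStep h j x z))
        ∂(stdGaussian (Euc d)) ≤
      ‖x - y‖ * (K * bracket x - (t + (B + 1) * bracket x) ^ 2 / bracket x) +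
        weightConst d L B K * h * (‖x - y‖ * bracket x) - 2 * c * ‖x - y‖ := by
  rcases eq_or_ne x y with rfl | hxy
  · simp
  have hr : 0 < ‖x - y‖ := norm_pos_iff.2 (sub_ne_zero.2 hxy)
  set r := ‖x - y‖ with hr_def
  set ρ := bracket x with hρ_def
  have hρ : 0 < ρ := bracket_pos x
  have hL := H.pos_L
  set γ := stdGaussian (Euc d)
  set F : Euc d → Euc d := fun z => M.eulerStep h j x z with hF
  set w : Euc d → ℝ := fun z => ‖M.eulerStep h j x z - M.eulerStep h j y z‖ with hw
  set u : Euc d → ℝ := fun z => w z / r with hu_def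
  set v : Euc d → ℝ := fun z => bracket (F z) / ρ with hv_def
  set s : Euc d → ℝ := fun z => (φ (F z) + (B + 1) * bracket (F z)) / ρ with hs_def
  set κ : Euc d → ℝ := fun z => L * (1 + ‖z‖) with hκ_def
  have hFm : Measurable F := H.measurable_eulerStep h j x
  have hwm : Measurable w := (hFm.sub (H.measurable_eulerStep h j y)).norm
  have hum : Measurable u := hwm.div_const r
  have hbm : Measurable fun z => bracket (F z) := continuous_bracket.measurable.comp hFm
  have hvm : Measurable v := hbm.div_const ρ
  have hsm : Measurable s := ((hφ.comp hFm).add (hbm.const_mul (B + 1))).div_const ρ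
  have hκ1 (z : Euc d) : 1 ≤ κ z :=
    one_le_mul_of_one_le_of_one_le H.one_le (by linarith [norm_nonneg z])
  have hs1 : √h ≤ 1 := Real.sqrt_le_one.2 h1
  have hu0 (z : Euc d) : 0 ≤ u z := div_nonneg (norm_nonneg _) hr.le
  have hv0 (z : Euc d) : 0 < v z := div_pos (bracket_pos _) hρ
  have hu (z : Euc d) : |u z - 1| ≤ √h * κ z := by
    have e1 : u z - 1 = (w z - r) / r := by simp only [hu_def]; field_simp
    rw [e1, abs_div, abs_of_pos hr, div_le_iff₀ hr]
    exact (abs_norm_sub_norm_le _ _).trans (H.norm_eulerStep_sub_sub_le h0 h1 j x y z)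
  have hv (z : Euc d) : |v z - 1| ≤ √h * κ z := by
    have e1 : v z - 1 = (bracket (F z) - ρ) / ρ := by simp only [hv_def]; field_simp
    rw [e1, abs_div, abs_of_pos hρ, div_le_iff₀ hρ]
    refine le_trans ?_ (H.norm_eulerStep_sub_self_le h0 h1 j x z)
    rw [abs_sub_le_iff]
    refine ⟨by linarith [bracket_le_add (F z) x], ?_⟩
    have := bracket_le_add x (F z)
    rw [norm_sub_rev] at this
    linarith
  have hu2 (z : Euc d) : u z ≤ 2 * κ z := by
    have := (abs_le.1 (hu z)).2
    nlinarith [hκ1 z]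
  have hv2 (z : Euc d) : v z ≤ 2 * κ z := by
    have := (abs_le.1 (hv z)).2
    nlinarith [hκ1 z]
  have hs0 (z : Euc d) : 0 ≤ s z := by
    refine div_nonneg ?_ hρ.le
    nlinarith [(abs_le.1 (hB (F z))).1, bracket_pos (F z)]
  have hsB (z : Euc d) : s z ≤ (2 * B + 1) * v z := by
    simp only [hs_def, hv_def]
    rw [← mul_div_assoc]
    gcongr
    nlinarith [(abs_le.1 (hB (F z))).2]
  have hvi : Integrable v γ := (H.integrable_bracket_eulerStep h0 h1 j x).div_const ρ
  have hui : Integrable u γ := (H.integrable_norm_eulerStep_sub h0 h1 j x y).div_const r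
  have hφi : Integrable (fun z => φ (F z)) γ := H.integrable_comp_eulerStep h0 h1 hφ hB j x
  have hbi : Integrable (fun z => (B + 1) * bracket (F z)) γ :=
    (H.integrable_bracket_eulerStep h0 h1 j x).const_mul _
  have hsi : Integrable s γ := (hφi.add hbi).div_const ρ
  have huvle (z : Euc d) : u z * v z ≤ 4 * L ^ 2 * (1 + ‖z‖) ^ 2 := by
    calc u z * v z ≤ (2 * κ z) * (2 * κ z) :=
          mul_le_mul (hu2 z) (hv2 z) (hv0 z).le (by linarith [hκ1 z])
      _ = _ := by simp only [hκ_def]; ring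
  have huv : Integrable (fun z => u z * v z) γ :=
    integrable_of_abs_le_pow (hum.mul hvm) 2 fun z => by
      rw [abs_of_nonneg (mul_nonneg (hu0 z) (hv0 z).le)]; exact huvle z
  have hi : Integrable (fun z => u z * s z ^ 2 / v z) γ := by
    refine integrable_of_abs_le_pow ((hum.mul (hsm.pow_const 2)).div hvm)
      (C := (2 * B + 1) ^ 2 * (4 * L ^ 2)) 2 fun z => ?_
    have hv0 := hv0 z
    have hu0 := hu0 z
    rw [abs_of_nonneg (by positivity), div_le_iff₀ hv0]
    calc u z * s z ^ 2 ≤ u z * ((2 * B + 1) * v z) ^ 2 := by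
          gcongr
          · exact hs0 z
          · exact hsB z
      _ = (2 * B + 1) ^ 2 * (u z * v z) * v z := by ring
      _ ≤ (2 * B + 1) ^ 2 * (4 * L ^ 2 * (1 + ‖z‖) ^ 2) * v z :=
          mul_le_mul_of_nonneg_right (mul_le_mul_of_nonneg_left (huvle z) (by positivity)) hv0.le
      _ = _ := by ring
  have hκ3 : (fun z => κ z ^ 3) = fun z => L ^ 3 * (1 + ‖z‖) ^ 3 := by
    funext z; simp only [hκ_def, mul_pow]
  have hκi : Integrable (fun z => κ z ^ 3) γ := by
    rw [hκ3]; exact (integrable_one_add_norm_pow 3).const_mul _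
  have hG : ∫ z, κ z ^ 3 ∂γ ≤ L ^ 3 * gaussMoment d := by
    rw [hκ3, integral_const_mul]
    gcongr
    exact integral_one_add_norm_pow_le (by norm_num)
  have hEu : ∫ z, u z ∂γ ≤ 1 + stepConst d L * h := by
    simp only [hu_def]
    rw [integral_div, div_le_iff₀ hr]
    exact H.integral_norm_eulerStep_sub_le h0 h1 j x y
  have hEu' : 1 - stepConst d L * h ≤ ∫ z, u z ∂γ := by
    simp only [hu_def]
    rw [integral_div, le_div_iff₀ hr]
    refine le_trans ?_ (H.le_integral_norm_eulerStep_sub h0 h1 j x y)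
    have := H.le_stepConst
    gcongr
  have hEv : ∫ z, v z ∂γ ≤ 1 + stepConst d L * h := by
    simp only [hv_def]
    rw [integral_div, div_le_iff₀ hρ]
    exact H.integral_bracket_eulerStep_le h0 h1 j x
  -- The slope is the normalized value before the switch. The shift by (B+1)ρ keeps it at least 1,
  -- and the growth bound keeps it at most 2B + 1.
  set θ := (t + (B + 1) * ρ) / ρ with hθ
  have hθ1 : 1 ≤ θ := by
    rw [hθ, le_div_iff₀ hρ]; linarith [(abs_le.1 ht).1]
  have hθB : θ ≤ 2 * B + 1 := by
    rw [hθ, div_le_iff₀ hρ]; linarith [(abs_le.1 ht).2]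
  -- Of the loss L(B+2)h, one L comes from the running reward in `hE` and L(B+1) from the mean of
  -- the bracket.
  have hEs : θ + c / ρ - L * (B + 2) * h ≤ ∫ z, s z ∂γ := by
    simp only [hs_def]
    rw [integral_div, le_div_iff₀ hρ, integral_add hφi hbi, integral_const_mul]
    have e1 := H.le_integral_bracket_eulerStep h0 h1 j x
    have e2 := mul_le_mul_of_nonneg_left e1 (by linarith : 0 ≤ B + 1)
    have e3 : (θ + c / ρ - L * (B + 2) * h) * ρ =
        t + (B + 1) * ρ + c - L * (B + 2) * h * ρ := by
      rw [hθ]; field_simp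
    rw [e3]
    simp only [hF]
    linarith
  have e1 := integral_mul_le_of_abs_sub_one_le h0 hui hvi huv hκi hκ1 hu hv hEu hEv hG
  have e2 := integral_mul_sq_div_ge (θ := θ) h0 h1 hui hvi hsi hκi hi hκ1 hu0 hv0 hs0 hsB hu hv
    hEu' hEv hG
  have e3 : (fun z => w z * (K * bracket (F z) -
      (φ (F z) + (B + 1) * bracket (F z)) ^ 2 / bracket (F z))) =
      fun z => r * ρ * (K * (u z * v z) - u z * s z ^ 2 / v z) := by
    funext z
    have := bracket_pos (F z)
    simp only [hu_def, hv_def, hs_def]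
    field_simp
  have hi' : Integrable (fun z => K * (u z * v z) - u z * s z ^ 2 / v z) γ :=
    (huv.const_mul K).sub hi
  rw [e3]
  refine ⟨hi'.const_mul _, ?_⟩
  rw [integral_const_mul, integral_sub (huv.const_mul K) hi, integral_const_mul]
  have e4 : K * (∫ z, u z * v z ∂γ) - ∫ z, u z * s z ^ 2 / v z ∂γ ≤
      K - θ ^ 2 + weightConst d L B K * h - 2 * (c / ρ) := by
    have f1 := mul_le_mul_of_nonneg_left e1 hK
    have f2 := mul_le_mul_of_nonneg_left hEs (by linarith : 0 ≤ 2 * θ)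
    have f3 : c / ρ ≤ θ * (c / ρ) := le_mul_of_one_le_left (by positivity) hθ1
    have f4 : θ * (L * (B + 2) * h) ≤ (2 * B + 1) * (L * (B + 2) * h) := by gcongr
    have f5 : θ ^ 2 * ((2 * stepConst d L + 5 * (L ^ 3 * gaussMoment d)) * h) ≤
        (2 * B + 1) ^ 2 * ((2 * stepConst d L + 5 * (L ^ 3 * gaussMoment d)) * h) := by
      have := stepConst_nonneg (d := d) (L := L)
      have := one_le_gaussMoment (d := d)
      gcongr
    unfold weightConst
    linarith
  have e5 := mul_le_mul_of_nonneg_left e4 (by positivity : 0 ≤ r * ρ)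
  refine e5.trans (le_of_eq ?_)
  rw [hθ]
  field_simp

/-- Induction with the regime that is optimal at `x` used at both points. The potential depends on
`x` and on V(x) only, which is why the bound is one-sided. In the prefactor, `L` serves the terminal
gain and the running reward, and `L / ε` serves the costs. -/
lemma eulerScheme_sub_le (H : M.UniformBounds L ε) (h0 : 0 ≤ h) (h1 : h ≤ 1) {T B K : ℝ}
    (hB : B = growthConst d L T) (hK : K = (2 * B + 1) ^ 2 + 1) {n : ℕ} (hn : n * h ≤ T)
    (i : Fin q) (x y : Euc d) :
    eulerScheme M h n i x - eulerScheme M h n i y ≤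
      (L + L / ε) * (1 + (weightConst d L B K + 1) * h) ^ n * (‖x - y‖ *
        (K * bracket x - (eulerScheme M h n i x + (B + 1) * bracket x) ^ 2 / bracket x)) := by
  have hB0 : 0 < B := hB ▸ H.growthConst_pos T
  have hL := H.pos_L
  have hε := H.pos
  have hK0 : 0 ≤ K := by rw [hK]; positivity
  have hC0 : 0 ≤ weightConst d L B K := by
    have := stepConst_nonneg (d := d) (L := L)
    have := one_le_gaussMoment (d := d)
    unfold weightConst
    positivity
  set C := weightConst d L B K with hC
  have hgrow {n : ℕ} (hn : n * h ≤ T) (i : Fin q) (x : Euc d) :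
      |eulerScheme M h n i x| ≤ B * bracket x := hB ▸ H.abs_eulerScheme_le h0 h1 hn i x
  -- The square is at most (2B+1)²⟨x⟩² by the growth of V; the additional 1 in `K` leaves one
  -- bracket, so the potential is at least 1.
  have hpot {n : ℕ} (hn : n * h ≤ T) (i : Fin q) (x : Euc d) :
      bracket x ≤ K * bracket x -
        (eulerScheme M h n i x + (B + 1) * bracket x) ^ 2 / bracket x := by
    have hρ := bracket_pos x
    have e1 := abs_le.1 (hgrow hn i x)
    have : (eulerScheme M h n i x + (B + 1) * bracket x) ^ 2 / bracket x ≤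
        (2 * B + 1) ^ 2 * bracket x := by
      rw [div_le_iff₀ hρ]
      calc _ ≤ ((2 * B + 1) * bracket x) ^ 2 := by
            gcongr
            · linarith
            · linarith
        _ = _ := by ring
    rw [hK]
    linarith
  induction n generalizing i x y with
  | zero =>
    have e1 := (abs_le.1 (H.g_lip i x y)).2
    have e2 := hpot hn i x
    have e3 : 1 ≤ K * bracket x -
        (eulerScheme M h 0 i x + (B + 1) * bracket x) ^ 2 / bracket x :=
      (one_le_bracket x).trans e2
    rw [eulerScheme_zero, eulerScheme_zero, pow_zero, mul_one]
    rw [eulerScheme_zero] at e3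
    have e4 : ‖x - y‖ * 1 ≤ ‖x - y‖ * _ := mul_le_mul_of_nonneg_left e3 (norm_nonneg _)
    have e5 : L * ‖x - y‖ ≤ (L + L / ε) * ‖x - y‖ := by
      gcongr; linarith [div_pos hL hε]
    have e6 := mul_le_mul_of_nonneg_left e4 (by positivity : 0 ≤ L + L / ε)
    linarith
  | succ n ih =>
    have hn' : n * h ≤ T := by push_cast at hn; linarith
    obtain ⟨j, hj⟩ := exists_eulerScheme_eq (M := M) (h := h) n i x
    have hjy := continuationValue_sub_le (M := M) (h := h) n i j y
    have hΨ := hpot hn i x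
    set t := eulerScheme M h (n + 1) i x with ht
    set Ψ := K * bracket x - (t + (B + 1) * bracket x) ^ 2 / bracket x with hΨ_def
    set r := ‖x - y‖ with hr
    have hr0 : 0 ≤ r := norm_nonneg _
    set a := (1 + (C + 1) * h) ^ n with ha
    have ha1 : 1 ≤ a := one_le_pow₀ (by nlinarith)
    have hfx : M.f j x * h ≤ L * bracket x * h := by
      gcongr; exact (le_abs_self _).trans (H.f_le j x)
    have hE : t + M.c i j x - L * bracket x * h ≤
        ∫ z, eulerScheme M h n j (M.eulerStep h j x z) ∂(stdGaussian (Euc d)) := by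
      have : t + M.c i j x = (∫ z, eulerScheme M h n j (M.eulerStep h j x z)
          ∂(stdGaussian (Euc d))) + M.f j x * h := by rw [hj, continuationValue]; ring
      linarith
    obtain ⟨hint, hle⟩ := H.integral_weight_le h0 h1 (H.measurable_eulerScheme n j) hB0.le hK0
      (hgrow hn' j) j x y (hgrow hn i x) (H.c_nonneg i j x) hE
    have e1 := integral_mono ((H.integrable_eulerScheme_eulerStep h0 h1 n j j x).sub
      (H.integrable_eulerScheme_eulerStep h0 h1 n j j y))
      (hint.const_mul ((L + L / ε) * a)) fun z => ih hn' j (M.eulerStep h j x z) (M.eulerStep h j y z)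
    rw [integral_sub' (H.integrable_eulerScheme_eulerStep h0 h1 n j j x)
      (H.integrable_eulerScheme_eulerStep h0 h1 n j j y), integral_const_mul] at e1
    have e2 := mul_le_mul_of_nonneg_left hle (by positivity : 0 ≤ (L + L / ε) * a)
    have e3 : (M.f j x - M.f j y) * h ≤ L * r * h := by
      gcongr; exact (le_abs_self _).trans (H.f_lip j x y)
    -- Without a switch both costs vanish; with a switch c ≥ ε, so the Lipschitz variation of the
    -- cost is a multiple of the cost itself.
    have e4 : M.c i j y - M.c i j x ≤ L / ε * M.c i j x * r := by
      by_cases hij : j = i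
      · subst hij; rw [H.c_self, H.c_self]; simp
      · have f1 := (abs_le.1 (H.c_lip i j x y)).1
        have f2 : L * 1 ≤ L * (M.c i j x / ε) := by
          gcongr; exact (one_le_div hε).2 (H.c_pos i j hij x)
        have f3 := mul_le_mul_of_nonneg_right f2 hr0
        calc _ ≤ L * 1 * r := by linarith
          _ ≤ _ := f3
          _ = _ := by ring
    -- The fall 2c of the potential pays for the variation of the cost, without any factor that
    -- would accumulate over the switches.
    have e5 : L / ε * M.c i j x * r ≤ (L + L / ε) * a * (2 * M.c i j x * r) := by
      have f1 : 0 ≤ M.c i j x * r := mul_nonneg (H.c_nonneg i j x) hr0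
      have f2 : L / ε ≤ (L + L / ε) * a * 2 := by
        have : 0 < L / ε := div_pos hL hε
        nlinarith
      nlinarith
    -- The running reward is absorbed by the extra 1 in the rate `C + 1`, since the potential is at
    -- least 1.
    have e6 : L * r * h ≤ (L + L / ε) * a * h * (r * Ψ) := by
      have f1 : 1 ≤ Ψ := (one_le_bracket x).trans hΨ
      have f2 : L * 1 ≤ (L + L / ε) * a := by
        have : 0 < L / ε := div_pos hL hε
        gcongr; linarith
      calc L * r * h = L * 1 * h * (r * 1) := by ring
        _ ≤ _ := by gcongr
    have e7 : (L + L / ε) * a * (C * h * (r * bracket x)) ≤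
        (L + L / ε) * a * (C * h * (r * Ψ)) := by
      gcongr
    unfold continuationValue at hj hjy
    rw [pow_succ, ← ha]
    have e8 : (L + L / ε) * (a * (1 + (C + 1) * h)) * (r * Ψ) =
        (L + L / ε) * a * (r * Ψ) + (L + L / ε) * a * (C * h * (r * Ψ)) +
          (L + L / ε) * a * h * (r * Ψ) := by ring
    rw [e8]
    have e9 : (L + L / ε) * a * (r * Ψ + C * h * (r * bracket x) - 2 * M.c i j x * r) =
        (L + L / ε) * a * (r * Ψ) + (L + L / ε) * a * (C * h * (r * bracket x)) -
          (L + L / ε) * a * (2 * M.c i j x * r) := by ring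
    rw [e9] at e2
    linarith

/-- The scheme is locally Lipschitz with a constant of linear growth, uniformly in the time
step. -/
theorem exists_abs_eulerScheme_sub_le (H : M.UniformBounds L ε) (T : ℝ) :
    ∃ C : ℝ, 0 < C ∧ ∀ h : ℝ, 0 ≤ h → h ≤ 1 → ∀ n : ℕ, n * h ≤ T → ∀ i x y,
      |eulerScheme M h n i x - eulerScheme M h n i y| ≤
        C * (bracket x + bracket y) * ‖x - y‖ := by
  set B := growthConst d L T with hB
  set K := (2 * B + 1) ^ 2 + 1 with hK
  have hL := H.pos_L
  have hε := H.pos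
  have hB0 : 0 < B := H.growthConst_pos T
  have hC0 : 0 ≤ weightConst d L B K := by
    have := stepConst_nonneg (d := d) (L := L)
    have := one_le_gaussMoment (d := d)
    unfold weightConst
    positivity
  have key (h : ℝ) (h0 : 0 ≤ h) (h1 : h ≤ 1) (n : ℕ) (hn : n * h ≤ T) (i : Fin q) (x y : Euc d) :
      eulerScheme M h n i x - eulerScheme M h n i y ≤
        (L + L / ε) * Real.exp ((weightConst d L B K + 1) * T) * K *
          (bracket x + bracket y) * ‖x - y‖ := by
    have hx := bracket_pos x
    have hy := bracket_pos y
    refine (H.eulerScheme_sub_le h0 h1 hB hK hn i x y).trans ?_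
    have e1 : K * bracket x - (eulerScheme M h n i x + (B + 1) * bracket x) ^ 2 / bracket x ≤
        K * (bracket x + bracket y) := by
      have : 0 ≤ (eulerScheme M h n i x + (B + 1) * bracket x) ^ 2 / bracket x := by positivity
      have : 0 ≤ K * bracket y := by positivity
      linarith
    have e2 := one_add_mul_pow_le_exp (by positivity : 0 ≤ weightConst d L B K + 1) h0 hn
    calc _ ≤ (L + L / ε) * (1 + (weightConst d L B K + 1) * h) ^ n *
          (‖x - y‖ * (K * (bracket x + bracket y))) := by gcongr
      _ ≤ (L + L / ε) * Real.exp ((weightConst d L B K + 1) * T) *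
          (‖x - y‖ * (K * (bracket x + bracket y))) := by gcongr
      _ = _ := by ring
  refine ⟨_, by positivity, fun h h0 h1 n hn i x y => abs_sub_le_iff.2
    ⟨key h h0 h1 n hn i x y, ?_⟩⟩
  have := key h h0 h1 n hn i y x
  rwa [norm_sub_rev, add_comm (bracket y)] at this

end SwitchingModel.UniformBounds

end LocalLipschitz

/-! ### Projection on the bounded lattice and the Lyapunov function -/

section LatticeProjection

variable {d : ℕ} {δ R : ℝ} {proj : Euc d → Euc d}

/-- Coordinatewise rounding to the mesh δ/d errs by at most δ/√d in the Euclidean norm. -/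
lemma exists_lattice_near (hd : 0 < d) (hδ : 0 < δ) (y : Euc d) :
    ∃ p : Euc d, (∃ z : Fin d → ℤ, ∀ a, p a = δ / d * z a) ∧ ‖y - p‖ ≤ δ := by
  have hd' : (0 : ℝ) < d := by exact_mod_cast hd
  have hs : 0 < δ / d := by positivity
  refine ⟨WithLp.toLp 2 fun a => δ / d * (round (y a / (δ / d)) : ℤ),
    ⟨fun a => round (y a / (δ / d)), fun a => rfl⟩, ?_⟩
  have hcoord (a : Fin d) : |y a - δ / d * (round (y a / (δ / d)) : ℤ)| ≤ δ / d := by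
    have h1 := abs_sub_round (y a / (δ / d))
    have h2 : y a - δ / d * (round (y a / (δ / d)) : ℤ) =
        δ / d * (y a / (δ / d) - (round (y a / (δ / d)) : ℤ)) := by
      rw [mul_sub, mul_div_cancel₀ _ hs.ne']
    rw [h2, abs_mul, abs_of_pos hs]
    nlinarith
  refine abs_le_of_sq_le_sq' ?_ hδ.le |>.2
  rw [EuclideanSpace.norm_sq_eq]
  calc ∑ a, ‖(y - WithLp.toLp 2 fun a => δ / d * (round (y a / (δ / d)) : ℤ)) a‖ ^ 2
      ≤ ∑ _a : Fin d, (δ / d) ^ 2 := Finset.sum_le_sum fun a _ => by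
        have := hcoord a
        simp only [PiLp.sub_apply, Real.norm_eq_abs]
        gcongr
    _ = d * (δ / d) ^ 2 := by simp
    _ = δ ^ 2 / d := by field_simp
    _ ≤ δ ^ 2 := div_le_self (sq_nonneg _) (by exact_mod_cast hd)

lemma norm_proj_le (hproj : IsClosestNeighbour (spaceGrid d δ R) proj) (y : Euc d) :
    ‖proj y‖ ≤ R := (hproj y).1.2

lemma exists_spaceGrid_near (hd : 0 < d) (hδ : 0 < δ) {y : Euc d} (hy : ‖y‖ ≤ R - δ) :
    ∃ p ∈ spaceGrid d δ R, ‖y - p‖ ≤ δ := by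
  obtain ⟨p, hp, hyp⟩ := exists_lattice_near hd hδ y
  refine ⟨p, ⟨hp, ?_⟩, hyp⟩
  have := norm_sub_le y (y - p)
  rw [sub_sub_cancel] at this
  linarith

/-- Well inside the ball only the mesh counts. Elsewhere the overshoot |y| - R is traded for |y|²/R,
so that the truncation error carries a factor 1/R at the price of one more moment. -/
lemma norm_sub_proj_le (hd : 0 < d) (hδ : 0 < δ) (hR : 0 < R)
    (hproj : IsClosestNeighbour (spaceGrid d δ R) proj) (y : Euc d) :
    ‖y - proj y‖ ≤ 2 * δ + ‖y‖ ^ 2 / R := by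
  have hmin (p : Euc d) (hp : p ∈ spaceGrid d δ R) : ‖y - proj y‖ ≤ ‖y - p‖ := by
    have := (hproj y).2 p hp
    rwa [dist_eq_norm, dist_eq_norm] at this
  have hq : 0 ≤ ‖y‖ ^ 2 / R := by positivity
  have hover : ‖y‖ - R ≤ ‖y‖ ^ 2 / R := by
    rw [le_div_iff₀ hR]; nlinarith [sq_nonneg (‖y‖ - R), norm_nonneg y]
  rcases le_or_gt ‖y‖ (R - δ) with h1 | h1
  · obtain ⟨p, hp, hyp⟩ := exists_spaceGrid_near hd hδ h1
    linarith [hmin p hp]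
  · rcases le_or_gt δ R with h2 | h2
    -- The point is pulled back radially to the sphere of radius R - δ, where a lattice point within
    -- distance δ still lies in the ball.
    · have hy : 0 < ‖y‖ := by linarith
      have hle : (R - δ) / ‖y‖ ≤ 1 := (div_le_one hy).2 h1.le
      have hnn : 0 ≤ (R - δ) / ‖y‖ := div_nonneg (by linarith) hy.le
      have hn : ‖((R - δ) / ‖y‖) • y‖ = R - δ := by
        rw [norm_smul, Real.norm_of_nonneg hnn]; field_simp
      obtain ⟨p, hp, hyp⟩ := exists_spaceGrid_near hd hδ hn.le
      have e1 : ‖y - ((R - δ) / ‖y‖) • y‖ = ‖y‖ - (R - δ) := by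
        have : y - ((R - δ) / ‖y‖) • y = (1 - (R - δ) / ‖y‖) • y := by
          rw [sub_smul, one_smul]
        rw [this, norm_smul, Real.norm_of_nonneg (by linarith)]
        field_simp
      have e2 := norm_add_le (y - ((R - δ) / ‖y‖) • y) (((R - δ) / ‖y‖) • y - p)
      rw [sub_add_sub_cancel] at e2
      linarith [hmin p hp]
    -- When the mesh exceeds the radius the origin is a sufficient competitor: |y| = (|y| - R) + R
    -- and R < δ.
    · have h0 : (0 : Euc d) ∈ spaceGrid d δ R := ⟨⟨0, fun a => by simp⟩, by simpa using hR.le⟩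
      have := hmin 0 h0
      rw [sub_zero] at this
      linarith

lemma norm_proj_le_add (hd : 0 < d) (hδ : 0 < δ)
    (hproj : IsClosestNeighbour (spaceGrid d δ R) proj) (y : Euc d) :
    ‖proj y‖ ≤ ‖y‖ + δ := by
  rcases le_or_gt ‖y‖ (R - δ) with h1 | h1
  · obtain ⟨p, hp, hyp⟩ := exists_spaceGrid_near hd hδ h1
    have h2 := (hproj y).2 p hp
    rw [dist_eq_norm, dist_eq_norm] at h2
    have := norm_sub_le y (y - proj y)
    rw [sub_sub_cancel] at this
    linarith
  · linarith [norm_proj_le hproj y]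

/-- The Lyapunov function `1 + |x|² + D²` of the quantized scheme. -/
noncomputable def lyapunov (D : ℝ) (x : Euc d) : ℝ := 1 + ‖x‖ ^ 2 + D ^ 2

variable {D h : ℝ}

lemma one_le_lyapunov (D : ℝ) (x : Euc d) : 1 ≤ lyapunov D x := by
  unfold lyapunov; nlinarith [sq_nonneg ‖x‖, sq_nonneg D]

lemma lyapunov_pos (D : ℝ) (x : Euc d) : 0 < lyapunov D x :=
  one_pos.trans_le (one_le_lyapunov D x)

lemma bracket_sq_le_lyapunov (D : ℝ) (x : Euc d) : bracket x ^ 2 ≤ lyapunov D x := by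
  rw [bracket_sq]; unfold lyapunov; nlinarith [sq_nonneg D]

lemma bracket_le_sqrt_lyapunov (D : ℝ) (x : Euc d) : bracket x ≤ √(lyapunov D x) :=
  Real.le_sqrt_of_sq_le (bracket_sq_le_lyapunov D x)

lemma le_sqrt_lyapunov (D : ℝ) (x : Euc d) : D ≤ √(lyapunov D x) :=
  Real.le_sqrt_of_sq_le (by unfold lyapunov; nlinarith [sq_nonneg ‖x‖])

lemma sqrt_lyapunov_le (hD : 0 ≤ D) (x : Euc d) : √(lyapunov D x) ≤ 1 + ‖x‖ + D := by
  refine Real.sqrt_le_iff.2 ⟨by positivity, ?_⟩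
  unfold lyapunov
  nlinarith [norm_nonneg x, mul_nonneg (norm_nonneg x) hD]

/-- Projection may lengthen `y` by the mesh δ = hD at every step. The summand D² in the Lyapunov
function absorbs this, as 2|y|D ≤ |y|² + D², and leaves a factor that stays bounded over T/h steps.
-/
lemma lyapunov_proj_le (hd : 0 < d) (hh : 0 < h) (h1 : h ≤ 1) (hD : 0 < D)
    (hproj : IsClosestNeighbour (spaceGrid d (h * D) R) proj) (y : Euc d) :
    lyapunov D (proj y) ≤ (1 + 2 * h) * lyapunov D y := by
  have e1 := norm_proj_le_add hd (by positivity) hproj y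
  have e2 : ‖proj y‖ ^ 2 ≤ (‖y‖ + h * D) ^ 2 := by gcongr
  have e3 : h * (2 * ‖y‖ * D) ≤ h * (‖y‖ ^ 2 + D ^ 2) := by
    gcongr; exact two_mul_le_add_sq ‖y‖ D
  have e4 : h ^ 2 * D ^ 2 ≤ h * D ^ 2 := by gcongr; nlinarith
  unfold lyapunov
  nlinarith [mul_nonneg hh.le (sq_nonneg ‖y‖)]

lemma bracket_proj_le (hd : 0 < d) (hδ : 0 < δ)
    (hproj : IsClosestNeighbour (spaceGrid d δ R) proj) (y : Euc d) :
    bracket (proj y) ≤ bracket y + δ := by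
  have e1 := norm_proj_le_add hd hδ hproj y
  refine Real.sqrt_le_iff.2 ⟨by linarith [bracket_pos y], ?_⟩
  have e2 : ‖proj y‖ ^ 2 ≤ (‖y‖ + δ) ^ 2 := by gcongr
  nlinarith [bracket_sq y, norm_le_bracket y]

end LatticeProjection

/-! ### Finite quantizers and moments of the quantization error -/

section Quantizer

variable {d : ℕ}

/-- A measurable map with finitely many values. -/
structure IsQuantizer (quant : Euc d → Euc d) : Prop where
  measurable : Measurable quant
  finite_range : (Set.range quant).Finite

variable {quant : Euc d → Euc d}

lemma IsQuantizer.of_closestNeighbour {N : ℕ} {w : Fin N → Euc d} (hm : Measurable quant)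
    (h : IsClosestNeighbour (Set.range w) quant) : IsQuantizer quant :=
  ⟨hm, (Set.finite_range w).subset (Set.range_subset_iff.2 fun y => (h y).1)⟩

/-- The amplitude `1 + |z| + |z - ẑ|`, which dominates all the noise terms. -/
noncomputable def noiseAmplitude (quant : Euc d → Euc d) (z : Euc d) : ℝ :=
  1 + ‖z‖ + ‖z - quant z‖

lemma one_le_noiseAmplitude (z : Euc d) : 1 ≤ noiseAmplitude quant z := by
  unfold noiseAmplitude; linarith [norm_nonneg z, norm_nonneg (z - quant z)]

lemma one_add_norm_quant_le (z : Euc d) : 1 + ‖quant z‖ ≤ noiseAmplitude quant z := by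
  have := norm_sub_le z (z - quant z)
  rw [sub_sub_cancel] at this
  unfold noiseAmplitude; linarith

namespace IsQuantizer

/-- As the range is finite, `φ` may be arbitrary. Thus `proj`, whose ties are broken without any
measurability, causes no difficulty after quantization. -/
lemma measurable_comp (hq : IsQuantizer quant) {β : Type*} [MeasurableSpace β] (φ : Euc d → β) :
    Measurable fun z => φ (quant z) := by
  intro s _
  have : (fun z => φ (quant z)) ⁻¹' s = quant ⁻¹' (φ ⁻¹' s ∩ Set.range quant) := by
    ext z; simp
  rw [this]
  exact hq.measurable (hq.finite_range.subset Set.inter_subset_right).measurableSet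

lemma integrable_comp (hq : IsQuantizer quant) (φ : Euc d → ℝ) :
    Integrable (fun z => φ (quant z)) (stdGaussian (Euc d)) := by
  obtain ⟨C, hC⟩ := (hq.finite_range.image fun y => ‖φ y‖).bddAbove
  refine Integrable.of_bound (hq.measurable_comp φ).aestronglyMeasurable C
    (Filter.Eventually.of_forall fun z => hC ⟨quant z, ⟨z, rfl⟩, rfl⟩)

lemma exists_norm_sub_le (hq : IsQuantizer quant) :
    ∃ C : ℝ, 0 ≤ C ∧ ∀ z, ‖z - quant z‖ ≤ C * (1 + ‖z‖) := by
  obtain ⟨C, hC⟩ := (hq.finite_range.image fun y => ‖y‖).bddAbove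
  have hC' (z : Euc d) : ‖quant z‖ ≤ C := hC ⟨quant z, ⟨z, rfl⟩, rfl⟩
  have hC0 : 0 ≤ C := (norm_nonneg _).trans (hC' 0)
  refine ⟨1 + C, by linarith, fun z => ?_⟩
  have := norm_sub_le z (quant z)
  nlinarith [hC' z, norm_nonneg z]

lemma measurable_norm_sub (hq : IsQuantizer quant) : Measurable fun z => ‖z - quant z‖ :=
  (measurable_id.sub hq.measurable).norm

lemma integrable_norm_sub_pow (hq : IsQuantizer quant) (n : ℕ) :
    Integrable (fun z => ‖z - quant z‖ ^ n) (stdGaussian (Euc d)) := by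
  obtain ⟨C, hC0, hC⟩ := hq.exists_norm_sub_le
  refine integrable_of_abs_le_pow (hq.measurable_norm_sub.pow_const n) (C := C ^ n) n fun z => ?_
  rw [abs_of_nonneg (by positivity), ← mul_pow]
  gcongr
  exact hC z

lemma integrable_norm_sub (hq : IsQuantizer quant) :
    Integrable (fun z => ‖z - quant z‖) (stdGaussian (Euc d)) := by
  simpa using hq.integrable_norm_sub_pow 1

lemma measurable_noiseAmplitude (hq : IsQuantizer quant) : Measurable (noiseAmplitude quant) :=
  (measurable_const.add measurable_norm).add hq.measurable_norm_sub

lemma integrable_noiseAmplitude_pow (hq : IsQuantizer quant) (n : ℕ) :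
    Integrable (fun z => noiseAmplitude quant z ^ n) (stdGaussian (Euc d)) := by
  obtain ⟨C, hC0, hC⟩ := hq.exists_norm_sub_le
  refine integrable_of_abs_le_pow (hq.measurable_noiseAmplitude.pow_const n)
    (C := (1 + C) ^ n) n fun z => ?_
  have h0 := one_le_noiseAmplitude (quant := quant) z
  rw [abs_of_nonneg (by positivity), ← mul_pow]
  gcongr
  unfold noiseAmplitude
  linarith [hC z]

lemma quantError_nonneg (p : ℝ) : 0 ≤ quantError quant p :=
  Real.rpow_nonneg (integral_nonneg fun z => by positivity) _

lemma quantError_two_sq :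
    quantError quant 2 ^ 2 = ∫ z, ‖z - quant z‖ ^ 2 ∂(stdGaussian (Euc d)) := by
  have : (∫ z, ‖z - quant z‖ ^ (2 : ℝ) ∂(stdGaussian (Euc d))) =
      ∫ z, ‖z - quant z‖ ^ 2 ∂(stdGaussian (Euc d)) := by
    congr 1; funext z; exact_mod_cast Real.rpow_natCast ‖z - quant z‖ 2
  rw [quantError, this, ← Real.rpow_natCast, ← Real.rpow_mul
    (integral_nonneg fun z => by positivity)]
  norm_num

lemma quantError_four_pow :
    quantError quant 4 ^ 4 = ∫ z, ‖z - quant z‖ ^ 4 ∂(stdGaussian (Euc d)) := by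
  have : (∫ z, ‖z - quant z‖ ^ (4 : ℝ) ∂(stdGaussian (Euc d))) =
      ∫ z, ‖z - quant z‖ ^ 4 ∂(stdGaussian (Euc d)) := by
    congr 1; funext z; exact_mod_cast Real.rpow_natCast ‖z - quant z‖ 4
  rw [quantError, this, ← Real.rpow_natCast, ← Real.rpow_mul
    (integral_nonneg fun z => by positivity)]
  norm_num

/-- The Cauchy–Schwarz inequality for real integrals. -/
lemma sq_integral_mul_le {α : Type*} {mα : MeasurableSpace α} {μ : Measure α} {f g : α → ℝ}
    (hf : Integrable (fun z => f z ^ 2) μ) (hg : Integrable (fun z => g z ^ 2) μ)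
    (hfg : Integrable (fun z => f z * g z) μ) :
    (∫ z, f z * g z ∂μ) ^ 2 ≤ (∫ z, f z ^ 2 ∂μ) * ∫ z, g z ^ 2 ∂μ := by
  have key (t : ℝ) : 0 ≤ (∫ z, f z ^ 2 ∂μ) * (t * t) + 2 * (∫ z, f z * g z ∂μ) * t +
      ∫ z, g z ^ 2 ∂μ := by
    have e1 : 0 ≤ ∫ z, (t * f z + g z) ^ 2 ∂μ := integral_nonneg fun z => sq_nonneg _
    have e2 : (fun z => (t * f z + g z) ^ 2) =
        fun z => t * t * f z ^ 2 + 2 * t * (f z * g z) + g z ^ 2 := by funext z; ring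
    have hi : Integrable (fun z => t * t * f z ^ 2 + 2 * t * (f z * g z)) μ :=
      (hf.const_mul _).add (hfg.const_mul _)
    rw [e2, integral_add hi hg, integral_add (hf.const_mul _) (hfg.const_mul _),
      integral_const_mul, integral_const_mul] at e1
    linarith
  have := discrim_le_zero key
  unfold discrim at this
  linarith

lemma integral_norm_sub_le (hq : IsQuantizer quant) :
    ∫ z, ‖z - quant z‖ ∂(stdGaussian (Euc d)) ≤ quantError quant 2 := by
  have := sq_integral_mul_le (f := fun z => ‖z - quant z‖) (g := fun _ => 1)
    (hq.integrable_norm_sub_pow 2) (integrable_const _) (by simpa using hq.integrable_norm_sub)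
  simp only [mul_one, one_pow, integral_const, probReal_univ, one_smul,
    ← quantError_two_sq] at this
  exact (abs_le_of_sq_le_sq' this (quantError_nonneg 2)).2

lemma quantError_two_le_four (hq : IsQuantizer quant) :
    quantError quant 2 ≤ quantError quant 4 := by
  have := sq_integral_mul_le (f := fun z => ‖z - quant z‖ ^ 2) (g := fun _ => 1)
    (μ := stdGaussian (Euc d))
    (by simpa [← pow_mul] using hq.integrable_norm_sub_pow 4) (integrable_const _)
    (by simpa using hq.integrable_norm_sub_pow 2)
  simp only [mul_one, one_pow, integral_const, probReal_univ, one_smul, ← pow_mul,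
    Nat.reduceMul, ← quantError_two_sq, ← quantError_four_pow] at this
  exact le_of_pow_le_pow_left₀ (by norm_num : 4 ≠ 0) (quantError_nonneg 4) this

lemma integral_noiseAmplitude_sq_le (hq : IsQuantizer quant) :
    ∫ z, noiseAmplitude quant z ^ 2 ∂(stdGaussian (Euc d)) ≤
      2 * (gaussMoment d + quantError quant 2 ^ 2) := by
  have e1 : ∫ z, noiseAmplitude quant z ^ 2 ∂(stdGaussian (Euc d)) ≤
      ∫ z, (2 * (1 + ‖z‖) ^ 2 + 2 * ‖z - quant z‖ ^ 2) ∂(stdGaussian (Euc d)) :=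
    integral_mono (hq.integrable_noiseAmplitude_pow 2)
      (((integrable_one_add_norm_pow 2).const_mul 2).add
        ((hq.integrable_norm_sub_pow 2).const_mul 2)) fun z => by
      unfold noiseAmplitude
      simp only
      nlinarith [sq_nonneg (1 + ‖z‖ - ‖z - quant z‖)]
  rw [integral_add ((integrable_one_add_norm_pow 2).const_mul 2)
    ((hq.integrable_norm_sub_pow 2).const_mul 2), integral_const_mul, integral_const_mul,
    ← quantError_two_sq] at e1
  linarith [integral_one_add_norm_pow_le (d := d) (n := 2) (by norm_num)]

lemma integral_noiseAmplitude_four_le (hq : IsQuantizer quant) :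
    ∫ z, noiseAmplitude quant z ^ 4 ∂(stdGaussian (Euc d)) ≤
      8 * (gaussMoment d + quantError quant 4 ^ 4) := by
  have e1 : ∫ z, noiseAmplitude quant z ^ 4 ∂(stdGaussian (Euc d)) ≤
      ∫ z, (8 * (1 + ‖z‖) ^ 4 + 8 * ‖z - quant z‖ ^ 4) ∂(stdGaussian (Euc d)) :=
    integral_mono (hq.integrable_noiseAmplitude_pow 4)
      (((integrable_one_add_norm_pow 4).const_mul 8).add
        ((hq.integrable_norm_sub_pow 4).const_mul 8)) fun z => by
      unfold noiseAmplitude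
      simp only
      have := add_pow_le (by positivity : 0 ≤ 1 + ‖z‖) (norm_nonneg (z - quant z)) 4
      norm_num at this
      linarith
  rw [integral_add ((integrable_one_add_norm_pow 4).const_mul 8)
    ((hq.integrable_norm_sub_pow 4).const_mul 8), integral_const_mul, integral_const_mul,
    ← quantError_four_pow] at e1
  have : ∫ z, (1 + ‖z‖) ^ 4 ∂(stdGaussian (Euc d)) = gaussMoment d := rfl
  linarith

lemma integral_noiseAmplitude_le (hq : IsQuantizer quant) :
    ∫ z, noiseAmplitude quant z ∂(stdGaussian (Euc d)) ≤
      gaussMoment d * (1 + quantError quant 2) := by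
  have hi : Integrable (fun z : Euc d => 1 + ‖z‖) (stdGaussian (Euc d)) := by
    simpa using integrable_one_add_norm_pow (d := d) 1
  have e1 : ∫ z, noiseAmplitude quant z ∂(stdGaussian (Euc d)) =
      (∫ z, (1 + ‖z‖) ∂(stdGaussian (Euc d))) + ∫ z, ‖z - quant z‖ ∂(stdGaussian (Euc d)) :=
    integral_add hi hq.integrable_norm_sub
  have e2 := integral_one_add_norm_pow_le (d := d) (n := 1) (by norm_num)
  simp only [pow_one] at e2
  nlinarith [hq.integral_norm_sub_le, one_le_gaussMoment (d := d),
    quantError_nonneg (quant := quant) 2]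

lemma integrable_noiseAmplitude_mul (hq : IsQuantizer quant) :
    Integrable (fun z => noiseAmplitude quant z * ‖z - quant z‖) (stdGaussian (Euc d)) := by
  obtain ⟨C, hC0, hC⟩ := hq.exists_norm_sub_le
  refine integrable_of_abs_le_pow (hq.measurable_noiseAmplitude.mul hq.measurable_norm_sub)
    (C := (1 + C) * C) 2 fun z => ?_
  have h0 := one_le_noiseAmplitude (quant := quant) z
  rw [abs_of_nonneg (by positivity)]
  calc _ ≤ ((1 + C) * (1 + ‖z‖)) * (C * (1 + ‖z‖)) := by
        gcongr
        · unfold noiseAmplitude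
          linarith [hC z]
        · exact hC z
    _ = _ := by ring

lemma integral_noiseAmplitude_mul_le (hq : IsQuantizer quant) :
    ∫ z, noiseAmplitude quant z * ‖z - quant z‖ ∂(stdGaussian (Euc d)) ≤
      gaussMoment d * (quantError quant 2 * (1 + quantError quant 2)) := by
  have hG := one_le_gaussMoment (d := d)
  have h2 := quantError_nonneg (quant := quant) 2
  have hi : Integrable (fun z : Euc d => (1 + ‖z‖) * ‖z - quant z‖) (stdGaussian (Euc d)) := by
    refine hq.integrable_noiseAmplitude_mul.mono'
      ((measurable_const.add measurable_norm).mul hq.measurable_norm_sub).aestronglyMeasurable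
      (Filter.Eventually.of_forall fun z => ?_)
    rw [Real.norm_of_nonneg (by positivity)]
    refine mul_le_mul_of_nonneg_right ?_ (norm_nonneg _)
    unfold noiseAmplitude
    linarith [norm_nonneg (z - quant z)]
  have e1 := sq_integral_mul_le (integrable_one_add_norm_pow 2) (hq.integrable_norm_sub_pow 2) hi
  have e2 := integral_one_add_norm_pow_le (d := d) (n := 2) (by norm_num)
  rw [← quantError_two_sq] at e1
  have e3 : (∫ z, (1 + ‖z‖) * ‖z - quant z‖ ∂(stdGaussian (Euc d))) ^ 2 ≤
      (gaussMoment d * quantError quant 2) ^ 2 := by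
    refine e1.trans ?_
    rw [mul_pow]
    gcongr
    nlinarith
  have e4 := (abs_le_of_sq_le_sq' e3 (by positivity)).2
  have e5 : ∫ z, noiseAmplitude quant z * ‖z - quant z‖ ∂(stdGaussian (Euc d)) =
      (∫ z, (1 + ‖z‖) * ‖z - quant z‖ ∂(stdGaussian (Euc d))) +
        ∫ z, ‖z - quant z‖ ^ 2 ∂(stdGaussian (Euc d)) := by
    rw [← integral_add hi (hq.integrable_norm_sub_pow 2)]
    congr 1; funext z; unfold noiseAmplitude; ring
  rw [e5, ← quantError_two_sq]
  nlinarith [sq_nonneg (quantError quant 2)]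

end IsQuantizer

end Quantizer

/-! ### Moment growth in one projected quantized step -/

section QuantizedStep

variable {d q : ℕ} {M : SwitchingModel d q} {L ε h D R : ℝ} {proj quant : Euc d → Euc d}

/-- The exponent of the moment bounds of one quantized step. -/
noncomputable def quantConst (d : ℕ) (L : ℝ) : ℝ := 1300 * L ^ 4 * gaussMoment d

lemma quantConst_nonneg (d : ℕ) (L : ℝ) : 0 ≤ quantConst d L := by
  have := one_le_gaussMoment (d := d)
  unfold quantConst
  positivity

section ErrorComparison

/-- Young's inequality turns an error of order √h e₂ into a growth rate h(1 + h⁻¹e₂²); over T/h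
steps this is the origin of the exponential of h⁻¹e₂². -/
lemma sqrt_mul_quantError_le (h0 : 0 < h) :
    √h * quantError quant 2 ≤ h * (1 + h⁻¹ * quantError quant 2 ^ 2) / 2 := by
  have e1 := two_mul_le_add_sq (√h) (quantError quant 2)
  rw [Real.sq_sqrt h0.le] at e1
  have e2 : h * (1 + h⁻¹ * quantError quant 2 ^ 2) = h + quantError quant 2 ^ 2 := by field_simp
  linarith

lemma quantError_two_sq_le (hq : IsQuantizer quant) (h0 : 0 < h) :
    quantError quant 2 ^ 2 ≤ h * (1 + (h ^ 2)⁻¹ * quantError quant 4 ^ 4) / 2 := by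
  have e0 : quantError quant 2 ^ 2 ≤ quantError quant 4 ^ 2 :=
    pow_le_pow_left₀ (IsQuantizer.quantError_nonneg 2) hq.quantError_two_le_four 2
  have e1 := two_mul_le_add_sq h (quantError quant 4 ^ 2)
  rw [← pow_mul, show 2 * 2 = 4 from rfl] at e1
  have e2 : h * (h * (1 + (h ^ 2)⁻¹ * quantError quant 4 ^ 4)) =
      h ^ 2 + quantError quant 4 ^ 4 := by field_simp
  have e3 : h * (2 * quantError quant 4 ^ 2) ≤
      h * (h * (1 + (h ^ 2)⁻¹ * quantError quant 4 ^ 4)) := by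
    rw [e2]; linarith
  have := le_of_mul_le_mul_left e3 h0
  linarith

lemma inv_mul_quantError_two_sq_le (hq : IsQuantizer quant) (h0 : 0 < h) :
    h⁻¹ * quantError quant 2 ^ 2 ≤ (1 + (h ^ 2)⁻¹ * quantError quant 4 ^ 4) / 2 := by
  rw [inv_mul_le_iff₀ h0]
  linarith [quantError_two_sq_le hq h0]

end ErrorComparison

namespace SwitchingModel.UniformBounds

lemma abs_inner_σ_le (H : M.UniformBounds L ε) (D : ℝ) (j : Fin q) (x z : Euc d) :
    |inner ℝ x (M.σ j x z)| ≤ L * lyapunov D x * ‖z‖ := by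
  have hL := H.pos_L
  have hρ := bracket_pos x
  calc _ ≤ ‖x‖ * ‖M.σ j x z‖ := abs_real_inner_le_norm _ _
    _ ≤ bracket x * (L * bracket x * ‖z‖) := by
      gcongr
      · exact norm_le_bracket x
      · exact ((M.σ j x).le_opNorm z).trans (by gcongr; exact H.σ_le j x)
    _ = L * bracket x ^ 2 * ‖z‖ := by ring
    _ ≤ _ := by gcongr; exact bracket_sq_le_lyapunov D x

set_option maxHeartbeats 400000 in
-- The only term of order √h is the product of `x` with the noise. There ẑ is written as z + (ẑ -
-- z): the part in z is linear and centred, and the correction costs √h|z - ẑ|. All other terms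
-- already carry a factor h.
lemma lyapunov_eulerStep_quant_le (H : M.UniformBounds L ε) (h0 : 0 ≤ h) (h1 : h ≤ 1) (D : ℝ)
    (quant : Euc d → Euc d) (j : Fin q) (x z : Euc d) :
    lyapunov D (M.eulerStep h j x (quant z)) ≤
      lyapunov D x + 2 * √h * inner ℝ x (M.σ j x z) +
        lyapunov D x * (6 * L ^ 2 * (√h * ‖z - quant z‖ + h * noiseAmplitude quant z ^ 2)) := by
  have hL := H.pos_L
  have hL1 := H.one_le
  have hρ := bracket_pos x
  set a := noiseAmplitude quant z with ha
  set e := ‖z - quant z‖ with he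
  have ha1 : 1 ≤ a := one_le_noiseAmplitude z
  have hq : ‖quant z‖ ≤ a := by linarith [one_add_norm_quant_le (quant := quant) z]
  have f1 : ‖M.eulerStep h j x (quant z)‖ ^ 2 = ‖x + h • M.b j x‖ ^ 2 +
      2 * √h * inner ℝ (x + h • M.b j x) (M.σ j x (quant z)) +
      h * ‖M.σ j x (quant z)‖ ^ 2 := sq_norm_add_smul_clm _ _ h0 _
  have f2 : ‖x + h • M.b j x‖ ^ 2 = ‖x‖ ^ 2 + 2 * h * inner ℝ x (M.b j x) +
      h ^ 2 * ‖M.b j x‖ ^ 2 := by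
    rw [norm_add_sq_real, inner_smul_right, norm_smul, mul_pow, Real.norm_of_nonneg h0]; ring
  have f3 : inner ℝ (x + h • M.b j x) (M.σ j x (quant z)) =
      inner ℝ x (M.σ j x z) + inner ℝ x (M.σ j x (quant z - z)) +
        h * inner ℝ (M.b j x) (M.σ j x (quant z)) := by
    rw [inner_add_left, real_inner_smul_left, map_sub, inner_sub_right]; ring
  have hσ (y : Euc d) : ‖M.σ j x y‖ ≤ L * bracket x * ‖y‖ :=
    ((M.σ j x).le_opNorm y).trans (by gcongr; exact H.σ_le j x)
  have g1 : inner ℝ x (M.b j x) ≤ L * bracket x ^ 2 := by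
    calc _ ≤ ‖x‖ * ‖M.b j x‖ := real_inner_le_norm _ _
      _ ≤ bracket x * (L * bracket x) := by
        gcongr
        · exact norm_le_bracket x
        · exact H.b_le j x
      _ = _ := by ring
  have g2 : ‖M.b j x‖ ^ 2 ≤ L ^ 2 * bracket x ^ 2 := by
    rw [← mul_pow]; gcongr; exact H.b_le j x
  have g3 : inner ℝ x (M.σ j x (quant z - z)) ≤ L * bracket x ^ 2 * e := by
    calc _ ≤ ‖x‖ * ‖M.σ j x (quant z - z)‖ := real_inner_le_norm _ _
      _ ≤ bracket x * (L * bracket x * e) := by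
        gcongr
        · exact norm_le_bracket x
        · have := hσ (quant z - z)
          rwa [norm_sub_rev] at this
      _ = _ := by ring
  have g4 : inner ℝ (M.b j x) (M.σ j x (quant z)) ≤ L ^ 2 * bracket x ^ 2 * a := by
    calc _ ≤ ‖M.b j x‖ * ‖M.σ j x (quant z)‖ := real_inner_le_norm _ _
      _ ≤ (L * bracket x) * (L * bracket x * a) := by
        gcongr
        · exact H.b_le j x
        · exact (hσ _).trans (by gcongr)
      _ = _ := by ring
  have g5 : ‖M.σ j x (quant z)‖ ^ 2 ≤ L ^ 2 * bracket x ^ 2 * a ^ 2 := by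
    calc _ ≤ (L * bracket x * a) ^ 2 := by gcongr; exact (hσ _).trans (by gcongr)
      _ = _ := by ring
  have hs1 : √h ≤ 1 := Real.sqrt_le_one.2 h1
  have he0 : 0 ≤ e := norm_nonneg _
  clear_value a e
  clear hσ
  set P := L ^ 2 * bracket x ^ 2 with hP
  have hP0 : 0 ≤ P := by positivity
  have hLP : L * bracket x ^ 2 ≤ P := by rw [hP]; gcongr; nlinarith
  have haa : a ≤ a ^ 2 := by nlinarith
  have ha2 : 1 ≤ a ^ 2 := by nlinarith
  have i1 : 2 * h * inner ℝ x (M.b j x) ≤ 2 * h * (P * a ^ 2) := by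
    gcongr; nlinarith
  have i2 : h ^ 2 * ‖M.b j x‖ ^ 2 ≤ h * (P * a ^ 2) := by
    have : h ^ 2 ≤ h := by nlinarith
    calc _ ≤ h * P := by gcongr
      _ ≤ _ := by gcongr; nlinarith
  have i3 : 2 * √h * inner ℝ x (M.σ j x (quant z - z)) ≤ 2 * √h * (P * e) := by
    gcongr
    exact g3.trans (by gcongr)
  have i4 : 2 * √h * (h * inner ℝ (M.b j x) (M.σ j x (quant z))) ≤ 2 * h * (P * a ^ 2) := by
    calc _ ≤ 2 * √h * (h * (P * a ^ 2)) := by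
          gcongr
          exact g4.trans (by gcongr)
      _ ≤ 2 * 1 * (h * (P * a ^ 2)) := by gcongr
      _ = _ := by ring
  have i5 : h * ‖M.σ j x (quant z)‖ ^ 2 ≤ h * (P * a ^ 2) := by gcongr
  have i6 : P * (6 * (√h * e + h * a ^ 2)) ≤
      lyapunov D x * (6 * L ^ 2 * (√h * e + h * a ^ 2)) := by
    have := bracket_sq_le_lyapunov D x
    calc _ = bracket x ^ 2 * (6 * L ^ 2 * (√h * e + h * a ^ 2)) := by rw [hP]; ring
      _ ≤ _ := by gcongr
  have : lyapunov D (M.eulerStep h j x (quant z)) =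
      lyapunov D x + (‖M.eulerStep h j x (quant z)‖ ^ 2 - ‖x‖ ^ 2) := by unfold lyapunov; ring
  have i7 : 0 ≤ √h * (P * e) := mul_nonneg (Real.sqrt_nonneg h) (mul_nonneg hP0 he0)
  rw [this, f1, f2, f3]
  linarith

lemma integral_lyapunov_eulerStep_quant_le (H : M.UniformBounds L ε) (hq : IsQuantizer quant)
    (h0 : 0 < h) (h1 : h ≤ 1) (D : ℝ) (j : Fin q) (x : Euc d) :
    ∫ z, lyapunov D (M.eulerStep h j x (quant z)) ∂(stdGaussian (Euc d)) ≤
      lyapunov D x *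
        (1 + 18 * L ^ 2 * gaussMoment d * (h * (1 + h⁻¹ * quantError quant 2 ^ 2))) := by
  have hG := one_le_gaussMoment (d := d)
  have hL := H.pos_L
  have hψ := lyapunov_pos D x
  have hI := integrable_inner_clm x (M.σ j x)
  have hI' : Integrable (fun z => lyapunov D x + 2 * √h * inner ℝ x (M.σ j x z))
    (stdGaussian (Euc d)) := (integrable_const _).add (hI.const_mul _)
  have hr := (hq.integrable_norm_sub.const_mul (√h)).add
    ((hq.integrable_noiseAmplitude_pow 2).const_mul h)
  have e1 := integral_mono
    (hq.integrable_comp fun y => lyapunov D (M.eulerStep h j x y))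
    (hI'.add ((hr.const_mul (6 * L ^ 2)).const_mul (lyapunov D x)))
    fun z => H.lyapunov_eulerStep_quant_le h0.le h1 D quant j x z
  refine e1.trans ?_
  rw [integral_add' hI' ((hr.const_mul (6 * L ^ 2)).const_mul (lyapunov D x)),
    integral_add (integrable_const _) (hI.const_mul _), integral_const_mul, integral_const_mul,
    integral_const_mul, integral_inner_clm, integral_add' (hq.integrable_norm_sub.const_mul (√h))
    ((hq.integrable_noiseAmplitude_pow 2).const_mul h), integral_const_mul, integral_const_mul]
  simp only [integral_const, probReal_univ, one_smul, mul_zero, add_zero]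
  set T2 := h⁻¹ * quantError quant 2 ^ 2 with hT2
  have hT0 : 0 ≤ T2 := by positivity
  have he2 : quantError quant 2 ^ 2 = h * T2 := by rw [hT2]; field_simp
  have f1 : √h * ∫ z, ‖z - quant z‖ ∂(stdGaussian (Euc d)) ≤ h * (1 + T2) / 2 :=
    (mul_le_mul_of_nonneg_left hq.integral_norm_sub_le (Real.sqrt_nonneg h)).trans
      (sqrt_mul_quantError_le h0)
  have f2 : h * ∫ z, noiseAmplitude quant z ^ 2 ∂(stdGaussian (Euc d)) ≤
      h * (2 * (gaussMoment d * (1 + T2))) := by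
    gcongr
    refine hq.integral_noiseAmplitude_sq_le.trans ?_
    rw [he2]
    nlinarith
  have f3 : h * (1 + T2) ≤ gaussMoment d * (h * (1 + T2)) :=
    le_mul_of_one_le_left (by positivity) hG
  have f4 : √h * (∫ z, ‖z - quant z‖ ∂(stdGaussian (Euc d))) +
      h * ∫ z, noiseAmplitude quant z ^ 2 ∂(stdGaussian (Euc d)) ≤
      3 * (gaussMoment d * (h * (1 + T2))) := by
    have : 0 ≤ gaussMoment d * (h * (1 + T2)) := by positivity
    linarith
  calc _ ≤ lyapunov D x + lyapunov D x *
        (6 * L ^ 2 * (3 * (gaussMoment d * (h * (1 + T2))))) := by gcongr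
    _ = _ := by ring

/-- When the bound is squared the centred term stays linear against ψ; the squares of the remaining
terms bring in the fourth power of the amplitude, hence the L⁴ quantization error. -/
lemma sq_lyapunov_eulerStep_quant_le (H : M.UniformBounds L ε) (h0 : 0 ≤ h) (h1 : h ≤ 1) (D : ℝ)
    (quant : Euc d → Euc d) (j : Fin q) (x z : Euc d) :
    lyapunov D (M.eulerStep h j x (quant z)) ^ 2 ≤
      (lyapunov D x ^ 2 + 4 * √h * lyapunov D x * inner ℝ x (M.σ j x z)) +
        lyapunov D x ^ 2 * ((8 * h * L ^ 2 * (1 + ‖z‖) ^ 2 +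
          12 * L ^ 2 * (√h * ‖z - quant z‖ + h * noiseAmplitude quant z ^ 2)) +
          144 * L ^ 4 * (h * ‖z - quant z‖ ^ 2 + h ^ 2 * noiseAmplitude quant z ^ 4)) := by
  have e1 := H.lyapunov_eulerStep_quant_le h0 h1 D quant j x z
  have hψ := lyapunov_pos D x
  have hψ' := lyapunov_pos D (M.eulerStep h j x (quant z))
  have hL := H.pos_L
  set ψ := lyapunov D x
  set I := inner ℝ x (M.σ j x z) with hI
  set e := ‖z - quant z‖
  set a := noiseAmplitude quant z
  set r := 6 * L ^ 2 * (√h * e + h * a ^ 2) with hr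
  have e2 : lyapunov D (M.eulerStep h j x (quant z)) ^ 2 ≤ (ψ + 2 * √h * I + ψ * r) ^ 2 := by
    gcongr
  have e3 : I ^ 2 ≤ L ^ 2 * ψ ^ 2 * (1 + ‖z‖) ^ 2 := by
    have f1 : |I| ≤ L * ψ * (1 + ‖z‖) :=
      (H.abs_inner_σ_le D j x z).trans (by gcongr; linarith)
    calc I ^ 2 = |I| ^ 2 := (sq_abs I).symm
      _ ≤ (L * ψ * (1 + ‖z‖)) ^ 2 := by gcongr
      _ = _ := by ring
  have hs : √h ^ 2 = h := Real.sq_sqrt h0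
  have e4 : r ^ 2 ≤ 72 * L ^ 4 * (h * e ^ 2 + h ^ 2 * a ^ 4) := by
    have f1 : (√h * e + h * a ^ 2) ^ 2 ≤ 2 * (h * e ^ 2 + h ^ 2 * a ^ 4) := by
      have := sq_nonneg (√h * e - h * a ^ 2)
      have f2 : (√h * e) ^ 2 = h * e ^ 2 := by rw [mul_pow, hs]
      nlinarith
    calc r ^ 2 = 36 * L ^ 4 * (√h * e + h * a ^ 2) ^ 2 := by rw [hr]; ring
      _ ≤ 36 * L ^ 4 * (2 * (h * e ^ 2 + h ^ 2 * a ^ 4)) := by gcongr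
      _ = _ := by ring
  have e5 : (ψ + 2 * √h * I + ψ * r) ^ 2 ≤
      ψ ^ 2 + 4 * √h * ψ * I + 8 * h * I ^ 2 + 2 * ψ ^ 2 * r + 2 * ψ ^ 2 * r ^ 2 := by
    have f1 := sq_nonneg (2 * √h * I - ψ * r)
    have f2 : (√h * I) ^ 2 = h * I ^ 2 := by rw [mul_pow, hs]
    nlinarith
  have e6 : 8 * h * I ^ 2 ≤ 8 * h * (L ^ 2 * ψ ^ 2 * (1 + ‖z‖) ^ 2) := by gcongr
  have e7 : 2 * ψ ^ 2 * r ^ 2 ≤ 2 * ψ ^ 2 * (72 * L ^ 4 * (h * e ^ 2 + h ^ 2 * a ^ 4)) := by gcongr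
  calc _ ≤ _ := e2
    _ ≤ _ := e5
    _ ≤ ψ ^ 2 + 4 * √h * ψ * I + 8 * h * (L ^ 2 * ψ ^ 2 * (1 + ‖z‖) ^ 2) + 2 * ψ ^ 2 * r +
        2 * ψ ^ 2 * (72 * L ^ 4 * (h * e ^ 2 + h ^ 2 * a ^ 4)) := by linarith
    _ = _ := by rw [hr]; ring

lemma integral_sq_lyapunov_eulerStep_quant_le (H : M.UniformBounds L ε) (hq : IsQuantizer quant)
    (h0 : 0 < h) (h1 : h ≤ 1) (D : ℝ) (j : Fin q) (x : Euc d) :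
    ∫ z, lyapunov D (M.eulerStep h j x (quant z)) ^ 2 ∂(stdGaussian (Euc d)) ≤
      lyapunov D x ^ 2 *
        (1 + 1277 * L ^ 4 * gaussMoment d * (h * (1 + (h ^ 2)⁻¹ * quantError quant 4 ^ 4))) := by
  have hG := one_le_gaussMoment (d := d)
  have hL := H.pos_L
  have hL1 := H.one_le
  have hψ := lyapunov_pos D x
  have hI := integrable_inner_clm x (M.σ j x)
  have hI' : Integrable (fun z => lyapunov D x ^ 2 + 4 * √h * lyapunov D x *
      inner ℝ x (M.σ j x z)) (stdGaussian (Euc d)) := (integrable_const _).add (hI.const_mul _)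
  have hr1 : Integrable (fun z => √h * ‖z - quant z‖ + h * noiseAmplitude quant z ^ 2)
      (stdGaussian (Euc d)) := (hq.integrable_norm_sub.const_mul (√h)).add
    ((hq.integrable_noiseAmplitude_pow 2).const_mul h)
  have hr2 : Integrable (fun z => h * ‖z - quant z‖ ^ 2 + h ^ 2 * noiseAmplitude quant z ^ 4)
      (stdGaussian (Euc d)) := ((hq.integrable_norm_sub_pow 2).const_mul h).add
    ((hq.integrable_noiseAmplitude_pow 4).const_mul (h ^ 2))
  have hr3 : Integrable (fun z : Euc d => 8 * h * L ^ 2 * (1 + ‖z‖) ^ 2 +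
      12 * L ^ 2 * (√h * ‖z - quant z‖ + h * noiseAmplitude quant z ^ 2)) (stdGaussian (Euc d)) :=
    ((integrable_one_add_norm_pow 2).const_mul _).add (hr1.const_mul _)
  have hr4 : Integrable (fun z => (8 * h * L ^ 2 * (1 + ‖z‖) ^ 2 +
      12 * L ^ 2 * (√h * ‖z - quant z‖ + h * noiseAmplitude quant z ^ 2)) +
      144 * L ^ 4 * (h * ‖z - quant z‖ ^ 2 + h ^ 2 * noiseAmplitude quant z ^ 4))
      (stdGaussian (Euc d)) := hr3.add (hr2.const_mul _)
  have e1 := integral_mono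
    (hq.integrable_comp fun y => lyapunov D (M.eulerStep h j x y) ^ 2)
    (hI'.add (hr4.const_mul (lyapunov D x ^ 2)))
    fun z => H.sq_lyapunov_eulerStep_quant_le h0.le h1 D quant j x z
  refine e1.trans ?_
  rw [integral_add' hI' (hr4.const_mul (lyapunov D x ^ 2)),
    integral_add (integrable_const _) (hI.const_mul _), integral_const_mul, integral_const_mul,
    integral_inner_clm, integral_add hr3 (hr2.const_mul _),
    integral_add ((integrable_one_add_norm_pow 2).const_mul _) (hr1.const_mul _),
    integral_const_mul, integral_const_mul, integral_const_mul,
    integral_add (hq.integrable_norm_sub.const_mul (√h))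
      ((hq.integrable_noiseAmplitude_pow 2).const_mul h),
    integral_add ((hq.integrable_norm_sub_pow 2).const_mul h)
      ((hq.integrable_noiseAmplitude_pow 4).const_mul (h ^ 2)),
    integral_const_mul, integral_const_mul, integral_const_mul, integral_const_mul,
    ← IsQuantizer.quantError_two_sq]
  simp only [integral_const, probReal_univ, one_smul, mul_zero, add_zero]
  set S := (h ^ 2)⁻¹ * quantError quant 4 ^ 4 with hS
  have hS0 : 0 ≤ S := by positivity
  have he4 : quantError quant 4 ^ 4 = h ^ 2 * S := by rw [hS]; field_simp
  have he2 : quantError quant 2 ^ 2 ≤ h * (1 + S) / 2 := quantError_two_sq_le hq h0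
  have hT2 := inv_mul_quantError_two_sq_le hq h0
  rw [← hS] at hT2
  have f1 : √h * ∫ z, ‖z - quant z‖ ∂(stdGaussian (Euc d)) ≤ 3 / 4 * (h * (1 + S)) := by
    refine (mul_le_mul_of_nonneg_left hq.integral_norm_sub_le (Real.sqrt_nonneg h)).trans
      ((sqrt_mul_quantError_le h0).trans ?_)
    have := mul_le_mul_of_nonneg_left hT2 h0.le
    have : 0 ≤ h * S := by positivity
    linarith
  set Q := gaussMoment d * (h * (1 + S)) with hQ
  have hQ1 : h * (1 + S) ≤ Q := le_mul_of_one_le_left (by positivity) hG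
  have hhS : 0 ≤ h * S := by positivity
  have hGS : 0 ≤ gaussMoment d * h * S := by positivity
  have hhG : h * gaussMoment d ≤ Q := by rw [hQ]; nlinarith
  have hhe : h * quantError quant 2 ^ 2 ≤ Q / 2 := by
    have : h * quantError quant 2 ^ 2 ≤ 1 * quantError quant 2 ^ 2 := by gcongr
    linarith
  have f2 : h * ∫ z, noiseAmplitude quant z ^ 2 ∂(stdGaussian (Euc d)) ≤ 3 * Q := by
    have := mul_le_mul_of_nonneg_left hq.integral_noiseAmplitude_sq_le h0.le
    linarith
  have f3 : ∫ z, (1 + ‖z‖) ^ 2 ∂(stdGaussian (Euc d)) ≤ gaussMoment d :=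
    integral_one_add_norm_pow_le (by norm_num)
  have f4 : h ^ 2 * ∫ z, noiseAmplitude quant z ^ 4 ∂(stdGaussian (Euc d)) ≤ 8 * Q := by
    have g1 := mul_le_mul_of_nonneg_left hq.integral_noiseAmplitude_four_le (sq_nonneg h)
    rw [he4] at g1
    have g2 : h ^ 2 * gaussMoment d ≤ h * gaussMoment d := by gcongr; nlinarith
    have g3 : h ^ 2 * (h ^ 2 * S) ≤ gaussMoment d * h * S := by
      have : h ^ 2 * h ^ 2 ≤ gaussMoment d * h := by
        have h3 : h ^ 2 * h ^ 2 ≤ 1 * h := by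
          have : h ^ 2 ≤ 1 := by nlinarith
          have : h ^ 2 ≤ h := by nlinarith
          gcongr
        exact h3.trans (by gcongr)
      nlinarith
    have : Q = h * gaussMoment d + gaussMoment d * h * S := by rw [hQ]; ring
    linarith
  have k1 : 8 * h * L ^ 2 * ∫ z, (1 + ‖z‖) ^ 2 ∂(stdGaussian (Euc d)) ≤ 8 * L ^ 4 * Q := by
    calc _ ≤ 8 * h * L ^ 2 * gaussMoment d := by gcongr
      _ = 8 * L ^ 2 * (h * gaussMoment d) := by ring
      _ ≤ 8 * L ^ 4 * Q := by
        have : L ^ 2 ≤ L ^ 4 := pow_le_pow_right₀ hL1 (by norm_num)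
        gcongr
  have k2 : 12 * L ^ 2 * (√h * (∫ z, ‖z - quant z‖ ∂(stdGaussian (Euc d))) +
      h * ∫ z, noiseAmplitude quant z ^ 2 ∂(stdGaussian (Euc d))) ≤ 12 * L ^ 4 * (15 / 4 * Q) := by
    have : L ^ 2 ≤ L ^ 4 := pow_le_pow_right₀ hL1 (by norm_num)
    have hQ0 : 0 ≤ Q := by positivity
    calc _ ≤ 12 * L ^ 2 * (15 / 4 * Q) := by gcongr; linarith
      _ ≤ _ := by gcongr
  have k3 : 144 * L ^ 4 * (h * quantError quant 2 ^ 2 +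
      h ^ 2 * ∫ z, noiseAmplitude quant z ^ 4 ∂(stdGaussian (Euc d))) ≤
      144 * L ^ 4 * (17 / 2 * Q) := by gcongr; linarith
  -- The three contributions add up to 8 + 12 · 15/4 + 144 · 17/2 = 1277.
  have k4 := add_le_add (add_le_add k1 k2) k3
  have k5 := mul_le_mul_of_nonneg_left k4 (sq_nonneg (lyapunov D x))
  refine (add_le_add_right k5 _).trans (le_of_eq ?_)
  rw [hQ]
  ring

lemma integral_lyapunov_proj_le (H : M.UniformBounds L ε) (hd : 0 < d) (hD : 0 < D)
    (hproj : IsClosestNeighbour (spaceGrid d (h * D) R) proj) (hq : IsQuantizer quant)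
    (h0 : 0 < h) (h1 : h ≤ 1) (j : Fin q) (x : Euc d) :
    ∫ z, lyapunov D (proj (M.eulerStep h j x (quant z))) ∂(stdGaussian (Euc d)) ≤
      Real.exp (20 * L ^ 4 * gaussMoment d * (h * (1 + h⁻¹ * quantError quant 2 ^ 2))) *
        lyapunov D x := by
  have hG := one_le_gaussMoment (d := d)
  have hL := H.pos_L
  have hψ := lyapunov_pos D x
  set Q := h * (1 + h⁻¹ * quantError quant 2 ^ 2) with hQ
  have hQh : h ≤ Q := le_mul_of_one_le_right h0.le (by
    have : 0 ≤ h⁻¹ * quantError quant 2 ^ 2 := by positivity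
    linarith)
  have e1 := integral_mono
    (hq.integrable_comp fun y => lyapunov D (proj (M.eulerStep h j x y)))
    ((hq.integrable_comp fun y => lyapunov D (M.eulerStep h j x y)).const_mul (1 + 2 * h))
    fun z => lyapunov_proj_le hd h0 h1 hD hproj _
  rw [integral_const_mul] at e1
  have e2 := H.integral_lyapunov_eulerStep_quant_le hq h0 h1 D j x
  have e3 : 1 + 2 * h ≤ Real.exp (2 * h) := by linarith [Real.add_one_le_exp (2 * h)]
  have e4 : 1 + 18 * L ^ 2 * gaussMoment d * Q ≤ Real.exp (18 * L ^ 2 * gaussMoment d * Q) := by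
    linarith [Real.add_one_le_exp (18 * L ^ 2 * gaussMoment d * Q)]
  have e5 : 2 * h + 18 * L ^ 2 * gaussMoment d * Q ≤ 20 * L ^ 4 * gaussMoment d * Q := by
    have f1 : L ^ 2 ≤ L ^ 4 := pow_le_pow_right₀ H.one_le (by norm_num)
    have f2 : 1 ≤ L ^ 4 := one_le_pow₀ H.one_le
    have hQ0 : 0 ≤ Q := h0.le.trans hQh
    have f3 : 18 * L ^ 2 * gaussMoment d * Q ≤ 18 * L ^ 4 * gaussMoment d * Q := by gcongr
    have f4 : 1 * Q ≤ L ^ 4 * gaussMoment d * Q := by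
      gcongr; exact one_le_mul_of_one_le_of_one_le f2 hG
    linarith
  calc _ ≤ _ := e1
    _ ≤ (1 + 2 * h) * (lyapunov D x * (1 + 18 * L ^ 2 * gaussMoment d * Q)) := by gcongr
    _ ≤ Real.exp (2 * h) * (lyapunov D x * Real.exp (18 * L ^ 2 * gaussMoment d * Q)) := by
        gcongr
    _ = Real.exp (2 * h + 18 * L ^ 2 * gaussMoment d * Q) * lyapunov D x := by
        rw [Real.exp_add]; ring
    _ ≤ _ := by gcongr

lemma integral_sq_lyapunov_proj_le (H : M.UniformBounds L ε) (hd : 0 < d) (hD : 0 < D)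
    (hproj : IsClosestNeighbour (spaceGrid d (h * D) R) proj) (hq : IsQuantizer quant)
    (h0 : 0 < h) (h1 : h ≤ 1) (j : Fin q) (x : Euc d) :
    ∫ z, lyapunov D (proj (M.eulerStep h j x (quant z))) ^ 2 ∂(stdGaussian (Euc d)) ≤
      Real.exp (quantConst d L * (h * (1 + (h ^ 2)⁻¹ * quantError quant 4 ^ 4))) *
        lyapunov D x ^ 2 := by
  have hG := one_le_gaussMoment (d := d)
  have hL := H.pos_L
  have hψ := lyapunov_pos D x
  set Q := h * (1 + (h ^ 2)⁻¹ * quantError quant 4 ^ 4) with hQ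
  have hQh : h ≤ Q := le_mul_of_one_le_right h0.le (by
    have : 0 ≤ (h ^ 2)⁻¹ * quantError quant 4 ^ 4 := by positivity
    linarith)
  have e1 := integral_mono
    (hq.integrable_comp fun y => lyapunov D (proj (M.eulerStep h j x y)) ^ 2)
    ((hq.integrable_comp fun y => lyapunov D (M.eulerStep h j x y) ^ 2).const_mul
      ((1 + 2 * h) ^ 2))
    fun z => by
      have := lyapunov_pos D (proj (M.eulerStep h j x (quant z)))
      simp only
      rw [← mul_pow]
      gcongr
      exact lyapunov_proj_le hd h0 h1 hD hproj _
  rw [integral_const_mul] at e1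
  have e2 := H.integral_sq_lyapunov_eulerStep_quant_le hq h0 h1 D j x
  have e3 : 1 + 2 * h ≤ Real.exp (2 * h) := by linarith [Real.add_one_le_exp (2 * h)]
  have e4 : 1 + 1277 * L ^ 4 * gaussMoment d * Q ≤
      Real.exp (1277 * L ^ 4 * gaussMoment d * Q) := by
    linarith [Real.add_one_le_exp (1277 * L ^ 4 * gaussMoment d * Q)]
  have hQ0 : 0 ≤ Q := h0.le.trans hQh
  have e5 : 2 * h + 2 * h + 1277 * L ^ 4 * gaussMoment d * Q ≤ quantConst d L * Q := by
    have f2 : 1 ≤ L ^ 4 := one_le_pow₀ H.one_le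
    have f4 : 1 * Q ≤ L ^ 4 * gaussMoment d * Q := by
      gcongr; exact one_le_mul_of_one_le_of_one_le f2 hG
    unfold quantConst
    linarith
  calc _ ≤ _ := e1
    _ ≤ (1 + 2 * h) ^ 2 * (lyapunov D x ^ 2 * (1 + 1277 * L ^ 4 * gaussMoment d * Q)) := by gcongr
    _ ≤ Real.exp (2 * h) ^ 2 *
        (lyapunov D x ^ 2 * Real.exp (1277 * L ^ 4 * gaussMoment d * Q)) := by
        gcongr
    _ = Real.exp (2 * h + 2 * h + 1277 * L ^ 4 * gaussMoment d * Q) * lyapunov D x ^ 2 := by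
        rw [Real.exp_add, Real.exp_add]; ring
    _ ≤ _ := by gcongr

lemma integral_lyapunov_proj_le' (H : M.UniformBounds L ε) (hd : 0 < d) (hD : 0 < D)
    (hproj : IsClosestNeighbour (spaceGrid d (h * D) R) proj) (hq : IsQuantizer quant)
    (h0 : 0 < h) (h1 : h ≤ 1) (j : Fin q) (x : Euc d) :
    ∫ z, lyapunov D (proj (M.eulerStep h j x (quant z))) ∂(stdGaussian (Euc d)) ≤
      Real.exp (quantConst d L * (h * (1 + h⁻¹ * quantError quant 2 ^ 2))) *
        lyapunov D x := by
  refine (H.integral_lyapunov_proj_le hd hD hproj hq h0 h1 j x).trans ?_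
  have := lyapunov_pos D x
  have := one_le_gaussMoment (d := d)
  have := H.pos_L
  unfold quantConst
  gcongr
  norm_num

/-- Since e₂ ≤ e₄, Young's inequality gives h⁻¹e₂² ≤ (1 + h⁻²e₄⁴)/2, so the growth factor in e₄
dominates the one in e₂. The moments of ψ and ψ² then share one factor and can be interpolated. -/
lemma integral_lyapunov_proj_le_four (H : M.UniformBounds L ε) (hd : 0 < d) (hD : 0 < D)
    (hproj : IsClosestNeighbour (spaceGrid d (h * D) R) proj) (hq : IsQuantizer quant)
    (h0 : 0 < h) (h1 : h ≤ 1) (j : Fin q) (x : Euc d) :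
    ∫ z, lyapunov D (proj (M.eulerStep h j x (quant z))) ∂(stdGaussian (Euc d)) ≤
      Real.exp (quantConst d L * (h * (1 + (h ^ 2)⁻¹ * quantError quant 4 ^ 4))) *
        lyapunov D x := by
  refine (H.integral_lyapunov_proj_le hd hD hproj hq h0 h1 j x).trans ?_
  have := lyapunov_pos D x
  have hG := one_le_gaussMoment (d := d)
  have hL := H.pos_L
  have e1 := inv_mul_quantError_two_sq_le hq h0
  set S := (h ^ 2)⁻¹ * quantError quant 4 ^ 4
  have hS : 0 ≤ S := by positivity
  have e2 : h * (1 + h⁻¹ * quantError quant 2 ^ 2) ≤ 2 * (h * (1 + S)) := by nlinarith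
  refine mul_le_mul_of_nonneg_right (Real.exp_le_exp.2 ?_) this.le
  have e3 : 20 * L ^ 4 * gaussMoment d * (h * (1 + h⁻¹ * quantError quant 2 ^ 2)) ≤
      20 * L ^ 4 * gaussMoment d * (2 * (h * (1 + S))) :=
    mul_le_mul_of_nonneg_left e2 (by positivity)
  have e4 : 0 ≤ L ^ 4 * gaussMoment d * (h * (1 + S)) := by positivity
  unfold quantConst
  linarith

/-- With s = √ψ(x), √p ≤ p/(2s) + s/2 reduces the claim to the mean of ψ; the growth factor is kept
because it is at least 1. -/
lemma integral_sqrt_lyapunov_proj_le (H : M.UniformBounds L ε) (hd : 0 < d) (hD : 0 < D)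
    (hproj : IsClosestNeighbour (spaceGrid d (h * D) R) proj) (hq : IsQuantizer quant)
    (h0 : 0 < h) (h1 : h ≤ 1) (j : Fin q) (x : Euc d) :
    ∫ z, √(lyapunov D (proj (M.eulerStep h j x (quant z)))) ∂(stdGaussian (Euc d)) ≤
      Real.exp (quantConst d L * (h * (1 + h⁻¹ * quantError quant 2 ^ 2))) *
        √(lyapunov D x) := by
  have e0 := H.integral_lyapunov_proj_le' hd hD hproj hq h0 h1 j x
  have hψ := lyapunov_pos D x
  set s := √(lyapunov D x) with hs
  have hs0 : 0 < s := Real.sqrt_pos.2 hψ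
  have hss : lyapunov D x = s ^ 2 := (Real.sq_sqrt hψ.le).symm
  have hΓ : 1 ≤ Real.exp (quantConst d L * (h * (1 + h⁻¹ * quantError quant 2 ^ 2))) :=
    Real.one_le_exp (mul_nonneg (quantConst_nonneg d L) (by positivity))
  set Γ := Real.exp (quantConst d L * (h * (1 + h⁻¹ * quantError quant 2 ^ 2)))
  have hi := hq.integrable_comp fun y => lyapunov D (proj (M.eulerStep h j x y))
  have e1 := integral_mono
    (hq.integrable_comp fun y => √(lyapunov D (proj (M.eulerStep h j x y))))
    ((hi.const_mul (2 * s)⁻¹).add (integrable_const (s / 2))) fun z => by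
      set p := lyapunov D (proj (M.eulerStep h j x (quant z))) with hp
      have hp0 : 0 < p := lyapunov_pos D _
      simp only [Pi.add_apply]
      rw [← hp]
      have h1 : (2 * s)⁻¹ * p + s / 2 - √p = (2 * s)⁻¹ * (√p - s) ^ 2 := by
        have : p = √p ^ 2 := (Real.sq_sqrt hp0.le).symm
        nth_rewrite 1 [this]
        field_simp; ring
      have h2 : 0 ≤ (2 * s)⁻¹ * (√p - s) ^ 2 := by positivity
      linarith
  refine e1.trans ?_
  rw [integral_add' (hi.const_mul _) (integrable_const _), integral_const_mul]
  simp only [integral_const, probReal_univ, one_smul]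
  rw [hss] at e0
  calc _ ≤ (2 * s)⁻¹ * (Γ * s ^ 2) + s / 2 := by gcongr
    _ = Γ * s / 2 + s / 2 := by field_simp
    _ ≤ _ := by nlinarith

/-- Interpolation between ψ and ψ²: with s = √ψ(x), p^{3/2} ≤ p²/(2s) + sp/2, and both means on the
right grow by the same factor. -/
lemma integral_sqrt_lyapunov_proj_pow_le (H : M.UniformBounds L ε) (hd : 0 < d) (hD : 0 < D)
    (hproj : IsClosestNeighbour (spaceGrid d (h * D) R) proj) (hq : IsQuantizer quant)
    (h0 : 0 < h) (h1 : h ≤ 1) (j : Fin q) (x : Euc d) :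
    ∫ z, √(lyapunov D (proj (M.eulerStep h j x (quant z)))) ^ 3 ∂(stdGaussian (Euc d)) ≤
      Real.exp (quantConst d L * (h * (1 + (h ^ 2)⁻¹ * quantError quant 4 ^ 4))) *
        √(lyapunov D x) ^ 3 := by
  have e0 := H.integral_lyapunov_proj_le_four hd hD hproj hq h0 h1 j x
  have e0' := H.integral_sq_lyapunov_proj_le hd hD hproj hq h0 h1 j x
  have hψ := lyapunov_pos D x
  set s := √(lyapunov D x) with hs
  have hs0 : 0 < s := Real.sqrt_pos.2 hψ
  have hss : lyapunov D x = s ^ 2 := (Real.sq_sqrt hψ.le).symm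
  set Γ := Real.exp (quantConst d L * (h * (1 + (h ^ 2)⁻¹ * quantError quant 4 ^ 4)))
  have hi := hq.integrable_comp fun y => lyapunov D (proj (M.eulerStep h j x y))
  have hi2 := hq.integrable_comp fun y => lyapunov D (proj (M.eulerStep h j x y)) ^ 2
  have e1 := integral_mono
    (hq.integrable_comp fun y => √(lyapunov D (proj (M.eulerStep h j x y))) ^ 3)
    ((hi2.const_mul (2 * s)⁻¹).add (hi.const_mul (s / 2))) fun z => by
      set p := lyapunov D (proj (M.eulerStep h j x (quant z))) with hp
      have hp0 : 0 < p := lyapunov_pos D _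
      simp only [Pi.add_apply]
      rw [← hp]
      have h1 : (2 * s)⁻¹ * p ^ 2 + s / 2 * p - √p ^ 3 = (2 * s)⁻¹ * √p ^ 2 * (√p - s) ^ 2 := by
        have : p = √p ^ 2 := (Real.sq_sqrt hp0.le).symm
        nth_rewrite 1 2 [this]
        field_simp; ring
      have h2 : 0 ≤ (2 * s)⁻¹ * √p ^ 2 * (√p - s) ^ 2 := by positivity
      linarith
  refine e1.trans ?_
  rw [integral_add' (hi2.const_mul _) (hi.const_mul _), integral_const_mul, integral_const_mul]
  rw [hss] at e0 e0'
  calc _ ≤ (2 * s)⁻¹ * (Γ * (s ^ 2) ^ 2) + s / 2 * (Γ * s ^ 2) := by gcongr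
    _ = _ := by field_simp; ring

end SwitchingModel.UniformBounds

end QuantizedStep

/-! ### One-step errors and their propagation through the recursion -/

section QuantizationError

variable {d q : ℕ} {M : SwitchingModel d q} {L ε h D R : ℝ} {proj quant : Euc d → Euc d}

namespace SwitchingModel.UniformBounds

lemma bracket_eulerStep_quant_le (H : M.UniformBounds L ε) (h0 : 0 ≤ h) (h1 : h ≤ 1) (D : ℝ)
    (j : Fin q) (x z : Euc d) :
    bracket (M.eulerStep h j x (quant z)) ≤
      2 * L * √(lyapunov D x) * noiseAmplitude quant z := by
  have hL := H.pos_L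
  refine (H.bracket_eulerStep_le h0 h1 j x _).trans ?_
  gcongr
  · exact bracket_le_sqrt_lyapunov D x
  · exact one_add_norm_quant_le z

/-- The three terms are the quantization of the noise, the mesh δ = hD, and the truncation at radius
R. -/
lemma norm_eulerStep_sub_proj_le (H : M.UniformBounds L ε) (hd : 0 < d) (h0 : 0 < h) (h1 : h ≤ 1)
    (hD : 0 < D) (hR : 0 < R) (hproj : IsClosestNeighbour (spaceGrid d (h * D) R) proj)
    (j : Fin q) (x z : Euc d) :
    ‖M.eulerStep h j x z - proj (M.eulerStep h j x (quant z))‖ ≤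
      4 * L ^ 2 * (√(lyapunov D x) * (√h * ‖z - quant z‖) + h * D +
        R⁻¹ * √(lyapunov D x) ^ 2 * noiseAmplitude quant z ^ 2) := by
  have hL := H.pos_L
  have hL1 := H.one_le
  have hL2 : L ≤ 4 * L ^ 2 := by nlinarith
  have hL3 : 2 ≤ 4 * L ^ 2 := by nlinarith
  set s := √(lyapunov D x)
  set e := ‖z - quant z‖ with he
  set Fq := M.eulerStep h j x (quant z) with hFq
  have e1 : ‖M.eulerStep h j x z - Fq‖ ≤ L * (s * (√h * e)) := by
    have : M.eulerStep h j x z - Fq = √h • M.σ j x (z - quant z) := by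
      simp only [hFq, SwitchingModel.eulerStep, map_sub, smul_sub]; abel
    rw [this, norm_smul, Real.norm_of_nonneg (Real.sqrt_nonneg h)]
    calc _ ≤ √h * (L * s * e) := by
          gcongr
          refine ((M.σ j x).le_opNorm _).trans ?_
          gcongr
          exact (H.σ_le j x).trans (by gcongr; exact bracket_le_sqrt_lyapunov D x)
      _ = _ := by ring
  have e2 := norm_sub_proj_le hd (by positivity) hR hproj Fq
  have e3 : ‖Fq‖ ^ 2 ≤ 4 * L ^ 2 * (s ^ 2 * noiseAmplitude quant z ^ 2) := by
    calc _ ≤ (2 * L * s * noiseAmplitude quant z) ^ 2 := by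
          gcongr
          exact (norm_le_bracket _).trans (H.bracket_eulerStep_quant_le h0.le h1 D j x z)
      _ = _ := by ring
  have e4 : ‖Fq‖ ^ 2 / R ≤ 4 * L ^ 2 * (R⁻¹ * s ^ 2 * noiseAmplitude quant z ^ 2) := by
    rw [div_eq_inv_mul]
    calc _ ≤ R⁻¹ * (4 * L ^ 2 * (s ^ 2 * noiseAmplitude quant z ^ 2)) := by gcongr
      _ = _ := by ring
  have e5 : L * (s * (√h * e)) ≤ 4 * L ^ 2 * (s * (√h * e)) := by gcongr
  have e6 : 2 * (h * D) ≤ 4 * L ^ 2 * (h * D) := by gcongr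
  have e7 := norm_add_le (M.eulerStep h j x z - Fq) (Fq - proj Fq)
  rw [sub_add_sub_cancel] at e7
  linarith

lemma bracket_add_bracket_le (H : M.UniformBounds L ε) (hd : 0 < d) (h0 : 0 < h) (h1 : h ≤ 1)
    (hD : 0 < D) (hproj : IsClosestNeighbour (spaceGrid d (h * D) R) proj)
    (j : Fin q) (x z : Euc d) :
    bracket (M.eulerStep h j x z) + bracket (proj (M.eulerStep h j x (quant z))) ≤
      5 * L * √(lyapunov D x) * noiseAmplitude quant z := by
  have hL1 := H.one_le
  have hL := H.pos_L
  have ha := one_le_noiseAmplitude (quant := quant) z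
  have e1 : bracket (M.eulerStep h j x z) ≤ 2 * L * √(lyapunov D x) * noiseAmplitude quant z := by
    refine (H.bracket_eulerStep_le h0.le h1 j x z).trans ?_
    gcongr
    · exact bracket_le_sqrt_lyapunov D x
    · unfold noiseAmplitude; linarith [norm_nonneg (z - quant z)]
  have e2 := bracket_proj_le hd (by positivity) hproj (M.eulerStep h j x (quant z))
  have e3 := H.bracket_eulerStep_quant_le h0.le h1 D (quant := quant) j x z
  have e4 : h * D ≤ L * √(lyapunov D x) * noiseAmplitude quant z := by
    have f1 := le_sqrt_lyapunov D x
    calc h * D ≤ 1 * √(lyapunov D x) * 1 := by rw [mul_one]; gcongr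
      _ ≤ _ := by gcongr
  linarith

/-- One-step error for an integrand whose Lipschitz constant grows linearly. -/
lemma integral_abs_sub_proj_le (H : M.UniformBounds L ε) (hd : 0 < d) (h0 : 0 < h) (h1 : h ≤ 1)
    (hD : 0 < D) (hR : 0 < R) (hproj : IsClosestNeighbour (spaceGrid d (h * D) R) proj)
    (hq : IsQuantizer quant) {φ : Euc d → ℝ} {C : ℝ} (hC : 0 ≤ C)
    (hφ : ∀ x y, |φ x - φ y| ≤ C * (bracket x + bracket y) * ‖x - y‖) (j : Fin q) (x : Euc d) :
    ∫ z, |φ (M.eulerStep h j x z) - φ (proj (M.eulerStep h j x (quant z)))|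
        ∂(stdGaussian (Euc d)) ≤
      C * (160 * L ^ 3 * gaussMoment d) *
        (√h * (quantError quant 2 * (1 + quantError quant 2)) * √(lyapunov D x) ^ 2 +
          h * D * (1 + quantError quant 2) * √(lyapunov D x) +
          R⁻¹ * (1 + quantError quant 4 ^ 4) * √(lyapunov D x) ^ 3) := by
  have hL := H.pos_L
  have hG := one_le_gaussMoment (d := d)
  set s := √(lyapunov D x) with hs
  have hs0 : 0 ≤ s := Real.sqrt_nonneg _
  set e2 := quantError quant 2
  set e4 := quantError quant 4
  have he2 : 0 ≤ e2 := IsQuantizer.quantError_nonneg 2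
  have hpt (z : Euc d) : |φ (M.eulerStep h j x z) - φ (proj (M.eulerStep h j x (quant z)))| ≤
      C * (20 * L ^ 3) * (√h * s ^ 2 * (noiseAmplitude quant z * ‖z - quant z‖) +
        h * D * s * noiseAmplitude quant z + R⁻¹ * s ^ 3 * noiseAmplitude quant z ^ 4) := by
    have ha := one_le_noiseAmplitude (quant := quant) z
    have f1 := H.bracket_add_bracket_le hd h0 h1 hD hproj (quant := quant) j x z
    have f2 := H.norm_eulerStep_sub_proj_le hd h0 h1 hD hR hproj (quant := quant) j x z
    calc _ ≤ C * (5 * L * s * noiseAmplitude quant z) *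
          (4 * L ^ 2 * (s * (√h * ‖z - quant z‖) + h * D +
            R⁻¹ * s ^ 2 * noiseAmplitude quant z ^ 2)) := by
          refine (hφ _ _).trans ?_
          gcongr
      _ = C * (20 * L ^ 3) * (√h * s ^ 2 * (noiseAmplitude quant z * ‖z - quant z‖) +
        h * D * s * noiseAmplitude quant z + R⁻¹ * s ^ 3 * noiseAmplitude quant z ^ 3) := by ring
      _ ≤ _ := by
          -- The third power is traded for the fourth, the moment that `quantError quant 4`
          -- controls.
          have : noiseAmplitude quant z ^ 3 ≤ noiseAmplitude quant z ^ 4 :=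
            pow_le_pow_right₀ ha (by norm_num)
          gcongr
  have hi1 : Integrable (noiseAmplitude quant) (stdGaussian (Euc d)) := by
    simpa using hq.integrable_noiseAmplitude_pow 1
  have j1 := hq.integrable_noiseAmplitude_mul.const_mul (√h * s ^ 2)
  have j2 := hi1.const_mul (h * D * s)
  have j3 := (hq.integrable_noiseAmplitude_pow 4).const_mul (R⁻¹ * s ^ 3)
  have j12 : Integrable (fun z => √h * s ^ 2 * (noiseAmplitude quant z * ‖z - quant z‖) +
      h * D * s * noiseAmplitude quant z) (stdGaussian (Euc d)) := j1.add j2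
  have k1 := integral_mono_of_nonneg (Filter.Eventually.of_forall fun z => abs_nonneg _)
    ((j12.add j3).const_mul (C * (20 * L ^ 3))) (Filter.Eventually.of_forall hpt)
  refine k1.trans ?_
  rw [integral_const_mul, integral_add' j12 j3, integral_add j1 j2, integral_const_mul,
    integral_const_mul, integral_const_mul]
  have l1 := hq.integral_noiseAmplitude_mul_le
  have l2 := hq.integral_noiseAmplitude_le
  have l3 : ∫ z, noiseAmplitude quant z ^ 4 ∂(stdGaussian (Euc d)) ≤
      gaussMoment d * (8 * (1 + e4 ^ 4)) := by
    have f1 := hq.integral_noiseAmplitude_four_le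
    have f2 : 0 ≤ e4 ^ 4 := by positivity
    nlinarith
  calc _ ≤ C * (20 * L ^ 3) * (√h * s ^ 2 * (gaussMoment d * (e2 * (1 + e2))) +
        h * D * s * (gaussMoment d * (1 + e2)) +
        R⁻¹ * s ^ 3 * (gaussMoment d * (8 * (1 + e4 ^ 4)))) := by gcongr
    _ ≤ C * (20 * L ^ 3) * (√h * s ^ 2 * (gaussMoment d * (8 * (e2 * (1 + e2)))) +
        h * D * s * (gaussMoment d * (8 * (1 + e2))) +
        R⁻¹ * s ^ 3 * (gaussMoment d * (8 * (1 + e4 ^ 4)))) := by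
        have p1 : 0 ≤ √h * s ^ 2 * (gaussMoment d * (e2 * (1 + e2))) := by positivity
        have p2 : 0 ≤ h * D * s * (gaussMoment d * (1 + e2)) := by positivity
        exact mul_le_mul_of_nonneg_left (by linarith) (by positivity)
    _ = _ := by ring

/-- One-step error for a Lipschitz integrand. -/
lemma integral_abs_sub_proj_le_of_lipschitz (H : M.UniformBounds L ε) (hd : 0 < d) (h0 : 0 < h)
    (h1 : h ≤ 1) (hD : 0 < D) (hR : 0 < R)
    (hproj : IsClosestNeighbour (spaceGrid d (h * D) R) proj)
    (hq : IsQuantizer quant) {φ : Euc d → ℝ} {C : ℝ} (hC : 0 ≤ C)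
    (hφ : ∀ x y, |φ x - φ y| ≤ C * ‖x - y‖) (j : Fin q) (x : Euc d) :
    ∫ z, |φ (M.eulerStep h j x z) - φ (proj (M.eulerStep h j x (quant z)))|
        ∂(stdGaussian (Euc d)) ≤
      C * (8 * L ^ 2 * gaussMoment d) *
        (√h * quantError quant 2 * √(lyapunov D x) + h * D +
          R⁻¹ * (1 + quantError quant 2 ^ 2) * √(lyapunov D x) ^ 2) := by
  have hL := H.pos_L
  have hG := one_le_gaussMoment (d := d)
  set s := √(lyapunov D x) with hs
  have hs0 : 0 ≤ s := Real.sqrt_nonneg _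
  set e2 := quantError quant 2
  have he2 : 0 ≤ e2 := IsQuantizer.quantError_nonneg 2
  have hpt (z : Euc d) : |φ (M.eulerStep h j x z) - φ (proj (M.eulerStep h j x (quant z)))| ≤
      C * (4 * L ^ 2) * ((√h * s) * ‖z - quant z‖ + h * D +
        R⁻¹ * s ^ 2 * noiseAmplitude quant z ^ 2) := by
    have f2 := H.norm_eulerStep_sub_proj_le hd h0 h1 hD hR hproj (quant := quant) j x z
    calc _ ≤ C * (4 * L ^ 2 * (s * (√h * ‖z - quant z‖) + h * D +
            R⁻¹ * s ^ 2 * noiseAmplitude quant z ^ 2)) := by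
          refine (hφ _ _).trans ?_
          gcongr
      _ = _ := by ring
  have j1 := hq.integrable_norm_sub.const_mul (√h * s)
  have j3 := (hq.integrable_noiseAmplitude_pow 2).const_mul (R⁻¹ * s ^ 2)
  have j12 : Integrable (fun z => (√h * s) * ‖z - quant z‖ + h * D) (stdGaussian (Euc d)) :=
    j1.add (integrable_const _)
  have k1 := integral_mono_of_nonneg (Filter.Eventually.of_forall fun z => abs_nonneg _)
    ((j12.add j3).const_mul (C * (4 * L ^ 2))) (Filter.Eventually.of_forall hpt)
  refine k1.trans ?_
  rw [integral_const_mul, integral_add' j12 j3, integral_add j1 (integrable_const _),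
    integral_const_mul, integral_const_mul]
  simp only [integral_const, probReal_univ, one_smul]
  have l1 := hq.integral_norm_sub_le
  rw [integral_const_mul]
  have l3 : ∫ z, noiseAmplitude quant z ^ 2 ∂(stdGaussian (Euc d)) ≤
      2 * gaussMoment d * (1 + e2 ^ 2) := by
    have f1 := hq.integral_noiseAmplitude_sq_le
    have f2 : 0 ≤ e2 ^ 2 := by positivity
    nlinarith
  have hG2 : 1 ≤ 2 * gaussMoment d := by linarith
  calc _ ≤ C * (4 * L ^ 2) * (√h * s * e2 + h * D +
        R⁻¹ * s ^ 2 * (2 * gaussMoment d * (1 + e2 ^ 2))) := by gcongr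
    _ ≤ C * (4 * L ^ 2) * (2 * gaussMoment d * (√h * s * e2) + 2 * gaussMoment d * (h * D) +
        R⁻¹ * s ^ 2 * (2 * gaussMoment d * (1 + e2 ^ 2))) := by
        have p1 : √h * s * e2 ≤ 2 * gaussMoment d * (√h * s * e2) :=
          le_mul_of_one_le_left (by positivity) hG2
        have p2 : h * D ≤ 2 * gaussMoment d * (h * D) :=
          le_mul_of_one_le_left (by positivity) hG2
        exact mul_le_mul_of_nonneg_left (by linarith) (by positivity)
    _ = _ := by ring

/-- Comparison of the two schemes by means of a supersolution `E` of the error recursion. -/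
lemma abs_eulerScheme_sub_quantizedScheme_le (H : M.UniformBounds L ε) (h0 : 0 ≤ h) (h1 : h ≤ 1)
    (hq : IsQuantizer quant) {T : ℝ} {E : ℕ → Euc d → ℝ} (hE0 : ∀ x, 0 ≤ E 0 x)
    (hE : ∀ n : ℕ, n * h ≤ T → ∀ j x,
      (∫ z, |eulerScheme M h n j (M.eulerStep h j x z) -
          eulerScheme M h n j (proj (M.eulerStep h j x (quant z)))| ∂(stdGaussian (Euc d))) +
        (∫ z, E n (proj (M.eulerStep h j x (quant z))) ∂(stdGaussian (Euc d))) ≤ E (n + 1) x)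
    {n : ℕ} (hn : n * h ≤ T) (i : Fin q) (x : Euc d) :
    |eulerScheme M h n i x - quantizedScheme M h proj quant n i x| ≤ E n x := by
  induction n generalizing i x with
  | zero =>
    have : eulerScheme M h 0 i x - quantizedScheme M h proj quant 0 i x = 0 := sub_self (M.g i x)
    rw [this, abs_zero]
    exact hE0 x
  | succ n ih =>
    have hn' : n * h ≤ T := by push_cast at hn; linarith
    have : Nonempty (Fin q) := ⟨i⟩
    refine abs_ciSup_sub_ciSup_le (a := fun j => continuationValue M h n j x - M.c i j x)
      (b := fun j => (∫ z, quantizedScheme M h proj quant n j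
        (proj (M.eulerStep h j x (quant z))) ∂(stdGaussian (Euc d))) + M.f j x * h - M.c i j x)
      fun j => ?_
    refine le_trans ?_ (hE n hn' j x)
    have i1 := H.integrable_eulerScheme_eulerStep h0 h1 n j j x
    have i2 := hq.integrable_comp fun y => eulerScheme M h n j (proj (M.eulerStep h j x y))
    have i3 := hq.integrable_comp fun y =>
      quantizedScheme M h proj quant n j (proj (M.eulerStep h j x y))
    have i4 := hq.integrable_comp fun y => E n (proj (M.eulerStep h j x y))
    -- The unquantized scheme at the projected quantized point is inserted: the first difference is
    -- the one-step error, the second is the earlier error carried along the quantized chain.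
    have e1 : continuationValue M h n j x - M.c i j x -
        ((∫ z, quantizedScheme M h proj quant n j (proj (M.eulerStep h j x (quant z)))
          ∂(stdGaussian (Euc d))) + M.f j x * h - M.c i j x) =
        (∫ z, (eulerScheme M h n j (M.eulerStep h j x z) -
          eulerScheme M h n j (proj (M.eulerStep h j x (quant z)))) ∂(stdGaussian (Euc d))) +
        ∫ z, (eulerScheme M h n j (proj (M.eulerStep h j x (quant z))) -
          quantizedScheme M h proj quant n j (proj (M.eulerStep h j x (quant z))))
          ∂(stdGaussian (Euc d)) := by
      rw [integral_sub i1 i2, integral_sub i2 i3, continuationValue]; ring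
    simp only [e1]
    refine (abs_add_le _ _).trans (add_le_add abs_integral_le_integral_abs ?_)
    exact norm_integral_le_of_norm_le i4
      (f := fun z => eulerScheme M h n j (proj (M.eulerStep h j x (quant z))) -
        quantizedScheme M h proj quant n j (proj (M.eulerStep h j x (quant z)))) (Filter.Eventually.of_forall fun z => ih hn' j _)

/-- A geometric supersolution of the recursion `E_{n+1} = α χ + E_n ∘ (transition)`. -/
lemma geometric_supersolution {χ : Euc d → ℝ} {α Γ : ℝ} (hα : 0 ≤ α)
    (hΓ : 1 ≤ Γ) {j : Fin q} {x : Euc d} (hχ : 0 ≤ χ x)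
    (hle : ∫ z, χ (proj (M.eulerStep h j x (quant z))) ∂(stdGaussian (Euc d)) ≤ Γ * χ x)
    (n : ℕ) :
    α * χ x + (∫ z, n * α * Γ ^ n * χ (proj (M.eulerStep h j x (quant z)))
      ∂(stdGaussian (Euc d))) ≤ (n + 1 : ℕ) * α * Γ ^ (n + 1) * χ x := by
  rw [integral_const_mul]
  have hΓn : 1 ≤ Γ ^ (n + 1) := one_le_pow₀ hΓ
  have e1 : n * α * Γ ^ n * (∫ z, χ (proj (M.eulerStep h j x (quant z))) ∂(stdGaussian (Euc d))) ≤
      n * α * Γ ^ n * (Γ * χ x) := by gcongr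
  have e2 : α * χ x ≤ α * χ x * Γ ^ (n + 1) := le_mul_of_one_le_right (by positivity) hΓn
  calc _ ≤ α * χ x * Γ ^ (n + 1) + n * α * Γ ^ n * (Γ * χ x) := add_le_add e2 e1
    _ = _ := by push_cast; ring

/-- The one-step error has three terms, weighted by the second, first and third power of √ψ. The
recursion is linear, so each term is propagated with the growth factor of its own moment and the
supersolutions are added. -/
lemma abs_sub_quantizedScheme_le (H : M.UniformBounds L ε) (hd : 0 < d) (h0 : 0 < h) (h1 : h ≤ 1)
    (hD : 0 < D) (hR : 0 < R) (hproj : IsClosestNeighbour (spaceGrid d (h * D) R) proj)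
    (hq : IsQuantizer quant) {T C : ℝ} (hC : 0 ≤ C)
    (hV : ∀ n : ℕ, n * h ≤ T → ∀ i x y, |eulerScheme M h n i x - eulerScheme M h n i y| ≤
      C * (bracket x + bracket y) * ‖x - y‖) {n : ℕ} (hn : n * h ≤ T) (i : Fin q) (x : Euc d) :
    |eulerScheme M h n i x - quantizedScheme M h proj quant n i x| ≤
      C * (160 * L ^ 3 * gaussMoment d) *
        (n * (√h * (quantError quant 2 * (1 + quantError quant 2))) *
            Real.exp (quantConst d L * (h * (1 + h⁻¹ * quantError quant 2 ^ 2))) ^ n *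
            √(lyapunov D x) ^ 2 +
          n * (h * D * (1 + quantError quant 2)) *
            Real.exp (quantConst d L * (h * (1 + h⁻¹ * quantError quant 2 ^ 2))) ^ n *
            √(lyapunov D x) +
          n * (R⁻¹ * (1 + quantError quant 4 ^ 4)) *
            Real.exp (quantConst d L * (h * (1 + (h ^ 2)⁻¹ * quantError quant 4 ^ 4))) ^ n *
            √(lyapunov D x) ^ 3) := by
  have hL := H.pos_L
  have hG := one_le_gaussMoment (d := d)
  have he2 : 0 ≤ quantError quant 2 := IsQuantizer.quantError_nonneg 2
  have hΓ2 : 1 ≤ Real.exp (quantConst d L * (h * (1 + h⁻¹ * quantError quant 2 ^ 2))) :=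
    Real.one_le_exp (mul_nonneg (quantConst_nonneg d L) (by positivity))
  have hΓ4 : 1 ≤ Real.exp (quantConst d L * (h * (1 + (h ^ 2)⁻¹ * quantError quant 4 ^ 4))) :=
    Real.one_le_exp (mul_nonneg (quantConst_nonneg d L) (by positivity))
  have hm2 (j : Fin q) (x : Euc d) := H.integral_lyapunov_proj_le' hd hD hproj hq h0 h1 j x
  have hm1 (j : Fin q) (x : Euc d) := H.integral_sqrt_lyapunov_proj_le hd hD hproj hq h0 h1 j x
  have hm3 (j : Fin q) (x : Euc d) :=
    H.integral_sqrt_lyapunov_proj_pow_le hd hD hproj hq h0 h1 j x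
  set Γ2 := Real.exp (quantConst d L * (h * (1 + h⁻¹ * quantError quant 2 ^ 2)))
  set Γ4 := Real.exp (quantConst d L * (h * (1 + (h ^ 2)⁻¹ * quantError quant 4 ^ 4)))
  set α := √h * (quantError quant 2 * (1 + quantError quant 2)) with hα
  set β := h * D * (1 + quantError quant 2) with hβ
  set η := R⁻¹ * (1 + quantError quant 4 ^ 4) with hη
  have hsq (y : Euc d) : √(lyapunov D y) ^ 2 = lyapunov D y := Real.sq_sqrt (lyapunov_pos D y).le
  refine H.abs_eulerScheme_sub_quantizedScheme_le h0.le h1 hq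
    (E := fun n x => C * (160 * L ^ 3 * gaussMoment d) * (n * α * Γ2 ^ n * √(lyapunov D x) ^ 2 +
      n * β * Γ2 ^ n * √(lyapunov D x) + n * η * Γ4 ^ n * √(lyapunov D x) ^ 3))
    (fun x => by simp) (fun n hn j x => ?_) hn i x
  have e0 := H.integral_abs_sub_proj_le hd h0 h1 hD hR hproj hq hC (hV n hn j) j x
  have e1 := geometric_supersolution (M := M) (h := h) (proj := proj) (quant := quant) (α := α)
    (by positivity)
    hΓ2 (χ := fun y => √(lyapunov D y) ^ 2) (j := j) (x := x) (by positivity)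
    (by simp_rw [hsq]; exact hm2 j x) n
  have e2 := geometric_supersolution (M := M) (h := h) (proj := proj) (quant := quant) (α := β)
    (by positivity)
    hΓ2 (χ := fun y => √(lyapunov D y)) (j := j) (x := x) (by positivity) (hm1 j x) n
  have e3 := geometric_supersolution (M := M) (h := h) (proj := proj) (quant := quant) (α := η)
    (by positivity)
    hΓ4 (χ := fun y => √(lyapunov D y) ^ 3) (j := j) (x := x) (by positivity) (hm3 j x) n
  have i1 := hq.integrable_comp fun y =>
    n * α * Γ2 ^ n * √(lyapunov D (proj (M.eulerStep h j x y))) ^ 2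
  have i2 := hq.integrable_comp fun y =>
    n * β * Γ2 ^ n * √(lyapunov D (proj (M.eulerStep h j x y)))
  have i3 := hq.integrable_comp fun y =>
    n * η * Γ4 ^ n * √(lyapunov D (proj (M.eulerStep h j x y))) ^ 3
  have i12 : Integrable (fun z => n * α * Γ2 ^ n *
      √(lyapunov D (proj (M.eulerStep h j x (quant z)))) ^ 2 + n * β * Γ2 ^ n *
      √(lyapunov D (proj (M.eulerStep h j x (quant z))))) (stdGaussian (Euc d)) := i1.add i2
  rw [integral_const_mul, integral_add i12 i3, integral_add i1 i2]
  have hC' : 0 ≤ C * (160 * L ^ 3 * gaussMoment d) := by positivity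
  have e4 := mul_le_mul_of_nonneg_left (add_le_add (add_le_add e1 e2) e3) hC'
  refine le_trans ?_ e4
  rw [mul_add] at *
  refine le_trans (add_le_add_left e0 _) (le_of_eq ?_)
  ring

/-- With a bounded Lipschitz constant each weight loses one power of √ψ. The mesh term then has no
weight at all and merely accumulates n times, without an exponential. -/
lemma abs_sub_quantizedScheme_le_of_lipschitz (H : M.UniformBounds L ε) (hd : 0 < d) (h0 : 0 < h)
    (h1 : h ≤ 1) (hD : 0 < D) (hR : 0 < R)
    (hproj : IsClosestNeighbour (spaceGrid d (h * D) R) proj)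
    (hq : IsQuantizer quant) {T C : ℝ} (hC : 0 ≤ C)
    (hV : ∀ n : ℕ, n * h ≤ T → ∀ i x y, |eulerScheme M h n i x - eulerScheme M h n i y| ≤
      C * ‖x - y‖) {n : ℕ} (hn : n * h ≤ T) (i : Fin q) (x : Euc d) :
    |eulerScheme M h n i x - quantizedScheme M h proj quant n i x| ≤
      C * (8 * L ^ 2 * gaussMoment d) *
        (n * (√h * quantError quant 2) *
            Real.exp (quantConst d L * (h * (1 + h⁻¹ * quantError quant 2 ^ 2))) ^ n *
            √(lyapunov D x) +
          n * (h * D) +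
          n * (R⁻¹ * (1 + quantError quant 2 ^ 2)) *
            Real.exp (quantConst d L * (h * (1 + (h ^ 2)⁻¹ * quantError quant 4 ^ 4))) ^ n *
            √(lyapunov D x) ^ 2) := by
  have hL := H.pos_L
  have hG := one_le_gaussMoment (d := d)
  have he2 : 0 ≤ quantError quant 2 := IsQuantizer.quantError_nonneg 2
  have hΓ2 : 1 ≤ Real.exp (quantConst d L * (h * (1 + h⁻¹ * quantError quant 2 ^ 2))) :=
    Real.one_le_exp (mul_nonneg (quantConst_nonneg d L) (by positivity))
  have hΓ4 : 1 ≤ Real.exp (quantConst d L * (h * (1 + (h ^ 2)⁻¹ * quantError quant 4 ^ 4))) :=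
    Real.one_le_exp (mul_nonneg (quantConst_nonneg d L) (by positivity))
  have hm1 (j : Fin q) (x : Euc d) := H.integral_sqrt_lyapunov_proj_le hd hD hproj hq h0 h1 j x
  have hm2 (j : Fin q) (x : Euc d) :=
    H.integral_lyapunov_proj_le_four hd hD hproj hq h0 h1 j x
  set Γ2 := Real.exp (quantConst d L * (h * (1 + h⁻¹ * quantError quant 2 ^ 2)))
  set Γ4 := Real.exp (quantConst d L * (h * (1 + (h ^ 2)⁻¹ * quantError quant 4 ^ 4)))
  set α := √h * quantError quant 2 with hα
  set η := R⁻¹ * (1 + quantError quant 2 ^ 2) with hη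
  have hsq (y : Euc d) : √(lyapunov D y) ^ 2 = lyapunov D y := Real.sq_sqrt (lyapunov_pos D y).le
  refine H.abs_eulerScheme_sub_quantizedScheme_le h0.le h1 hq
    (E := fun n x => C * (8 * L ^ 2 * gaussMoment d) * (n * α * Γ2 ^ n * √(lyapunov D x) +
      n * (h * D) + n * η * Γ4 ^ n * √(lyapunov D x) ^ 2))
    (fun x => by simp) (fun n hn j x => ?_) hn i x
  have e0 := H.integral_abs_sub_proj_le_of_lipschitz hd h0 h1 hD hR hproj hq hC (hV n hn j) j x
  have e1 := geometric_supersolution (M := M) (h := h) (proj := proj) (quant := quant) (α := α)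
    (by positivity)
    hΓ2 (χ := fun y => √(lyapunov D y)) (j := j) (x := x) (by positivity) (hm1 j x) n
  have e3 := geometric_supersolution (M := M) (h := h) (proj := proj) (quant := quant) (α := η)
    (by positivity)
    hΓ4 (χ := fun y => √(lyapunov D y) ^ 2) (j := j) (x := x) (by positivity)
    (by simp_rw [hsq]; exact hm2 j x) n
  have i1 := hq.integrable_comp fun y =>
    n * α * Γ2 ^ n * √(lyapunov D (proj (M.eulerStep h j x y)))
  have i3 := hq.integrable_comp fun y =>
    n * η * Γ4 ^ n * √(lyapunov D (proj (M.eulerStep h j x y))) ^ 2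
  have i12 : Integrable (fun z => n * α * Γ2 ^ n *
      √(lyapunov D (proj (M.eulerStep h j x (quant z)))) + n * (h * D)) (stdGaussian (Euc d)) :=
    i1.add (integrable_const _)
  rw [integral_const_mul, integral_add i12 i3, integral_add i1 (integrable_const _)]
  simp only [integral_const, probReal_univ, one_smul]
  have hC' : 0 ≤ C * (8 * L ^ 2 * gaussMoment d) := by positivity
  have e4 := mul_le_mul_of_nonneg_left (add_le_add e1 e3) hC'
  push_cast at e4 ⊢
  refine (add_le_add_left e0 _).trans ?_
  linarith

end SwitchingModel.UniformBounds

end QuantizationError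

/-! ### Summation over at most T/h steps -/

section QuantizationTheorem

variable {d q : ℕ} {M : SwitchingModel d q} {L ε : ℝ}

namespace SwitchingModel.UniformBounds

lemma exp_pow_le {C h T s : ℝ} (hC : 0 ≤ C) (hs : 0 ≤ s) {n : ℕ} (hn : n * h ≤ T) :
    Real.exp (C * (h * (1 + s))) ^ n ≤ Real.exp (C * T) * Real.exp (C * T * s) := by
  rw [← Real.exp_nat_mul, ← Real.exp_add]
  refine Real.exp_le_exp.2 ?_
  calc n * (C * (h * (1 + s))) = C * (1 + s) * (n * h) := by ring
    _ ≤ C * (1 + s) * T := by gcongr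
    _ = _ := by ring

lemma nat_mul_sqrt_le {h T : ℝ} (h0 : 0 < h) {n : ℕ} (hn : n * h ≤ T) :
    n * √h ≤ T * h ^ (-(1 / 2) : ℝ) := by
  have e1 : h ^ (-(1 / 2) : ℝ) = (√h)⁻¹ := by
    rw [Real.rpow_neg h0.le, Real.sqrt_eq_rpow]
  have hs : 0 < √h := Real.sqrt_pos.2 h0
  rw [e1, ← div_eq_mul_inv, le_div_iff₀ hs, mul_assoc, Real.mul_self_sqrt h0.le]
  exact hn

lemma nat_mul_inv_le {h T R : ℝ} (h0 : 0 < h) (hR : 0 < R) {n : ℕ} (hn : n * h ≤ T) :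
    n * R⁻¹ ≤ T * (1 / (R * h)) := by
  rw [mul_one_div, le_div_iff₀ (by positivity)]
  calc n * R⁻¹ * (R * h) = n * h := by field_simp
    _ ≤ T := hn

/-- Prefactors such as 1 + e₂ or 1 + e₄⁴, absent from the final bound, are hidden in the exponential
at the price of 1 in its rate. -/
lemma one_add_mul_exp_le {κ K a : ℝ} (hK : κ + 1 ≤ K) (ha : 0 ≤ a) :
    (1 + a) * Real.exp (κ * a) ≤ Real.exp (K * a) := by
  calc (1 + a) * Real.exp (κ * a) ≤ Real.exp a * Real.exp (κ * a) := by
        gcongr; linarith [Real.add_one_le_exp a]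
    _ = Real.exp (a + κ * a) := by rw [Real.exp_add]
    _ ≤ _ := Real.exp_le_exp.2 (by nlinarith)

/-- Bookkeeping for the accumulated error when the Lipschitz constants grow linearly. -/
lemma accumulated_error_le {n : ℕ} {A C h D R T κ K e2 e4 S Γ2 Γ4 s X r p Et ES : ℝ}
    (hn : n * h ≤ T) (hn1 : n * √h ≤ T * r) (hn2 : n * R⁻¹ ≤ T * p)
    (hCA : C ≤ A) (hA0 : 0 ≤ A) (hK : 2 * T * A * Real.exp κ ≤ K)
    (h0 : 0 ≤ h) (hD : 0 ≤ D) (hR : 0 ≤ R) (hT : 0 ≤ T) (he2 : 0 ≤ e2)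
    (hΓ2 : 0 ≤ Γ2) (hΓ4 : 0 ≤ Γ4) (hs0 : 0 ≤ s) (hsX : s ≤ X) (hr : 0 ≤ r) (hp : 0 ≤ p)
    (hEt : 1 ≤ Et) (hES : 0 ≤ ES) (he4S : 1 + e4 ^ 4 ≤ 2 * (1 + S))
    (g2 : (1 + e2) * Γ2 ≤ 2 * Real.exp κ * Et) (g4 : Γ4 * (2 * (1 + S)) ≤ 2 * Real.exp κ * ES) :
    C * (n * (√h * (e2 * (1 + e2))) * Γ2 * s ^ 2 + n * (h * D * (1 + e2)) * Γ2 * s +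
      n * (R⁻¹ * (1 + e4 ^ 4)) * Γ4 * s ^ 3) ≤
      K * Et * X * (D + r * e2 * X + p * ES * s ^ 2) := by
  have hX : 0 ≤ X := hs0.trans hsX
  have hEt0 : 0 ≤ Et := zero_le_one.trans hEt
  have t1 : n * (√h * (e2 * (1 + e2))) * Γ2 * s ^ 2 ≤
      2 * T * Real.exp κ * (Et * X * (r * e2 * X)) := by
    calc _ = (n * √h) * e2 * ((1 + e2) * Γ2) * (s * s) := by ring
      _ ≤ (T * r) * e2 * (2 * Real.exp κ * Et) * (X * X) := by gcongr
      _ = _ := by ring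
  have t2 : n * (h * D * (1 + e2)) * Γ2 * s ≤ 2 * T * Real.exp κ * (Et * X * D) := by
    calc _ = (n * h) * D * ((1 + e2) * Γ2) * s := by ring
      _ ≤ T * D * (2 * Real.exp κ * Et) * X := by gcongr
      _ = _ := by ring
  have t3 : n * (R⁻¹ * (1 + e4 ^ 4)) * Γ4 * s ^ 3 ≤
      2 * T * Real.exp κ * (Et * X * (p * ES * s ^ 2)) := by
    have f0 : Γ4 * (1 + e4 ^ 4) ≤ 2 * Real.exp κ * ES :=
      (mul_le_mul_of_nonneg_left he4S hΓ4).trans g4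
    calc _ = (n * R⁻¹) * (Γ4 * (1 + e4 ^ 4)) * (s * s ^ 2) := by ring
      _ ≤ (T * p) * (2 * Real.exp κ * ES) * (X * s ^ 2) := by gcongr
      _ = 1 * (2 * T * Real.exp κ * (X * (p * ES * s ^ 2))) := by ring
      _ ≤ Et * (2 * T * Real.exp κ * (X * (p * ES * s ^ 2))) := by gcongr
      _ = _ := by ring
  have t123 := add_le_add (add_le_add t1 t2) t3
  have hnn : 0 ≤ Et * X * (D + r * e2 * X + p * ES * s ^ 2) := by positivity
  calc _ ≤ A * (2 * T * Real.exp κ * (Et * X * (r * e2 * X)) + 2 * T * Real.exp κ * (Et * X * D) +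
        2 * T * Real.exp κ * (Et * X * (p * ES * s ^ 2))) :=
        mul_le_mul hCA t123 (by positivity) hA0
    _ = 2 * T * A * Real.exp κ * (Et * X * (D + r * e2 * X + p * ES * s ^ 2)) := by ring
    _ ≤ K * (Et * X * (D + r * e2 * X + p * ES * s ^ 2)) := mul_le_mul_of_nonneg_right hK hnn
    _ = _ := by ring

/-- Bookkeeping for the accumulated error when the Lipschitz constants are bounded. -/
lemma accumulated_error_le_of_lipschitz {n : ℕ} {A C h D R T κ K e2 S Γ2 Γ4 s X r p Et ES : ℝ}
    (hn : n * h ≤ T) (hn1 : n * √h ≤ T * r) (hn2 : n * R⁻¹ ≤ T * p)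
    (hCA : C ≤ A) (hA0 : 0 ≤ A) (hK : 2 * T * A * Real.exp κ ≤ K) (hκ : 0 ≤ κ)
    (h0 : 0 ≤ h) (hD : 0 ≤ D) (hR : 0 ≤ R) (hT : 0 ≤ T) (he2 : 0 ≤ e2)
    (hΓ2 : 0 ≤ Γ2) (hΓ4 : 0 ≤ Γ4) (hs0 : 0 ≤ s) (hsX : s ≤ X) (hr : 0 ≤ r) (hp : 0 ≤ p)
    (hEt : 0 ≤ Et) (hES : 0 ≤ ES) (he2S : 1 + e2 ^ 2 ≤ 2 * (1 + S))
    (g2 : (1 + e2) * Γ2 ≤ 2 * Real.exp κ * Et) (g4 : Γ4 * (2 * (1 + S)) ≤ 2 * Real.exp κ * ES) :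
    C * (n * (√h * e2) * Γ2 * s + n * (h * D) + n * (R⁻¹ * (1 + e2 ^ 2)) * Γ4 * s ^ 2) ≤
      K * (r * e2 * Et * X + D + p * ES * s ^ 2) := by
  have hX : 0 ≤ X := hs0.trans hsX
  have hexpκ : 1 ≤ Real.exp κ := Real.one_le_exp hκ
  have t1 : n * (√h * e2) * Γ2 * s ≤ 2 * T * Real.exp κ * (r * e2 * Et * X) := by
    have f0 : Γ2 ≤ 2 * Real.exp κ * Et :=
      (le_mul_of_one_le_left hΓ2 (by linarith)).trans g2
    calc _ = (n * √h) * e2 * Γ2 * s := by ring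
      _ ≤ (T * r) * e2 * (2 * Real.exp κ * Et) * X := by gcongr
      _ = _ := by ring
  have t2 : n * (h * D) ≤ 2 * T * Real.exp κ * D := by
    calc _ = (n * h) * D := by ring
      _ ≤ T * D := by gcongr
      _ ≤ (2 * T * Real.exp κ) * D := by gcongr; nlinarith
  have t3 : n * (R⁻¹ * (1 + e2 ^ 2)) * Γ4 * s ^ 2 ≤ 2 * T * Real.exp κ * (p * ES * s ^ 2) := by
    have f0 : Γ4 * (1 + e2 ^ 2) ≤ 2 * Real.exp κ * ES :=
      (mul_le_mul_of_nonneg_left he2S hΓ4).trans g4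
    calc _ = (n * R⁻¹) * (Γ4 * (1 + e2 ^ 2)) * s ^ 2 := by ring
      _ ≤ (T * p) * (2 * Real.exp κ * ES) * s ^ 2 := by gcongr
      _ = _ := by ring
  have t123 := add_le_add (add_le_add t1 t2) t3
  have hnn : 0 ≤ r * e2 * Et * X + D + p * ES * s ^ 2 := by positivity
  calc _ ≤ A * (2 * T * Real.exp κ * (r * e2 * Et * X) + 2 * T * Real.exp κ * D +
        2 * T * Real.exp κ * (p * ES * s ^ 2)) := mul_le_mul hCA t123 (by positivity) hA0
    _ = 2 * T * A * Real.exp κ * (r * e2 * Et * X + D + p * ES * s ^ 2) := by ring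
    _ ≤ _ := mul_le_mul_of_nonneg_right hK hnn

lemma mul_exp_pow_le {C h T κ K a b : ℝ} (hC : 0 ≤ C) (hκ : κ = C * T) (hK : κ + 1 ≤ K)
    (ha : 0 ≤ a) (hb : b ≤ 2 * (1 + a)) {n : ℕ} (hn : n * h ≤ T) :
    b * Real.exp (C * (h * (1 + a))) ^ n ≤ 2 * Real.exp κ * Real.exp (K * a) := by
  have hΓ := exp_pow_le hC ha hn
  rw [← hκ] at hΓ
  calc _ ≤ (2 * (1 + a)) * (Real.exp κ * Real.exp (κ * a)) := by gcongr
    _ = 2 * Real.exp κ * ((1 + a) * Real.exp (κ * a)) := by ring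
    _ ≤ _ := mul_le_mul_of_nonneg_left (one_add_mul_exp_le hK ha) (by positivity)

lemma one_add_quantError_two_le {h : ℝ} {quant : Euc d → Euc d} (h0 : 0 < h) (h1 : h ≤ 1) :
    1 + quantError quant 2 ≤ 2 * (1 + h⁻¹ * quantError quant 2 ^ 2) := by
  have f1 : quantError quant 2 ^ 2 ≤ h⁻¹ * quantError quant 2 ^ 2 :=
    le_mul_of_one_le_left (sq_nonneg _) ((one_le_inv₀ h0).2 h1)
  nlinarith [sq_nonneg (quantError quant 2 - 1)]

lemma one_add_quantError_four_pow_le {h : ℝ} {quant : Euc d → Euc d} (h0 : 0 < h) (h1 : h ≤ 1) :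
    1 + quantError quant 4 ^ 4 ≤ 2 * (1 + (h ^ 2)⁻¹ * quantError quant 4 ^ 4) := by
  have f0 : 0 ≤ quantError quant 4 ^ 4 := by positivity
  have f1 : quantError quant 4 ^ 4 ≤ (h ^ 2)⁻¹ * quantError quant 4 ^ 4 :=
    le_mul_of_one_le_left f0 ((one_le_inv₀ (by positivity)).2 (pow_le_one₀ h0.le h1))
  linarith

lemma one_add_quantError_two_sq_le {h : ℝ} {quant : Euc d → Euc d} (hq : IsQuantizer quant)
    (h0 : 0 < h) (h1 : h ≤ 1) :
    1 + quantError quant 2 ^ 2 ≤ 2 * (1 + (h ^ 2)⁻¹ * quantError quant 4 ^ 4) := by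
  have f1 := quantError_two_sq_le hq h0
  have f2 : 0 ≤ (h ^ 2)⁻¹ * quantError quant 4 ^ 4 := by positivity
  nlinarith

/-- The error bounds between the scheme with Gaussian increments and the quantized scheme. -/
theorem exists_quantization_bound (H : M.UniformBounds L ε) (hd : 0 < d) {T : ℝ} (hT : 0 < T) :
    ∃ K : ℝ, 0 < K ∧ ∀ h : ℝ, 0 < h → h ≤ 1 → ∀ n : ℕ, n * h ≤ T →
      ∀ δ R : ℝ, 0 < δ → 0 < R →
      ∀ proj : Euc d → Euc d, IsClosestNeighbour (spaceGrid d δ R) proj →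
      ∀ quant : Euc d → Euc d, IsQuantizer quant → ∀ (i : Fin q) (x : Euc d),
        |eulerScheme M h n i x - quantizedScheme M h proj quant n i x| ≤
          K * Real.exp (K * h⁻¹ * quantError quant 2 ^ 2) * (1 + ‖x‖ + δ / h) *
            (δ / h + h ^ (-(1 / 2) : ℝ) * quantError quant 2 * (1 + ‖x‖ + δ / h) +
              1 / (R * h) * Real.exp (K * (h ^ 2)⁻¹ * quantError quant 4 ^ 4) *
                (1 + ‖x‖ ^ 2 + (δ / h) ^ 2)) ∧
        ((∀ a b y z, M.c a b y = M.c a b z) →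
          |eulerScheme M h n i x - quantizedScheme M h proj quant n i x| ≤
            K * (h ^ (-(1 / 2) : ℝ) * quantError quant 2 *
                Real.exp (K * h⁻¹ * quantError quant 2 ^ 2) * (1 + ‖x‖ + δ / h) +
              δ / h +
              1 / (R * h) * Real.exp (K * (h ^ 2)⁻¹ * quantError quant 4 ^ 4) *
                (1 + ‖x‖ ^ 2 + (δ / h) ^ 2))) := by
  have hL := H.pos_L
  have hG := one_le_gaussMoment (d := d)
  obtain ⟨C, hC, hlip⟩ := H.exists_abs_eulerScheme_sub_le T
  have hC' := H.growthConst_pos (d := d) T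
  -- One constant dominates the prefactors of both cases, so that a single `K` serves both bounds.
  set A := C * (160 * L ^ 3 * gaussMoment d) + growthConst d L T * (8 * L ^ 2 * gaussMoment d)
    with hA
  have hA1 : C * (160 * L ^ 3 * gaussMoment d) ≤ A := by
    have : 0 ≤ growthConst d L T * (8 * L ^ 2 * gaussMoment d) := by positivity
    linarith
  have hA2 : growthConst d L T * (8 * L ^ 2 * gaussMoment d) ≤ A := by
    have : 0 ≤ C * (160 * L ^ 3 * gaussMoment d) := by positivity
    linarith
  have hA0 : 0 < A := by positivity
  clear_value A
  set κ := quantConst d L * T with hκ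
  have hκ0 : 0 ≤ κ := mul_nonneg (quantConst_nonneg d L) hT.le
  set K₀ := 2 * T * A * Real.exp κ with hK₀
  have hK₀0 : 0 < K₀ := by positivity
  -- `K` has two roles: as a prefactor it must exceed `K₀`, as an exponential rate it must exceed `κ
  -- + 1`.
  set K := K₀ + κ + 1 with hK
  have hK0 : 0 < K := by positivity
  have hKK : K₀ ≤ K := by linarith
  refine ⟨K, hK0, fun h h0 h1 n hn δ R hδ hR proj hproj quant hq i x => ?_⟩
  set D := δ / h with hD_def
  have hD : 0 < D := by positivity
  have hδD : δ = h * D := by rw [hD_def]; field_simp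
  rw [hδD] at hproj
  have hψ := lyapunov_pos D x
  set s := √(lyapunov D x) with hs
  have hs0 : 0 ≤ s := Real.sqrt_nonneg _
  have hs2 : s ^ 2 = 1 + ‖x‖ ^ 2 + D ^ 2 := Real.sq_sqrt hψ.le
  have hsle : s ≤ 1 + ‖x‖ + D := sqrt_lyapunov_le hD.le x
  rw [← hs2]
  set e2 := quantError quant 2 with he2
  set e4 := quantError quant 4 with he4
  have he20 : 0 ≤ e2 := IsQuantizer.quantError_nonneg 2
  have he40 : 0 ≤ e4 := IsQuantizer.quantError_nonneg 4
  set X := 1 + ‖x‖ + D with hX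
  have hX0 : 0 ≤ X := hs0.trans hsle
  set t := h⁻¹ * e2 ^ 2 with ht
  set S := (h ^ 2)⁻¹ * e4 ^ 4 with hS
  have ht0 : 0 ≤ t := by positivity
  have hS0 : 0 ≤ S := by positivity
  have hKt : K * h⁻¹ * e2 ^ 2 = K * t := by rw [ht]; ring
  have hKS : K * (h ^ 2)⁻¹ * e4 ^ 4 = K * S := by rw [hS]; ring
  rw [hKt, hKS]
  have he2t := one_add_quantError_two_le (quant := quant) h0 h1
  have he4S := one_add_quantError_four_pow_le (quant := quant) h0 h1
  have he2S := one_add_quantError_two_sq_le hq h0 h1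
  rw [← he2, ← ht] at he2t
  rw [← he4, ← hS] at he4S
  rw [← he2, ← he4, ← hS] at he2S
  have hn1 := nat_mul_sqrt_le h0 hn
  have hn2 := nat_mul_inv_le h0 hR hn
  have hr0 := (Real.rpow_pos_of_pos h0 (-(1 / 2))).le
  have hp0 : 0 ≤ 1 / (R * h) := by positivity
  have hone : 1 ≤ Real.exp (K * t) := Real.one_le_exp (mul_nonneg hK0.le ht0)
  have g2 := mul_exp_pow_le (quantConst_nonneg d L) hκ (by linarith : κ + 1 ≤ K) ht0 he2t hn
  have g4 := mul_exp_pow_le (quantConst_nonneg d L) hκ (by linarith : κ + 1 ≤ K) hS0 le_rfl hn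
  rw [mul_comm] at g4
  constructor
  · have key := H.abs_sub_quantizedScheme_le hd h0 h1 hD hR hproj hq hC.le
      (fun n hn => hlip h h0.le h1 n hn) hn i x
    rw [← he2, ← he4, ← ht, ← hS, ← hs] at key
    exact key.trans (accumulated_error_le hn hn1 hn2 hA1 hA0.le hKK h0.le hD.le hR.le hT.le he20
      (pow_nonneg (Real.exp_pos _).le n) (pow_nonneg (Real.exp_pos _).le n) hs0 hsle hr0 hp0 hone
      (Real.exp_pos _).le he4S g2 g4)
  · intro hcost
    have key := H.abs_sub_quantizedScheme_le_of_lipschitz hd h0 h1 hD hR hproj hq hC'.le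
      (fun n hn => H.abs_eulerScheme_sub_le_of_const_cost hcost h0.le h1 hn) hn i x
    rw [← he2, ← he4, ← ht, ← hS, ← hs] at key
    exact key.trans (accumulated_error_le_of_lipschitz hn hn1 hn2 hA2 hA0.le hKK hκ0 h0.le hD.le
      hR.le hT.le he20 (pow_nonneg (Real.exp_pos _).le n) (pow_nonneg (Real.exp_pos _).le n) hs0
      hsle hr0 hp0 (Real.exp_pos _).le (Real.exp_pos _).le he2S g2 g4)

end SwitchingModel.UniformBounds

end QuantizationTheorem

/-! ### The time grid and the independence of Brownian increments -/

section TimeGrid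

variable {T : ℝ≥0} {m : ℕ}

lemma gridTime_strictMono (hT : 0 < T) (hm : 0 < m) : StrictMono (gridTime T m) := by
  intro a b hab
  have hm' : (0 : ℝ≥0) < m := by exact_mod_cast hm
  have : 0 < T / (m : ℝ≥0) := div_pos hT hm'
  have hab' : (a : ℝ≥0) < b := by exact_mod_cast hab
  exact mul_lt_mul_of_pos_right hab' this

lemma gridTime_last (hm : 0 < m) : gridTime T m m = T := by
  have hm' : (m : ℝ≥0) ≠ 0 := by exact_mod_cast hm.ne'
  exact mul_div_cancel₀ T hm'

lemma gridTime_succ_sub (ℓ : ℕ) :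
    (gridTime T m (ℓ + 1) : ℝ) - gridTime T m ℓ = (T : ℝ) / m := by
  simp only [gridTime]; push_cast; ring

end TimeGrid

section Independence

variable {Ω S E : Type*} {mΩ : MeasurableSpace Ω} [MeasurableSpace S] [MeasurableSpace E]
  {P : Measure Ω} [IsProbabilityMeasure P]

/-- Conditioning on an independent variable: `E[φ(Y, Z)] = E[∫ φ(Y, z) ν(dz)]`. -/
lemma ProbabilityTheory.IndepFun.integral_comp_prodMk {Y : Ω → S} {Z : Ω → E} (hYZ : IndepFun Y Z P)
    (hY : Measurable Y) (hZ : Measurable Z) {φ : S × E → ℝ} (hφ : Measurable φ)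
    (hint : Integrable (fun ω => φ (Y ω, Z ω)) P) :
    Integrable (fun ω => ∫ z, φ (Y ω, z) ∂(P.map Z)) P ∧
      ∫ ω, φ (Y ω, Z ω) ∂P = ∫ ω, ∫ z, φ (Y ω, z) ∂(P.map Z) ∂P := by
  have hmap := (indepFun_iff_map_prod_eq_prod_map_map hY.aemeasurable hZ.aemeasurable).1 hYZ
  have := Measure.isProbabilityMeasure_map (μ := P) hY.aemeasurable
  have := Measure.isProbabilityMeasure_map (μ := P) hZ.aemeasurable
  have hYZm : Measurable fun ω => (Y ω, Z ω) := hY.prodMk hZ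
  have hint' : Integrable φ ((P.map Y).prod (P.map Z)) := by
    rw [← hmap]
    exact (integrable_map_measure hφ.aestronglyMeasurable hYZm.aemeasurable).2 hint
  have hm : StronglyMeasurable fun y => ∫ z, φ (y, z) ∂(P.map Z) :=
    hφ.stronglyMeasurable.integral_prod_right'
  refine ⟨(integrable_map_measure hm.aestronglyMeasurable hY.aemeasurable).1
    hint'.integral_prod_left, ?_⟩
  calc ∫ ω, φ (Y ω, Z ω) ∂P = ∫ p, φ p ∂(P.map fun ω => (Y ω, Z ω)) :=
        (integral_map hYZm.aemeasurable hφ.aestronglyMeasurable).symm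
    _ = ∫ y, ∫ z, φ (y, z) ∂(P.map Z) ∂(P.map Y) := by rw [hmap, integral_prod _ hint']
    _ = _ := integral_map hY.aemeasurable hm.aestronglyMeasurable

end Independence

namespace IsBrownianMotion

variable {Ω : Type*} {mΩ : MeasurableSpace Ω} {P : Measure Ω} {𝓕 : Filtration ℝ≥0 mΩ} {d : ℕ}
  {W : ℝ≥0 → Ω → Euc d} {T : ℝ≥0} {m : ℕ}

lemma measurable_normalizedIncrement_succ (hW : IsBrownianMotion P 𝓕 W) (hT : 0 < T) (hm : 0 < m)
    (ℓ : ℕ) : Measurable[𝓕 (gridTime T m (ℓ + 1))] (normalizedIncrement W T m ℓ) := by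
  have h1 : Measurable[𝓕 (gridTime T m (ℓ + 1))] (W (gridTime T m (ℓ + 1))) := hW.adapted _
  have h2 : Measurable[𝓕 (gridTime T m (ℓ + 1))] (W (gridTime T m ℓ)) :=
    hW.adapted.measurable_le ((gridTime_strictMono hT hm).monotone (Nat.le_succ ℓ))
  exact (h1.sub h2).const_smul (Real.sqrt ((T : ℝ) / m))⁻¹

lemma measurable_normalizedIncrement (hW : IsBrownianMotion P 𝓕 W) (ℓ : ℕ) :
    Measurable (normalizedIncrement W T m ℓ) :=
  ((hW.adapted.measurable (i := gridTime T m (ℓ + 1))).sub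
    (hW.adapted.measurable (i := gridTime T m ℓ))).const_smul (Real.sqrt ((T : ℝ) / m))⁻¹

lemma map_normalizedIncrement (hW : IsBrownianMotion P 𝓕 W) (hT : 0 < T) (hm : 0 < m) (ℓ : ℕ) :
    P.map (normalizedIncrement W T m ℓ) = stdGaussian (Euc d) := by
  have hh : 0 < √((T : ℝ) / m) := by positivity
  have h1 := hW.law (gridTime T m ℓ) (gridTime T m (ℓ + 1))
    ((gridTime_strictMono hT hm).monotone (Nat.le_succ ℓ))
  rw [gridTime_succ_sub] at h1
  have h2 : normalizedIncrement W T m ℓ = (fun z : Euc d => (√((T : ℝ) / m))⁻¹ • z) ∘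
      fun ω => W (gridTime T m (ℓ + 1)) ω - W (gridTime T m ℓ) ω := rfl
  have hmeas : Measurable fun ω => W (gridTime T m (ℓ + 1)) ω - W (gridTime T m ℓ) ω :=
    (hW.adapted.measurable).sub hW.adapted.measurable
  rw [h2, ← Measure.map_map (by fun_prop) hmeas, h1, Measure.map_map (by fun_prop) (by fun_prop)]
  have h3 : ((fun z : Euc d => (√((T : ℝ) / m))⁻¹ • z) ∘ fun z => √((T : ℝ) / m) • z) = id := by
    funext z
    change (√((T : ℝ) / m))⁻¹ • (√((T : ℝ) / m) • z) = z
    rw [smul_smul, inv_mul_cancel₀ hh.ne', one_smul]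
  rw [h3, Measure.map_id]

lemma indepFun_normalizedIncrement (hW : IsBrownianMotion P 𝓕 W) (hT : 0 < T) (hm : 0 < m)
    {ℓ : ℕ} {S : Type*} [MeasurableSpace S] {Y : Ω → S} (hY : Measurable[𝓕 (gridTime T m ℓ)] Y) :
    IndepFun Y (normalizedIncrement W T m ℓ) P := by
  have h1 := hW.indep (gridTime T m ℓ) (gridTime T m (ℓ + 1))
    ((gridTime_strictMono hT hm).monotone (Nat.le_succ ℓ))
  have h2 : IndepFun (fun ω => W (gridTime T m (ℓ + 1)) ω - W (gridTime T m ℓ) ω) Y P :=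
    (IndepFun_iff_Indep _ _ _).2 (indep_of_indep_of_le_right h1 hY.comap_le)
  exact (h2.comp (φ := fun z : Euc d => (√((T : ℝ) / m))⁻¹ • z) (by fun_prop) measurable_id).symm

end IsBrownianMotion

/-! ### Controlled Euler paths: adaptedness and integrability -/

namespace DiscreteControl

variable {Ω : Type*} {mΩ : MeasurableSpace Ω} {P : Measure Ω} {𝓕 : Filtration ℝ≥0 mΩ}
  {d q : ℕ} {T : ℝ≥0} {m k : ℕ} {i : Fin q} {M : SwitchingModel d q} {W : ℝ≥0 → Ω → Euc d}
  {x : Euc d} {L ε : ℝ}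

lemma monotone_τ (α : DiscreteControl P 𝓕 T m k i) (ω : Ω) : Monotone fun n => α.τ n ω :=
  monotone_nat_of_le_succ fun n => α.mono n ω

lemma regime_eq (α : DiscreteControl P 𝓕 T m k i) {t : ℝ≥0} {ω : Ω} {n : ℕ}
    (h1 : α.τ n ω ≤ t) (h2 : (t : WithTop ℝ≥0) < α.τ (n + 1) ω) : α.regime t ω = α.ι n ω := by
  classical
  have hn : ∃ n, α.τ n ω ≤ (t : WithTop ℝ≥0) ∧ (t : WithTop ℝ≥0) < α.τ (n + 1) ω := ⟨n, h1, h2⟩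
  have hmono := α.monotone_τ ω
  have huniq {a b : ℕ} (ha : (t : WithTop ℝ≥0) < α.τ (a + 1) ω) (hb : α.τ b ω ≤ t) : b ≤ a := by
    by_contra hab
    exact absurd (ha.trans_le ((hmono (by lia : a + 1 ≤ b)).trans hb)) (lt_irrefl _)
  unfold regime
  rw [dif_pos hn]
  obtain ⟨f1, f2⟩ := Nat.find_spec hn
  congr 1
  exact le_antisymm (huniq h2 f1) (huniq f2 h1)

lemma measurable_regime_time (α : DiscreteControl P 𝓕 T m k i) (t : ℝ≥0) :
    Measurable[𝓕 t] (α.regime t) := by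
  let _ : MeasurableSpace Ω := 𝓕 t
  have hle (n : ℕ) : MeasurableSet[𝓕 t] {ω | α.τ n ω ≤ t} := α.isStoppingTime n t
  have hlt (n : ℕ) : MeasurableSet[𝓕 t] {ω | (t : WithTop ℝ≥0) < α.τ n ω} := by
    have : {ω | (t : WithTop ℝ≥0) < α.τ n ω} = {ω | α.τ n ω ≤ t}ᶜ := by
      ext ω; exact (not_le (a := α.τ n ω) (b := (t : WithTop ℝ≥0))).symm
    rw [this]
    exact (hle n).compl
  have hι (n : ℕ) (j : Fin q) : MeasurableSet[𝓕 t] (α.ι n ⁻¹' {j} ∩ {ω | α.τ n ω ≤ t}) :=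
    (α.measurable_regime n (measurableSet_singleton j)).2 t
  refine measurable_to_countable' fun j => ?_
  -- Split by the index active at time `t`. The last set accounts for the default value of `regime`
  -- where no index is active.
  have : α.regime t ⁻¹' {j} =
      (⋃ n, (α.ι n ⁻¹' {j} ∩ {ω | α.τ n ω ≤ t}) ∩ {ω | (t : WithTop ℝ≥0) < α.τ (n + 1) ω}) ∪
      ((⋂ n, ({ω | α.τ n ω ≤ t} ∩ {ω | (t : WithTop ℝ≥0) < α.τ (n + 1) ω})ᶜ) ∩ {_ω | i = j}) := by
    ext ω
    by_cases hn : ∃ n, α.τ n ω ≤ (t : WithTop ℝ≥0) ∧ (t : WithTop ℝ≥0) < α.τ (n + 1) ω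
    · obtain ⟨n, h1, h2⟩ := hn
      constructor
      · intro h
        rw [Set.mem_preimage, α.regime_eq h1 h2] at h
        exact Or.inl (Set.mem_iUnion.2 ⟨n, ⟨h, h1⟩, h2⟩)
      · rintro (h | h)
        · obtain ⟨n', ⟨h3, h4⟩, h5⟩ := Set.mem_iUnion.1 h
          rw [Set.mem_preimage, α.regime_eq h4 h5]
          exact h3
        · exact absurd ⟨h1, h2⟩ (Set.mem_iInter.1 h.1 n)
    · have hr : α.regime t ω = i := by
        unfold regime; rw [dif_neg hn, α.start_regime]
      constructor
      · intro h
        refine Or.inr ⟨Set.mem_iInter.2 fun n hn' => hn ⟨n, hn'⟩, ?_⟩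
        rw [Set.mem_preimage, hr] at h
        exact h
      · rintro (h | h)
        · obtain ⟨n', ⟨h3, h4⟩, h5⟩ := Set.mem_iUnion.1 h
          exact absurd ⟨n', h4, h5⟩ hn
        · rw [Set.mem_preimage, hr]
          exact h.2
  rw [this]
  exact (MeasurableSet.iUnion fun n => (hι n j).inter (hlt (n + 1))).union
    ((MeasurableSet.iInter fun n => ((hle n).inter (hlt (n + 1))).compl).inter
      (MeasurableSet.const _))

lemma euler_start (α : DiscreteControl P 𝓕 T m k i) (ω : Ω) : euler M W x α k ω = x := by
  cases k with
  | zero => rfl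
  | succ k => simp [euler]

lemma euler_succ (α : DiscreteControl P 𝓕 T m k i) {ℓ : ℕ} (hℓ : k ≤ ℓ) (ω : Ω) :
    euler M W x α (ℓ + 1) ω =
      M.eulerStep ((T : ℝ) / m) (α.regime (gridTime T m ℓ) ω) (euler M W x α ℓ ω)
        (normalizedIncrement W T m ℓ ω) := by
  simp [euler, hℓ]

/-- The regime that holds just before time `t_ℓ`. -/
noncomputable def prevRegime (α : DiscreteControl P 𝓕 T m k i) (ℓ : ℕ) (ω : Ω) : Fin q :=
  if ℓ ≤ k then i else α.regime (gridTime T m (ℓ - 1)) ω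

lemma prevRegime_start (α : DiscreteControl P 𝓕 T m k i) (ω : Ω) : α.prevRegime k ω = i :=
  if_pos le_rfl

lemma prevRegime_succ (α : DiscreteControl P 𝓕 T m k i) {ℓ : ℕ} (hℓ : k ≤ ℓ) (ω : Ω) :
    α.prevRegime (ℓ + 1) ω = α.regime (gridTime T m ℓ) ω :=
  if_neg (by lia)

lemma measurable_eval_regime {S : Type*} [MeasurableSpace S] {F : Fin q → Euc d → S}
    (hF : ∀ j, Measurable (F j)) {m' : MeasurableSpace Ω} {I : Ω → Fin q} {X : Ω → Euc d}
    (hI : Measurable[m'] I) (hX : Measurable[m'] X) : Measurable[m'] fun ω => F (I ω) (X ω) := by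
  have : Measurable fun p : Fin q × Euc d => F p.1 p.2 :=
    measurable_from_prod_countable_right hF
  exact this.comp (hI.prodMk hX)

lemma measurable_eulerStep_uncurried (H : M.UniformBounds L ε) (h : ℝ) :
    Measurable fun p : (Fin q × Euc d) × Euc d => M.eulerStep h p.1.1 p.1.2 p.2 := by
  have h1 : Measurable fun p : Fin q × (Euc d × Euc d) => M.eulerStep h p.1 p.2.1 p.2.2 :=
    measurable_from_prod_countable_right fun j => (H.continuous_eulerStep h j).measurable
  exact h1.comp (measurable_fst.fst.prodMk (measurable_fst.snd.prodMk measurable_snd))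

lemma measurable_euler (H : M.UniformBounds L ε) (hW : IsBrownianMotion P 𝓕 W) (hT : 0 < T)
    (hm : 0 < m) (α : DiscreteControl P 𝓕 T m k i) {ℓ : ℕ} (hℓ : k ≤ ℓ) :
    Measurable[𝓕 (gridTime T m ℓ)] (euler M W x α ℓ) := by
  induction ℓ, hℓ using Nat.le_induction with
  | base =>
    have : euler M W x α k = fun _ => x := funext α.euler_start
    rw [this]
    exact measurable_const
  | succ ℓ hℓ ih =>
    have hle := 𝓕.mono ((gridTime_strictMono hT hm).monotone (Nat.le_succ ℓ))
    have : euler M W x α (ℓ + 1) = fun ω => M.eulerStep ((T : ℝ) / m)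
        (α.regime (gridTime T m ℓ) ω) (euler M W x α ℓ ω) (normalizedIncrement W T m ℓ ω) :=
      funext (α.euler_succ hℓ)
    rw [this]
    exact (measurable_eulerStep_uncurried H _).comp
      ((((α.measurable_regime_time _).mono hle le_rfl).prodMk (ih.mono hle le_rfl)).prodMk
        (hW.measurable_normalizedIncrement_succ hT hm ℓ))

lemma measurable_prevRegime (hT : 0 < T) (hm : 0 < m) (α : DiscreteControl P 𝓕 T m k i) {ℓ : ℕ}
    (hℓ : k ≤ ℓ) : Measurable[𝓕 (gridTime T m ℓ)] (α.prevRegime ℓ) := by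
  rcases hℓ.eq_or_lt with rfl | hlt
  · have : α.prevRegime k = fun _ => i := funext α.prevRegime_start
    rw [this]
    exact measurable_const
  · obtain ⟨n, rfl⟩ := Nat.exists_eq_succ_of_ne_zero (by lia : ℓ ≠ 0)
    have : α.prevRegime (n + 1) = α.regime (gridTime T m n) :=
      funext (α.prevRegime_succ (by lia))
    rw [Nat.succ_eq_add_one, this]
    exact (α.measurable_regime_time _).mono
      (𝓕.mono ((gridTime_strictMono hT hm).monotone (Nat.le_succ n))) le_rfl

variable [IsProbabilityMeasure P]

/-- One step multiplies the bracket by at most 2L(1 + |ϑ|), and ϑ is independent of the past; a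
product of independent integrable variables is integrable. -/
lemma integrable_bracket_euler (H : M.UniformBounds L ε) (hW : IsBrownianMotion P 𝓕 W)
    (hT : 0 < T) (hm : 0 < m) (hh : (T : ℝ) / m ≤ 1) (α : DiscreteControl P 𝓕 T m k i) {ℓ : ℕ}
    (hℓ : k ≤ ℓ) : Integrable (fun ω => bracket (euler M W x α ℓ ω)) P := by
  induction ℓ, hℓ using Nat.le_induction with
  | base => simp_rw [euler_start]; exact integrable_const _
  | succ ℓ hℓ ih =>
    have hXm := measurable_euler (x := x) H hW hT hm α hℓ
    have hZ := hW.measurable_normalizedIncrement (T := T) (m := m) ℓ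
    have hind := hW.indepFun_normalizedIncrement hT hm hXm
    have hi1 : Integrable (fun z : Euc d => 1 + ‖z‖)
        (P.map (normalizedIncrement W T m ℓ)) := by
      rw [hW.map_normalizedIncrement hT hm]
      simpa using integrable_one_add_norm_pow (d := d) 1
    have hi2 : Integrable (fun ω => 1 + ‖normalizedIncrement W T m ℓ ω‖) P :=
      (integrable_map_measure hi1.aestronglyMeasurable hZ.aemeasurable).1 hi1
    have hi3 := (hind.comp (φ := bracket) (ψ := fun z : Euc d => 1 + ‖z‖)
      continuous_bracket.measurable (by fun_prop)).integrable_mul ih hi2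
    refine (hi3.const_mul (2 * L)).mono'
      (continuous_bracket.measurable.comp ((measurable_euler H hW hT hm α
        (hℓ.trans (Nat.le_succ ℓ))).mono (𝓕.le _) le_rfl)).aestronglyMeasurable
      (Filter.Eventually.of_forall fun ω => ?_)
    rw [Real.norm_of_nonneg (bracket_pos _).le, euler_succ α hℓ]
    refine (H.bracket_eulerStep_le (by positivity) hh _ _ _).trans (le_of_eq ?_)
    simp only [Pi.mul_apply, Function.comp_apply]
    ring

lemma integrable_comp_euler (H : M.UniformBounds L ε) (hW : IsBrownianMotion P 𝓕 W)
    (hT : 0 < T) (hm : 0 < m) (hh : (T : ℝ) / m ≤ 1) (α : DiscreteControl P 𝓕 T m k i) {ℓ : ℕ}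
    (hℓ : k ≤ ℓ) {F : Fin q → Euc d → ℝ} (hF : ∀ j, Measurable (F j)) {B : ℝ}
    (hB : ∀ j y, |F j y| ≤ B * bracket y) {I : Ω → Fin q} (hI : Measurable I) :
    Integrable (fun ω => F (I ω) (euler M W x α ℓ ω)) P :=
  ((integrable_bracket_euler H hW hT hm hh α hℓ).const_mul B).mono'
    (measurable_eval_regime hF hI
      ((measurable_euler H hW hT hm α hℓ).mono (𝓕.le _) le_rfl)).aestronglyMeasurable
    (Filter.Eventually.of_forall fun _ => hB _ _)

lemma integrable_cost (H : M.UniformBounds L ε) (hW : IsBrownianMotion P 𝓕 W)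
    (hT : 0 < T) (hm : 0 < m) (hh : (T : ℝ) / m ≤ 1) (α : DiscreteControl P 𝓕 T m k i) {ℓ : ℕ}
    (hℓ : k ≤ ℓ) :
    Integrable (fun ω => M.c (α.prevRegime ℓ ω) (α.regime (gridTime T m ℓ) ω)
      (euler M W x α ℓ ω)) P := by
  have hX := (measurable_euler (x := x) H hW hT hm α hℓ).mono (𝓕.le _) le_rfl
  have hI := (α.measurable_regime_time (gridTime T m ℓ)).mono (𝓕.le _) le_rfl
  have hJ := (measurable_prevRegime hT hm α hℓ).mono (𝓕.le _) le_rfl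
  have hc : Measurable fun p : (Fin q × Fin q) × Euc d => M.c p.1.1 p.1.2 p.2 :=
    measurable_from_prod_countable_right fun p => (H.continuous_c p.1 p.2).measurable
  exact ((integrable_bracket_euler H hW hT hm hh α hℓ).const_mul L).mono'
    (hc.comp ((hJ.prodMk hI).prodMk hX)).aestronglyMeasurable
    (Filter.Eventually.of_forall fun _ => H.c_le _ _ _)

/-- The Markov property: regime and position at t_ℓ are known at that time, so the next Gaussian
increment can be integrated out with both frozen. -/
lemma integral_continuationValue (H : M.UniformBounds L ε) (hW : IsBrownianMotion P 𝓕 W)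
    (hT : 0 < T) (hm : 0 < m) (hh : (T : ℝ) / m ≤ 1) (α : DiscreteControl P 𝓕 T m k i) {ℓ : ℕ}
    (hℓ : k ≤ ℓ) (n : ℕ) :
    Integrable (fun ω => continuationValue M ((T : ℝ) / m) n (α.regime (gridTime T m ℓ) ω)
      (euler M W x α ℓ ω)) P ∧
    ∫ ω, continuationValue M ((T : ℝ) / m) n (α.regime (gridTime T m ℓ) ω)
        (euler M W x α ℓ ω) ∂P =
      (∫ ω, eulerScheme M ((T : ℝ) / m) n (α.prevRegime (ℓ + 1) ω)
        (euler M W x α (ℓ + 1) ω) ∂P) +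
      ∫ ω, M.f (α.regime (gridTime T m ℓ) ω) (euler M W x α ℓ ω) * ((T : ℝ) / m) ∂P := by
  set h := (T : ℝ) / m with hdef
  have h0 : 0 ≤ h := by positivity
  have hX := measurable_euler (x := x) H hW hT hm α hℓ
  have hI := α.measurable_regime_time (gridTime T m ℓ)
  have hI' := hI.mono (𝓕.le _) le_rfl
  have hYm := hI.prodMk hX
  have hind := hW.indepFun_normalizedIncrement hT hm hYm
  set V : Fin q → Euc d → ℝ := eulerScheme M h n
  have hV (j : Fin q) : Measurable (V j) := H.measurable_eulerScheme n j
  have hV2 : Measurable fun p : Fin q × Euc d => V p.1 p.2 :=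
    measurable_from_prod_countable_right hV
  have hφ : Measurable fun p : (Fin q × Euc d) × Euc d => V p.1.1 (M.eulerStep h p.1.1 p.1.2 p.2) :=
    hV2.comp (measurable_fst.fst.prodMk (measurable_eulerStep_uncurried H h))
  have hint := integrable_comp_euler (x := x) H hW hT hm hh α (hℓ.trans (Nat.le_succ ℓ)) hV
    (H.abs_eulerScheme_le_pow h0 hh n) hI'
  simp_rw [euler_succ α hℓ] at hint
  obtain ⟨e1, e2⟩ := hind.integral_comp_prodMk (hYm.mono (𝓕.le _) le_rfl)
    (hW.measurable_normalizedIncrement ℓ) hφ hint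
  rw [hW.map_normalizedIncrement hT hm] at e1 e2
  have hf : Integrable (fun ω => M.f (α.regime (gridTime T m ℓ) ω) (euler M W x α ℓ ω) * h) P :=
    (integrable_comp_euler H hW hT hm hh α hℓ (fun j => (H.continuous_f j).measurable)
      H.f_le hI').mul_const h
  refine ⟨e1.add hf, ?_⟩
  simp_rw [prevRegime_succ α hℓ, euler_succ α hℓ]
  rw [e2]
  exact integral_add e1 hf

end DiscreteControl

lemma SwitchingModel.UniformBounds.c_le_sum_Ico {d q : ℕ} {M : SwitchingModel d q} {L ε : ℝ}
    (H : M.UniformBounds L ε) (ι : ℕ → Fin q) (x : Euc d) {a b : ℕ} (hab : a ≤ b) :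
    M.c (ι a) (ι b) x ≤ ∑ n ∈ Finset.Ico a b, M.c (ι n) (ι (n + 1)) x := by
  induction b, hab using Nat.le_induction with
  | base => simp [H.c_self]
  | succ b hab ih =>
    rw [Finset.sum_Ico_succ_top hab]
    linarith [H.c_triangle (ι a) (ι b) (ι (b + 1)) x]

/-! ### Verification, upper bound: no control gains more than the scheme -/

namespace DiscreteControl

variable {Ω : Type*} {mΩ : MeasurableSpace Ω} {P : Measure Ω} {𝓕 : Filtration ℝ≥0 mΩ}
  {d q : ℕ} {T : ℝ≥0} {m k : ℕ} {i : Fin q} {M : SwitchingModel d q} {W : ℝ≥0 → Ω → Euc d}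
  {x : Euc d} {L ε : ℝ}

lemma exists_regime_index (hT : 0 < T) (hm : 0 < m) (α : DiscreteControl P 𝓕 T m k i) {ω : Ω}
    (hω : ∃ n, (T : WithTop ℝ≥0) < α.τ n ω) {ℓ : ℕ} (hk : k ≤ ℓ) (hℓ : ℓ ≤ m) :
    ∃ n, α.τ n ω ≤ (gridTime T m ℓ : ℝ≥0) ∧
      ((gridTime T m ℓ : ℝ≥0) : WithTop ℝ≥0) < α.τ (n + 1) ω := by
  classical
  have hmono := (gridTime_strictMono hT hm).monotone
  -- The active index is the predecessor of the first index whose switching time is after t_ℓ; that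
  -- first index is not 0 because τ_0 = t_k.
  have hex : ∃ n, ((gridTime T m ℓ : ℝ≥0) : WithTop ℝ≥0) < α.τ n ω := by
    obtain ⟨n, hn⟩ := hω
    refine ⟨n, lt_of_le_of_lt ?_ hn⟩
    have := hmono hℓ
    rw [gridTime_last hm] at this
    exact WithTop.coe_le_coe.2 this
  have hne : Nat.find hex ≠ 0 := by
    intro h0
    have := Nat.find_spec hex
    rw [h0, α.start_time] at this
    exact absurd (hmono hk) (not_le.2 (WithTop.coe_lt_coe.1 this))
  obtain ⟨n, hn⟩ := Nat.exists_eq_succ_of_ne_zero hne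
  refine ⟨n, not_lt.1 (Nat.find_min hex (by lia)), ?_⟩
  have := Nat.find_spec hex
  rwa [hn] at this

open Classical in
-- Several switches may happen at the same grid time. The chain of regimes passed there costs at
-- least as much as the direct switch, by the triangular condition. The switches with indices
-- between the one active just before t_ℓ and the one active at t_ℓ all take place at t_ℓ, as no
-- other grid value is left for them.
lemma ofReal_cost_le_tsum (H : M.UniformBounds L ε) (hT : 0 < T) (hm : 0 < m)
    (α : DiscreteControl P 𝓕 T m k i) {ω : Ω} (hω : ∃ n, (T : WithTop ℝ≥0) < α.τ n ω) {ℓ : ℕ}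
    (hk : k ≤ ℓ) (hℓ : ℓ ≤ m) (y : Euc d) :
    ENNReal.ofReal (M.c (α.prevRegime ℓ ω) (α.regime (gridTime T m ℓ) ω) y) ≤
      ∑' n, if α.τ (n + 1) ω = ((gridTime T m ℓ : ℝ≥0) : WithTop ℝ≥0) then
        ENNReal.ofReal (M.c (α.ι n ω) (α.ι (n + 1) ω) y) else 0 := by
  have hgrid := gridTime_strictMono hT hm
  have hτ := α.monotone_τ ω
  obtain ⟨b, hb1, hb2⟩ := α.exists_regime_index hT hm hω hk hℓ
  -- `a` is the index active just before t_ℓ. The middle clause says that a finite next switching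
  -- time is not earlier than t_ℓ. At the start ℓ = k one takes a = 0.
  obtain ⟨a, ha1, ha2, hprev⟩ : ∃ a, a ≤ b ∧
      (∀ ℓ', k ≤ ℓ' → ((gridTime T m ℓ' : ℝ≥0) : WithTop ℝ≥0) = α.τ (a + 1) ω → ℓ ≤ ℓ') ∧
      α.prevRegime ℓ ω = α.ι a ω := by
    rcases hk.eq_or_lt with rfl | hlt
    · exact ⟨0, b.zero_le, fun ℓ' h _ => h, by rw [prevRegime_start, α.start_regime]⟩
    · obtain ⟨p, rfl⟩ := Nat.exists_eq_succ_of_ne_zero (by lia : ℓ ≠ 0)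
      obtain ⟨a, h1, h2⟩ := α.exists_regime_index hT hm hω (by lia : k ≤ p) (by lia)
      refine ⟨a, ?_, fun ℓ' _ h => ?_, by rw [α.prevRegime_succ (by lia), α.regime_eq h1 h2]⟩
      · by_contra hab
        have h3 : α.τ (b + 1) ω ≤ α.τ a ω := hτ (by lia)
        exact absurd ((hb2.trans_le h3).trans_le h1)
          (not_lt.2 (WithTop.coe_le_coe.2 (hgrid.monotone (Nat.le_succ p))))
      · rw [← h] at h2
        exact hgrid.lt_iff_lt.1 (WithTop.coe_lt_coe.1 h2)
  have hswitch (n : ℕ) (hn : n ∈ Finset.Ico a b) :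
      α.τ (n + 1) ω = ((gridTime T m ℓ : ℝ≥0) : WithTop ℝ≥0) := by
    obtain ⟨hn1, hn2⟩ := Finset.mem_Ico.1 hn
    have hle : α.τ (n + 1) ω ≤ (gridTime T m ℓ : ℝ≥0) := (hτ (by lia : n + 1 ≤ b)).trans hb1
    refine le_antisymm hle ?_
    have hle' : α.τ (a + 1) ω ≤ α.τ (n + 1) ω := hτ (by lia)
    rcases α.grid (a + 1) ω with h | ⟨ℓ', h1, -, h2⟩
    · rw [h, top_le_iff] at hle'
      exact hle' ▸ le_top
    · refine le_trans ?_ hle'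
      rw [h2]
      exact WithTop.coe_le_coe.2 (hgrid.monotone (ha2 ℓ' h1 h2.symm))
  rw [hprev, α.regime_eq hb1 hb2]
  calc ENNReal.ofReal (M.c (α.ι a ω) (α.ι b ω) y)
      ≤ ENNReal.ofReal (∑ n ∈ Finset.Ico a b, M.c (α.ι n ω) (α.ι (n + 1) ω) y) :=
        ENNReal.ofReal_le_ofReal (H.c_le_sum_Ico (fun n => α.ι n ω) y ha1)
    _ = ∑ n ∈ Finset.Ico a b, ENNReal.ofReal (M.c (α.ι n ω) (α.ι (n + 1) ω) y) :=
        ENNReal.ofReal_sum_of_nonneg fun n _ => H.c_nonneg _ _ _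
    _ = ∑ n ∈ Finset.Ico a b, if α.τ (n + 1) ω = ((gridTime T m ℓ : ℝ≥0) : WithTop ℝ≥0) then
          ENNReal.ofReal (M.c (α.ι n ω) (α.ι (n + 1) ω) y) else 0 :=
        Finset.sum_congr rfl fun n hn => (if_pos (hswitch n hn)).symm
    _ ≤ _ := ENNReal.sum_le_tsum _

lemma ofReal_sum_cost_le_totalCost (H : M.UniformBounds L ε) (hT : 0 < T) (hm : 0 < m)
    (α : DiscreteControl P 𝓕 T m k i) {ω : Ω} (hω : ∃ n, (T : WithTop ℝ≥0) < α.τ n ω) :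
    ENNReal.ofReal (∑ ℓ ∈ Finset.Icc k m,
      M.c (α.prevRegime ℓ ω) (α.regime (gridTime T m ℓ) ω) (euler M W x α ℓ ω)) ≤
      α.totalCost M W x ω := by
  classical
  rw [ENNReal.ofReal_sum_of_nonneg fun n _ => H.c_nonneg _ _ _]
  unfold totalCost
  rw [Summable.tsum_finsetSum fun _ _ => ENNReal.summable]
  refine Finset.sum_le_sum fun ℓ hℓ => ?_
  obtain ⟨h1, h2⟩ := Finset.mem_Icc.1 hℓ
  exact α.ofReal_cost_le_tsum H hT hm hω h1 h2 _

variable [IsProbabilityMeasure P]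

lemma integral_continuationValue_sub_cost (H : M.UniformBounds L ε) (hW : IsBrownianMotion P 𝓕 W)
    (hT : 0 < T) (hm : 0 < m) (hh : (T : ℝ) / m ≤ 1) (α : DiscreteControl P 𝓕 T m k i) {ℓ : ℕ}
    (hℓ : k ≤ ℓ) (n : ℕ) :
    Integrable (fun ω => continuationValue M ((T : ℝ) / m) n (α.regime (gridTime T m ℓ) ω)
      (euler M W x α ℓ ω) - M.c (α.prevRegime ℓ ω) (α.regime (gridTime T m ℓ) ω)
      (euler M W x α ℓ ω)) P ∧
    ∫ ω, (continuationValue M ((T : ℝ) / m) n (α.regime (gridTime T m ℓ) ω)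
        (euler M W x α ℓ ω) - M.c (α.prevRegime ℓ ω) (α.regime (gridTime T m ℓ) ω)
        (euler M W x α ℓ ω)) ∂P =
      (∫ ω, eulerScheme M ((T : ℝ) / m) n (α.prevRegime (ℓ + 1) ω)
        (euler M W x α (ℓ + 1) ω) ∂P) +
      ((∫ ω, M.f (α.regime (gridTime T m ℓ) ω) (euler M W x α ℓ ω) * ((T : ℝ) / m) ∂P) -
      ∫ ω, M.c (α.prevRegime ℓ ω) (α.regime (gridTime T m ℓ) ω) (euler M W x α ℓ ω) ∂P) := by
  obtain ⟨h1, h2⟩ := α.integral_continuationValue (x := x) H hW hT hm hh hℓ n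
  have h3 := α.integrable_cost (x := x) H hW hT hm hh hℓ
  refine ⟨h1.sub h3, ?_⟩
  rw [integral_sub h1 h3, h2]
  ring

lemma integrable_eulerScheme_euler (H : M.UniformBounds L ε) (hW : IsBrownianMotion P 𝓕 W)
    (hT : 0 < T) (hm : 0 < m) (hh : (T : ℝ) / m ≤ 1) (α : DiscreteControl P 𝓕 T m k i) {ℓ : ℕ}
    (hℓ : k ≤ ℓ) (n : ℕ) :
    Integrable (fun ω => eulerScheme M ((T : ℝ) / m) n (α.prevRegime ℓ ω)
      (euler M W x α ℓ ω)) P :=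
  α.integrable_comp_euler H hW hT hm hh hℓ (H.measurable_eulerScheme n)
    (H.abs_eulerScheme_le_pow (by positivity) hh n)
    ((α.measurable_prevRegime hT hm hℓ).mono (𝓕.le _) le_rfl)

/-- The supermartingale step: the regime chosen by the control is one candidate in the maximum. -/
lemma integral_eulerScheme_succ_le (H : M.UniformBounds L ε) (hW : IsBrownianMotion P 𝓕 W)
    (hT : 0 < T) (hm : 0 < m) (hh : (T : ℝ) / m ≤ 1) (α : DiscreteControl P 𝓕 T m k i) {ℓ : ℕ}
    (hℓ : k ≤ ℓ) (n : ℕ) :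
    (∫ ω, eulerScheme M ((T : ℝ) / m) n (α.prevRegime (ℓ + 1) ω)
        (euler M W x α (ℓ + 1) ω) ∂P) +
      ((∫ ω, M.f (α.regime (gridTime T m ℓ) ω) (euler M W x α ℓ ω) * ((T : ℝ) / m) ∂P) -
      ∫ ω, M.c (α.prevRegime ℓ ω) (α.regime (gridTime T m ℓ) ω) (euler M W x α ℓ ω) ∂P) ≤
    ∫ ω, eulerScheme M ((T : ℝ) / m) (n + 1) (α.prevRegime ℓ ω) (euler M W x α ℓ ω) ∂P := by
  obtain ⟨h1, h2⟩ := α.integral_continuationValue_sub_cost (x := x) H hW hT hm hh hℓ n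
  rw [← h2]
  exact integral_mono h1 (α.integrable_eulerScheme_euler H hW hT hm hh hℓ _)
    fun ω => continuationValue_sub_le n _ _ _

lemma integral_reward (H : M.UniformBounds L ε) (hW : IsBrownianMotion P 𝓕 W)
    (hT : 0 < T) (hm : 0 < m) (hh : (T : ℝ) / m ≤ 1) (hkm : k ≤ m)
    (α : DiscreteControl P 𝓕 T m k i) :
    ∫ ω, α.reward M W x ω ∂P = (∑ ℓ ∈ Finset.Ico k m,
      ∫ ω, M.f (α.regime (gridTime T m ℓ) ω) (euler M W x α ℓ ω) * ((T : ℝ) / m) ∂P) +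
      ∫ ω, M.g (α.regime (gridTime T m m) ω) (euler M W x α m ω) ∂P := by
  have hI (ℓ : ℕ) := (α.measurable_regime_time (gridTime T m ℓ)).mono (𝓕.le _) le_rfl
  have hf (ℓ : ℕ) (hℓ : ℓ ∈ Finset.Ico k m) : Integrable (fun ω =>
      M.f (α.regime (gridTime T m ℓ) ω) (euler M W x α ℓ ω) * ((T : ℝ) / m)) P :=
    (α.integrable_comp_euler H hW hT hm hh (Finset.mem_Ico.1 hℓ).1
      (fun j => (H.continuous_f j).measurable) H.f_le (hI ℓ)).mul_const _
  have hg : Integrable (fun ω => M.g (α.regime (gridTime T m m) ω) (euler M W x α m ω)) P :=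
    α.integrable_comp_euler H hW hT hm hh hkm (fun j => (H.continuous_g j).measurable)
      H.g_le (hI m)
  unfold reward
  rw [integral_add (integrable_finsetSum _ hf) hg, integral_finsetSum _ hf]

lemma integral_reward_sub_cost_le (H : M.UniformBounds L ε) (hW : IsBrownianMotion P 𝓕 W)
    (hT : 0 < T) (hm : 0 < m) (hh : (T : ℝ) / m ≤ 1) (hkm : k ≤ m)
    (α : DiscreteControl P 𝓕 T m k i) :
    ∫ ω, α.reward M W x ω ∂P - ∫ ω, ∑ ℓ ∈ Finset.Icc k m,
      M.c (α.prevRegime ℓ ω) (α.regime (gridTime T m ℓ) ω) (euler M W x α ℓ ω) ∂P ≤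
    eulerScheme M ((T : ℝ) / m) (m - k) i x := by
  have hI (ℓ : ℕ) := (α.measurable_regime_time (gridTime T m ℓ)).mono (𝓕.le _) le_rfl
  have hstep (ℓ : ℕ) (hℓ : k ≤ ℓ) : ℓ ≤ m →
      (∫ ω, eulerScheme M ((T : ℝ) / m) (m - ℓ) (α.prevRegime ℓ ω) (euler M W x α ℓ ω) ∂P) +
        ∑ r ∈ Finset.Ico k ℓ, ((∫ ω, M.f (α.regime (gridTime T m r) ω) (euler M W x α r ω) *
          ((T : ℝ) / m) ∂P) -
        ∫ ω, M.c (α.prevRegime r ω) (α.regime (gridTime T m r) ω) (euler M W x α r ω) ∂P) ≤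
      eulerScheme M ((T : ℝ) / m) (m - k) i x := by
    induction ℓ, hℓ using Nat.le_induction with
    | base => intro _; simp [prevRegime_start, euler_start]
    | succ ℓ hℓ ih =>
      intro hlm
      have h1 := α.integral_eulerScheme_succ_le (x := x) H hW hT hm hh hℓ (m - (ℓ + 1))
      rw [show m - (ℓ + 1) + 1 = m - ℓ by lia] at h1
      rw [Finset.sum_Ico_succ_top hℓ]
      linarith [ih (by lia)]
  have hcost (ℓ : ℕ) (hℓ : ℓ ∈ Finset.Icc k m) :=
    α.integrable_cost (x := x) H hW hT hm hh (Finset.mem_Icc.1 hℓ).1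
  -- A switch at the horizon does not pay, by the terminal condition, so the scheme may start from g
  -- of the previous regime.
  have hlast : (∫ ω, M.g (α.regime (gridTime T m m) ω) (euler M W x α m ω) ∂P) -
      ∫ ω, M.c (α.prevRegime m ω) (α.regime (gridTime T m m) ω) (euler M W x α m ω) ∂P ≤
      ∫ ω, eulerScheme M ((T : ℝ) / m) (m - m) (α.prevRegime m ω) (euler M W x α m ω) ∂P := by
    have hg : Integrable (fun ω => M.g (α.regime (gridTime T m m) ω) (euler M W x α m ω)) P :=
      α.integrable_comp_euler H hW hT hm hh hkm (fun j => (H.continuous_g j).measurable)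
        H.g_le (hI m)
    have hc := α.integrable_cost (x := x) H hW hT hm hh hkm
    rw [← integral_sub hg hc]
    refine integral_mono (hg.sub hc) (α.integrable_eulerScheme_euler H hW hT hm hh hkm _)
      fun ω => ?_
    simp only [Nat.sub_self, eulerScheme_zero]
    exact H.terminal _ _ _
  rw [α.integral_reward H hW hT hm hh hkm, integral_finsetSum _ hcost,
    ← Finset.Ico_insert_right hkm, Finset.sum_insert (by simp)]
  have := hstep m hkm le_rfl
  rw [Finset.sum_sub_distrib] at this
  linarith

/-- Only a lower bound of the expected cost is needed, and the merged cost is integrable; controls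
of infinite expected cost are thereby included without a separate case. -/
lemma expectedProfit_le (H : M.UniformBounds L ε) (hW : IsBrownianMotion P 𝓕 W)
    (hT : 0 < T) (hm : 0 < m) (hh : (T : ℝ) / m ≤ 1) (hkm : k ≤ m)
    (α : DiscreteControl P 𝓕 T m k i) :
    α.expectedProfit M W x ≤ (eulerScheme M ((T : ℝ) / m) (m - k) i x : EReal) := by
  set C : Ω → ℝ := fun ω => ∑ ℓ ∈ Finset.Icc k m,
    M.c (α.prevRegime ℓ ω) (α.regime (gridTime T m ℓ) ω) (euler M W x α ℓ ω) with hC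
  have hC0 (ω : Ω) : 0 ≤ C ω := Finset.sum_nonneg fun _ _ => H.c_nonneg _ _ _
  have hCint : Integrable C P := integrable_finsetSum _ fun ℓ hℓ =>
    α.integrable_cost (x := x) H hW hT hm hh (Finset.mem_Icc.1 hℓ).1
  have h1 : ENNReal.ofReal (∫ ω, C ω ∂P) ≤ ∫⁻ ω, α.totalCost M W x ω ∂P := by
    rw [ofReal_integral_eq_lintegral_ofReal hCint (Filter.Eventually.of_forall hC0)]
    exact lintegral_mono_ae (α.admissible.mono fun ω hω =>
      α.ofReal_sum_cost_le_totalCost H hT hm hω)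
  have h2 : ((∫ ω, C ω ∂P : ℝ) : EReal) ≤ ((∫⁻ ω, α.totalCost M W x ω ∂P : ℝ≥0∞) : EReal) := by
    have h3 := EReal.coe_ennreal_le_coe_ennreal_iff.2 h1
    rwa [EReal.coe_ennreal_ofReal, max_eq_left (integral_nonneg hC0)] at h3
  calc α.expectedProfit M W x
      ≤ ((∫ ω, α.reward M W x ω ∂P : ℝ) : EReal) - ((∫ ω, C ω ∂P : ℝ) : EReal) :=
        EReal.sub_le_sub le_rfl h2
    _ = ((∫ ω, α.reward M W x ω ∂P - ∫ ω, C ω ∂P : ℝ) : EReal) := (EReal.coe_sub _ _).symm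
    _ ≤ _ := EReal.coe_le_coe_iff.2 (α.integral_reward_sub_cost_le H hW hT hm hh hkm)

end DiscreteControl

/-! ### Verification, lower bound: the optimal feedback control -/

/-- Measurable selection of an index realizing one of finitely many measurable functions. -/
lemma exists_measurable_selection {S : Type*} [MeasurableSpace S] {q : ℕ} {G : S → ℝ}
    {F : Fin q → S → ℝ} (hG : Measurable G) (hF : ∀ j, Measurable (F j))
    (hex : ∀ s, ∃ j, G s = F j s) : ∃ p : S → Fin q, Measurable p ∧ ∀ s, G s = F (p s) s := by
  classical
  rcases isEmpty_or_nonempty S with hS | ⟨⟨s₀⟩⟩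
  · exact ⟨fun s => hS.elim s, measurable_of_empty _, fun s => hS.elim s⟩
  have j₀ : Fin q := (hex s₀).choose
  -- The least index that realizes the value is selected, since it depends measurably on `s`.
  have hex' (s : S) : ∃ n : ℕ, ∃ hn : n < q, G s = F ⟨n, hn⟩ s := by
    obtain ⟨j, hj⟩ := hex s
    exact ⟨j, j.2, hj⟩
  have hmeas (n : ℕ) : MeasurableSet {s | ∃ hn : n < q, G s = F ⟨n, hn⟩ s} := by
    by_cases hn : n < q
    · simpa [hn] using measurableSet_eq_fun hG (hF ⟨n, hn⟩)
    · simp [hn]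
  refine ⟨fun s => if hn : Nat.find (hex' s) < q then ⟨Nat.find (hex' s), hn⟩ else j₀,
    (measurable_from_top (f := fun n : ℕ => if hn : n < q then (⟨n, hn⟩ : Fin q) else j₀)).comp
      (measurable_find hex' hmeas), fun s => ?_⟩
  obtain ⟨h1, h2⟩ := Nat.find_spec (hex' s)
  simpa only [dif_pos h1] using h2

lemma SwitchingModel.UniformBounds.exists_measurable_policy {d q : ℕ} {M : SwitchingModel d q}
    {L ε : ℝ} (H : M.UniformBounds L ε) (h : ℝ) :
    ∃ pol : ℕ → Fin q × Euc d → Fin q, (∀ n, Measurable (pol n)) ∧ ∀ n s,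
      eulerScheme M h (n + 1) s.1 s.2 =
        continuationValue M h n (pol n s) s.2 - M.c s.1 (pol n s) s.2 := by
  have key (n : ℕ) := exists_measurable_selection (S := Fin q × Euc d)
    (G := fun s => eulerScheme M h (n + 1) s.1 s.2)
    (F := fun j s => continuationValue M h n j s.2 - M.c s.1 j s.2)
    (measurable_from_prod_countable_right fun i => H.measurable_eulerScheme (n + 1) i)
    (fun j => ((H.measurable_continuationValue n j).comp measurable_snd).sub
      (measurable_from_prod_countable_right fun i => (H.continuous_c i j).measurable))
    (fun s => exists_eulerScheme_eq n s.1 s.2)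
  choose pol h1 h2 using key
  exact ⟨pol, h1, h2⟩

section Stopping

variable {Ω : Type*} {mΩ : MeasurableSpace Ω} {𝓕 : Filtration ℝ≥0 mΩ}

lemma isStoppingTime_deterministic (σ : WithTop ℝ≥0) : IsStoppingTime 𝓕 fun _ => σ :=
  fun _ => MeasurableSet.const _

/-- For σ = ⊤ the second condition is empty and only measurability with respect to the whole
filtration is left. -/
lemma measurable_stopped_deterministic {q : ℕ} {σ : WithTop ℝ≥0}
    (hσ : IsStoppingTime 𝓕 fun _ => σ) {I : Ω → Fin q}
    (hI : Measurable[⨆ t, 𝓕 t] I)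
    (hI' : ∀ t : ℝ≥0, σ ≤ t → Measurable[𝓕 t] I) : Measurable[hσ.measurableSpace] I := by
  refine @measurable_to_countable' _ _ _ _ hσ.measurableSpace _ fun j => ?_
  refine ⟨hI (measurableSet_singleton j), fun t => ?_⟩
  by_cases ht : σ ≤ t
  · have : I ⁻¹' {j} ∩ {_ω : Ω | σ ≤ t} = I ⁻¹' {j} := Set.inter_eq_left.2 fun _ _ => ht
    rw [this]
    exact hI' t ht (measurableSet_singleton j)
  · have : I ⁻¹' {j} ∩ {_ω : Ω | σ ≤ t} = ∅ := Set.eq_empty_of_forall_notMem fun _ h => ht h.2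
    rw [this]
    exact @MeasurableSet.empty _ (𝓕 t)

end Stopping

section Policy

variable {Ω : Type*} {mΩ : MeasurableSpace Ω} {P : Measure Ω} {𝓕 : Filtration ℝ≥0 mΩ}
  {d q : ℕ} {T : ℝ≥0} {m k : ℕ} {i : Fin q} {M : SwitchingModel d q} {W : ℝ≥0 → Ω → Euc d}
  {x : Euc d} {L ε : ℝ} {pol : ℕ → Fin q × Euc d → Fin q}

/-- The pair (regime before `t_{k+r}`, position at `t_{k+r}`) under the feedback policy `pol`,
where `pol n` decides with `n + 1` time steps left. -/
noncomputable def policyState (M : SwitchingModel d q) (W : ℝ≥0 → Ω → Euc d) (T : ℝ≥0) (m k : ℕ)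
    (pol : ℕ → Fin q × Euc d → Fin q) (i : Fin q) (x : Euc d) : ℕ → Ω → Fin q × Euc d
  | 0, _ => (i, x)
  | r + 1, ω =>
    (pol (m - (k + r + 1)) (policyState M W T m k pol i x r ω),
      M.eulerStep ((T : ℝ) / m) (pol (m - (k + r + 1)) (policyState M W T m k pol i x r ω))
        (policyState M W T m k pol i x r ω).2 (normalizedIncrement W T m (k + r) ω))

/-- The switching times of a feedback control: a decision at every grid time before `T`. -/
noncomputable def policyTime (T : ℝ≥0) (m k : ℕ) : ℕ → WithTop ℝ≥0
  | 0 => (gridTime T m k : ℝ≥0)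
  -- The first decision falls on the starting time, so τ_0 = τ_1 = t_k when k < m, and the regime
  -- chosen at t_{k+r} is ι_{r+1}. A decision may keep the regime, at zero cost; none is taken at T.
  | n + 1 => if k + n < m then ((gridTime T m (k + n) : ℝ≥0) : WithTop ℝ≥0) else ⊤

lemma measurable_policyState (H : M.UniformBounds L ε) (hW : IsBrownianMotion P 𝓕 W) (hT : 0 < T)
    (hm : 0 < m) (hpol : ∀ n, Measurable (pol n)) (r : ℕ) :
    Measurable[𝓕 (gridTime T m (k + r))] (policyState M W T m k pol i x r) := by
  induction r with
  | zero => exact measurable_const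
  | succ r ih =>
    have hle := 𝓕.mono ((gridTime_strictMono hT hm).monotone (Nat.le_succ (k + r)))
    have ih' : Measurable[𝓕 (gridTime T m (k + (r + 1)))] (policyState M W T m k pol i x r) :=
      ih.mono hle le_rfl
    have hj := (hpol (m - (k + r + 1))).comp ih'
    exact hj.prodMk ((DiscreteControl.measurable_eulerStep_uncurried H _).comp
      ((hj.prodMk (measurable_snd.comp ih')).prodMk
        (hW.measurable_normalizedIncrement_succ hT hm (k + r))))

lemma measurable_policyState_regime (H : M.UniformBounds L ε) (hW : IsBrownianMotion P 𝓕 W)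
    (hT : 0 < T) (hm : 0 < m) (hpol : ∀ n, Measurable (pol n)) (r : ℕ) :
    Measurable[𝓕 (gridTime T m (k + r))] fun ω => (policyState M W T m k pol i x (r + 1) ω).1 :=
  (hpol _).comp (measurable_policyState H hW hT hm hpol r)

lemma monotone_policyTime (hT : 0 < T) (hm : 0 < m) (n : ℕ) :
    policyTime T m k n ≤ policyTime T m k (n + 1) := by
  have hmono := (gridTime_strictMono hT hm).monotone
  cases n with
  | zero =>
    simp only [policyTime]
    split_ifs
    · exact le_rfl
    · exact le_top
  | succ n =>
    simp only [policyTime]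
    split_ifs with h1 h2
    · exact WithTop.coe_le_coe.2 (hmono (by lia))
    · exact le_top
    · lia
    · exact le_rfl

/-- The control that follows the feedback policy `pol`. -/
noncomputable def policyControl (H : M.UniformBounds L ε) (hW : IsBrownianMotion P 𝓕 W)
    (hT : 0 < T) (hm : 0 < m) (hkm : k ≤ m) (hpol : ∀ n, Measurable (pol n)) (i : Fin q)
    (x : Euc d) : DiscreteControl P 𝓕 T m k i where
  τ n _ := policyTime T m k n
  ι n ω := (policyState M W T m k pol i x n ω).1
  isStoppingTime n := isStoppingTime_deterministic _
  measurable_regime n := by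
    refine measurable_stopped_deterministic _ (measurable_fst.comp
      ((measurable_policyState H hW hT hm hpol n).mono
        (le_iSup (fun t => 𝓕 t) (gridTime T m (k + n))) le_rfl)) fun t ht => ?_
    cases n with
    | zero => exact measurable_const
    | succ n =>
      by_cases hn : k + n < m
      · rw [policyTime, if_pos hn] at ht
        exact (measurable_policyState_regime H hW hT hm hpol n).mono
          (𝓕.mono (WithTop.coe_le_coe.1 ht)) le_rfl
      · rw [policyTime, if_neg hn, top_le_iff] at ht
        exact absurd ht WithTop.coe_ne_top
  mono n _ := monotone_policyTime hT hm n
  grid n _ := by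
    cases n with
    | zero => exact Or.inr ⟨k, le_rfl, hkm, rfl⟩
    | succ n =>
      by_cases hn : k + n < m
      · exact Or.inr ⟨k + n, by lia, hn.le, by rw [policyTime, if_pos hn]⟩
      · exact Or.inl (by rw [policyTime, if_neg hn])
  start_time _ := rfl
  start_regime _ := rfl
  admissible := Filter.Eventually.of_forall fun _ => ⟨m + 1, by
    rw [policyTime, if_neg (by lia)]
    exact WithTop.coe_lt_top T⟩

section Feedback

variable (H : M.UniformBounds L ε) (hW : IsBrownianMotion P 𝓕 W) (hT : 0 < T) (hm : 0 < m)
  (hkm : k ≤ m) (hpol : ∀ n, Measurable (pol n))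

lemma policyControl_regime {r : ℕ} (hr : k + r < m) (ω : Ω) :
    (policyControl H hW hT hm hkm hpol i x).regime (gridTime T m (k + r)) ω =
      (policyState M W T m k pol i x (r + 1) ω).1 := by
  refine DiscreteControl.regime_eq (n := r + 1) _ ?_ ?_
  · change policyTime T m k (r + 1) ≤ _
    rw [policyTime, if_pos hr]
  · change _ < policyTime T m k (r + 1 + 1)
    rw [policyTime]
    split_ifs
    · exact WithTop.coe_lt_coe.2 (gridTime_strictMono hT hm (by lia))
    · exact WithTop.coe_lt_top _

lemma policyControl_regime_last (ω : Ω) :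
    (policyControl H hW hT hm hkm hpol i x).regime (gridTime T m m) ω =
      (policyState M W T m k pol i x (m - k) ω).1 := by
  refine DiscreteControl.regime_eq (n := m - k) _ ?_ ?_
  · change policyTime T m k (m - k) ≤ _
    rcases Nat.eq_zero_or_pos (m - k) with h | h
    · rw [h, policyTime]
      exact WithTop.coe_le_coe.2 ((gridTime_strictMono hT hm).monotone hkm)
    · obtain ⟨n, hn⟩ := Nat.exists_eq_succ_of_ne_zero h.ne'
      rw [hn, Nat.succ_eq_add_one, policyTime, if_pos (by lia)]
      exact WithTop.coe_le_coe.2 ((gridTime_strictMono hT hm).monotone (by lia))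
  · change _ < policyTime T m k (m - k + 1)
    rw [policyTime, if_neg (by lia)]
    exact WithTop.coe_lt_top _

lemma policyControl_euler {r : ℕ} (hr : k + r ≤ m) (ω : Ω) :
    DiscreteControl.euler M W x (policyControl H hW hT hm hkm hpol i x) (k + r) ω =
      (policyState M W T m k pol i x r ω).2 := by
  induction r with
  | zero => exact DiscreteControl.euler_start _ _
  | succ r ih =>
    rw [← add_assoc, DiscreteControl.euler_succ _ (by lia), ih (by lia),
      policyControl_regime _ _ _ _ _ _ (by lia)]
    rfl

lemma policyControl_prevRegime {r : ℕ} (hr : k + r ≤ m) (ω : Ω) :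
    (policyControl H hW hT hm hkm hpol i x).prevRegime (k + r) ω =
      (policyState M W T m k pol i x r ω).1 := by
  cases r with
  | zero => exact DiscreteControl.prevRegime_start _ _
  | succ r =>
    rw [← add_assoc, DiscreteControl.prevRegime_succ _ (by lia),
      policyControl_regime _ _ _ _ _ _ (by lia)]

/-- Exactly one index n ≥ 1 belongs to each grid time before T, so merging switches loses nothing
and the merged cost is the true cost. The horizon is absent from the sum because no decision is
taken there. -/
lemma policyControl_totalCost (ω : Ω) :
    (policyControl H hW hT hm hkm hpol i x).totalCost M W x ω =
      ENNReal.ofReal (∑ ℓ ∈ Finset.Ico k m,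
        M.c ((policyControl H hW hT hm hkm hpol i x).prevRegime ℓ ω)
          ((policyControl H hW hT hm hkm hpol i x).regime (gridTime T m ℓ) ω)
          (DiscreteControl.euler M W x (policyControl H hW hT hm hkm hpol i x) ℓ ω)) := by
  classical
  set α := policyControl H hW hT hm hkm hpol i x with hα
  have hτ (n : ℕ) : α.τ (n + 1) ω =
      if k + n < m then ((gridTime T m (k + n) : ℝ≥0) : WithTop ℝ≥0) else ⊤ := rfl
  rw [ENNReal.ofReal_sum_of_nonneg fun n _ => H.c_nonneg _ _ _, Finset.sum_Ico_eq_sum_range,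
    DiscreteControl.totalCost, tsum_eq_sum (s := Finset.range (m - k))]
  · refine Finset.sum_congr rfl fun n hn => ?_
    have hn' : k + n < m := by have := Finset.mem_range.1 hn; lia
    rw [Finset.sum_eq_single (k + n)]
    · rw [hτ, if_pos hn', if_pos rfl, policyControl_prevRegime _ _ _ _ _ _ hn'.le,
        policyControl_regime _ _ _ _ _ _ hn']
      rfl
    · intro ℓ _ hℓ
      rw [hτ, if_pos hn', if_neg]
      intro h
      exact hℓ ((gridTime_strictMono hT hm).injective (WithTop.coe_injective h)).symm
    · intro h
      exact absurd (Finset.mem_Icc.2 ⟨by lia, hn'.le⟩) h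
  · intro n hn
    have hn' : ¬ k + n < m := by rw [Finset.mem_range] at hn; lia
    refine Finset.sum_eq_zero fun ℓ _ => ?_
    rw [hτ, if_neg hn', if_neg WithTop.top_ne_coe]

variable [IsProbabilityMeasure P]

/-- The telescoping of the upper bound, now with equality at every step because the policy attains
the maximum. -/
lemma policyControl_integral (hh : (T : ℝ) / m ≤ 1)
    (hopt : ∀ n s, eulerScheme M ((T : ℝ) / m) (n + 1) s.1 s.2 =
      continuationValue M ((T : ℝ) / m) n (pol n s) s.2 - M.c s.1 (pol n s) s.2) :
    ∫ ω, (policyControl H hW hT hm hkm hpol i x).reward M W x ω ∂P -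
      ∫ ω, ∑ ℓ ∈ Finset.Ico k m,
        M.c ((policyControl H hW hT hm hkm hpol i x).prevRegime ℓ ω)
          ((policyControl H hW hT hm hkm hpol i x).regime (gridTime T m ℓ) ω)
          (DiscreteControl.euler M W x (policyControl H hW hT hm hkm hpol i x) ℓ ω) ∂P =
      eulerScheme M ((T : ℝ) / m) (m - k) i x := by
  set α := policyControl H hW hT hm hkm hpol i x with hα
  have hstep (ℓ : ℕ) (hℓ : k ≤ ℓ) : ℓ ≤ m →
      (∫ ω, eulerScheme M ((T : ℝ) / m) (m - ℓ) (α.prevRegime ℓ ω) (α.euler M W x ℓ ω) ∂P) +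
        ∑ r ∈ Finset.Ico k ℓ, ((∫ ω, M.f (α.regime (gridTime T m r) ω) (α.euler M W x r ω) *
          ((T : ℝ) / m) ∂P) -
        ∫ ω, M.c (α.prevRegime r ω) (α.regime (gridTime T m r) ω) (α.euler M W x r ω) ∂P) =
      eulerScheme M ((T : ℝ) / m) (m - k) i x := by
    induction ℓ, hℓ using Nat.le_induction with
    | base => intro _; simp [DiscreteControl.prevRegime_start, DiscreteControl.euler_start]
    | succ ℓ hℓ ih =>
      intro hlm
      have h1 := (α.integral_continuationValue_sub_cost (x := x) H hW hT hm hh hℓ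
        (m - (ℓ + 1))).2
      have h2 : (fun ω => eulerScheme M ((T : ℝ) / m) (m - ℓ) (α.prevRegime ℓ ω)
          (α.euler M W x ℓ ω)) = fun ω => continuationValue M ((T : ℝ) / m) (m - (ℓ + 1))
          (α.regime (gridTime T m ℓ) ω) (α.euler M W x ℓ ω) - M.c (α.prevRegime ℓ ω)
          (α.regime (gridTime T m ℓ) ω) (α.euler M W x ℓ ω) := by
        funext ω
        obtain ⟨r, rfl⟩ := Nat.exists_eq_add_of_le hℓ
        rw [show m - (k + r) = m - (k + r + 1) + 1 by lia, hα,
          policyControl_prevRegime _ _ _ _ _ _ (by lia), policyControl_euler _ _ _ _ _ _ (by lia),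
          policyControl_regime _ _ _ _ _ _ (by lia), hopt]
        rfl
      rw [← ih (by lia), h2, h1, Finset.sum_Ico_succ_top hℓ]
      ring
  -- Without a decision at T, the regime at T is the one held just before.
  have hlast : ∫ ω, M.g (α.regime (gridTime T m m) ω) (α.euler M W x m ω) ∂P =
      ∫ ω, eulerScheme M ((T : ℝ) / m) (m - m) (α.prevRegime m ω) (α.euler M W x m ω) ∂P := by
    congr 1
    funext ω
    obtain ⟨r, hr⟩ := Nat.exists_eq_add_of_le hkm
    have h1 := policyControl_regime_last H hW hT hm hkm hpol ω (i := i) (x := x)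
    have h2 := policyControl_prevRegime H hW hT hm hkm hpol hr.ge ω (i := i) (x := x)
    rw [← hr, show r = m - k by lia] at h2
    rw [Nat.sub_self, eulerScheme_zero, hα, h1, h2]
  have hcost (ℓ : ℕ) (hℓ : ℓ ∈ Finset.Ico k m) :=
    α.integrable_cost (x := x) H hW hT hm hh (Finset.mem_Ico.1 hℓ).1
  rw [α.integral_reward H hW hT hm hh hkm, integral_finsetSum _ hcost, hlast]
  have := hstep m hkm le_rfl
  rw [Finset.sum_sub_distrib] at this
  linarith

lemma policyControl_expectedProfit (hh : (T : ℝ) / m ≤ 1)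
    (hopt : ∀ n s, eulerScheme M ((T : ℝ) / m) (n + 1) s.1 s.2 =
      continuationValue M ((T : ℝ) / m) n (pol n s) s.2 - M.c s.1 (pol n s) s.2) :
    (policyControl H hW hT hm hkm hpol i x).expectedProfit M W x =
      (eulerScheme M ((T : ℝ) / m) (m - k) i x : EReal) := by
  have hint := policyControl_integral (i := i) (x := x) H hW hT hm hkm hpol hh hopt
  have hcost := policyControl_totalCost (i := i) (x := x) H hW hT hm hkm hpol
  set α := policyControl H hW hT hm hkm hpol i x
  have hC0 (ω : Ω) : 0 ≤ ∑ ℓ ∈ Finset.Ico k m, M.c (α.prevRegime ℓ ω)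
      (α.regime (gridTime T m ℓ) ω) (α.euler M W x ℓ ω) :=
    Finset.sum_nonneg fun _ _ => H.c_nonneg _ _ _
  have hCint := integrable_finsetSum (Finset.Ico k m) fun ℓ hℓ =>
    α.integrable_cost (x := x) H hW hT hm hh (Finset.mem_Ico.1 hℓ).1
  rw [← hint, DiscreteControl.expectedProfit, funext hcost,
    ← ofReal_integral_eq_lintegral_ofReal hCint (Filter.Eventually.of_forall hC0),
    EReal.coe_ennreal_ofReal, max_eq_left (integral_nonneg hC0), EReal.coe_sub]

end Feedback

/-- Dynamic programming: the value of the discrete switching problem solves the backward scheme. -/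
theorem eulerValue_eq_eulerScheme [IsProbabilityMeasure P] (H : M.UniformBounds L ε)
    (hW : IsBrownianMotion P 𝓕 W) (hT : 0 < T) (hm : 0 < m) (hh : (T : ℝ) / m ≤ 1) (hkm : k ≤ m)
    (i : Fin q) (x : Euc d) :
    eulerValue P 𝓕 M W T m k i x = (eulerScheme M ((T : ℝ) / m) (m - k) i x : EReal) := by
  obtain ⟨pol, hpol, hopt⟩ := H.exists_measurable_policy ((T : ℝ) / m)
  refine le_antisymm (iSup_le fun α => α.expectedProfit_le H hW hT hm hh hkm) ?_
  rw [← policyControl_expectedProfit H hW hT hm hkm hpol hh hopt]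
  exact le_iSup (fun α : DiscreteControl P 𝓕 T m k i => α.expectedProfit M W x) _

end Policy

/-! ### Conclusion: dynamic programming combined with the quantization bound -/

theorem theorem4p1 {Ω : Type*} {mΩ : MeasurableSpace Ω} (P : Measure Ω) [IsProbabilityMeasure P]
    (𝓕 : Filtration ℝ≥0 mΩ) {d q : ℕ} (hd : 0 < d) (W : ℝ≥0 → Ω → Euc d)
    (hW : IsBrownianMotion P 𝓕 W) (M : SwitchingModel d q) (hM : M.StandingAssumptions)
    (T : ℝ≥0) (hT : 0 < T) :
    ∃ K : ℝ, 0 < K ∧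
      ∀ m : ℕ, 0 < m → (T : ℝ) / m ≤ 1 →
      ∀ δ R : ℝ, 0 < δ → 0 < R →
      ∀ proj : Euc d → Euc d, IsClosestNeighbour (spaceGrid d δ R) proj →
      ∀ (N : ℕ) (w : Fin N → Euc d), 0 < N → IsOptimalGrid w →
      ∀ quant : Euc d → Euc d, Measurable quant → IsClosestNeighbour (Set.range w) quant →
      ∀ k : ℕ, k ≤ m → ∀ x ∈ spaceGrid d δ R, ∀ i : Fin q,
        let h : ℝ := (T : ℝ) / m
        let e₂ : ℝ := quantError quant 2
        let e₄ : ℝ := quantError quant 4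
        ∃ v : ℝ, eulerValue P 𝓕 M W T m k i x = (v : EReal) ∧
          |v - quantizedValue M T m proj quant k i x| ≤
            K * Real.exp (K * h⁻¹ * e₂ ^ 2) * (1 + ‖x‖ + δ / h) *
              (δ / h + h ^ (-(1 / 2) : ℝ) * e₂ * (1 + ‖x‖ + δ / h) +
                1 / (R * h) * Real.exp (K * (h ^ 2)⁻¹ * e₄ ^ 4) *
                  (1 + ‖x‖ ^ 2 + (δ / h) ^ 2)) ∧
          ((∀ a b y z, M.c a b y = M.c a b z) →
            |v - quantizedValue M T m proj quant k i x| ≤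
              K * (h ^ (-(1 / 2) : ℝ) * e₂ * Real.exp (K * h⁻¹ * e₂ ^ 2) *
                    (1 + ‖x‖ + δ / h) +
                δ / h +
                1 / (R * h) * Real.exp (K * (h ^ 2)⁻¹ * e₄ ^ 4) *
                  (1 + ‖x‖ ^ 2 + (δ / h) ^ 2))) := by

  obtain ⟨L, ε, H⟩ := hM.exists_uniformBounds
  obtain ⟨K, hK, hbound⟩ := H.exists_quantization_bound hd (T := (T : ℝ)) (by exact_mod_cast hT)
  refine ⟨K, hK, ?_⟩
  intro m hm hh δ R hδ hR proj hproj N w _ _ quant hquant hnear k hkm x _ i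
  have hT' : (0 : ℝ) < T := by exact_mod_cast hT
  have hm' : (0 : ℝ) < m := by exact_mod_cast hm
  have hsteps : ((m - k : ℕ) : ℝ) * ((T : ℝ) / m) ≤ T := by
    calc ((m - k : ℕ) : ℝ) * ((T : ℝ) / m) ≤ (m : ℝ) * ((T : ℝ) / m) := by
          gcongr
          exact Nat.sub_le m k
      _ = T := mul_div_cancel₀ _ hm'.ne'
  exact ⟨eulerScheme M ((T : ℝ) / m) (m - k) i x,
    eulerValue_eq_eulerScheme H hW hT hm hh hkm i x,
    hbound ((T : ℝ) / m) (div_pos hT' hm') hh (m - k) hsteps δ R hδ hR proj hproj quant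
      (IsQuantizer.of_closestNeighbour hquant hnear) i x⟩
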